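/- Let $k$ be an algebraically closed field of characteristic $\neq 2,3$, let $C$ be a smooth projective (connected) curve of genus $g$ over $k$, and let $L$ be a line bundle of degree $h$ on $C$ with $2h \ge g+1$. Put $V_r := H^0(C, L^{r})$, and for $(a_4,a_6)\in V_4\times V_6$ put $\Delta := 4a_4^3-27a_6^2\in V_{12}$. For $c \in C$ let $\mathrm{val}_c$ denote the order of vanishing at $c$ of a section of a power of $L$ (it is $\infty$ for the zero section). For $d\in\mathbb{N}$ let $$\mathcal{K}_d := \{(a_4,a_6,c)\in V_4\times V_6\times C \mid \mathrm{val}_c(\Delta)\ge d\}\subseteq \mathbb{A}(V_4\oplus V_6)\times C,$$ and, with $D\subseteq C\times C$ the diagonal, let $$\mathcal{K}_2^+ := \{(a_4,a_6,c,c')\in V_4\times V_6\times (C\times C-D)\mid \mathrm{val}_c(\Delta)\ge 2 \text{ and } \mathrm{val}_{c'}(\Delta)\ge 2\}\subseteq \mathbb{A}(V_4\oplus V_6)\times (C\times C-D).$$ These subsets are Zariski closed, and: (a) $\mathcal{K}_d$ has codimension $d$ in $\mathbb{A}(V_4\oplus V_6)\times C$ for every $d\le 3$. (b) $\mathcal{K}_2$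 has exactly two irreducible components $\mathcal{K}_2(\mathrm{I}_2)$ and $\mathcal{K}_2(\mathrm{II})$: the first is the closure of the locus in $\mathcal{K}_2$ where $\mathrm{val}_c(a_6)=0$, and the second is the locus in $\mathcal{K}_2$ where $\mathrm{val}_c(a_6)\ge 1$. (c) $\mathcal{K}_2^+$ has codimension $4$ in $\mathbb{A}(V_4\oplus V_6)\times (C\times C-D)$. -/

import Mathlib

open AlgebraicGeometry CategoryTheory CategoryTheory.Limits TopologicalSpace

universe u

noncomputable section

namespace EllBertini

/-! ### Codimension -/

/-- The codimension of a closed subset `Z` of a topological space `Y`: the infimum, over the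
irreducible closed subsets `T ⊆ Z`, of the supremum of the lengths of chains
`T = T₀ ⊊ T₁ ⊊ ⋯ ⊊ Tₑ` of irreducible closed subsets of `Y`. -/
def codim {Y : Type*} [TopologicalSpace Y] (Z : Set Y) : ℕ∞ :=
  ⨅ (T : IrreducibleCloseds Y) (_ : (T : Set Y) ⊆ Z), Order.coheight T

variable (k : Type u) [Field k]

/-! ### `k`-points of `k`-schemes and affine spaces -/

/-- The set `X(k)` of `k`-points of a `k`-scheme `X`. -/
def Pt (X : Scheme.{u}) [X.Over (Spec (.of k))] : Type u :=
  {p : Spec (.of k) ⟶ X // p ≫ (X ↘ Spec (.of k)) = 𝟙 _}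

variable {k}

/-- The point of the underlying space of `X` at which a `k`-point is located. -/
def Pt.point {X : Scheme.{u}} [X.Over (Spec (.of k))] (p : Pt k X) : X :=
  p.1 (IsLocalRing.closedPoint k)

variable (k)

/-- The affine space `𝔸(V) = Spec (Sym V^∨)` of a `k`-vector space `V`. -/
def affSpace (V : Type u) [AddCommGroup V] [Module k V] : Scheme.{u} :=
  Spec (.of (SymmetricAlgebra k (Module.Dual k V)))

instance (V : Type u) [AddCommGroup V] [Module k V] : (affSpace k V).Over (Spec (.of k)) where
  hom := Spec.map (CommRingCat.ofHom (algebraMap k (SymmetricAlgebra k (Module.Dual k V))))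

variable {k}

/-- A vector `v ∈ V` as a `k`-point of `𝔸(V)`: it corresponds to the `k`-algebra map
`Sym V^∨ → k` that sends a linear form `ℓ` to `ℓ v`. -/
def vecPt {V : Type u} [AddCommGroup V] [Module k V] (v : V) : Pt k (affSpace k V) :=
  ⟨Spec.map (CommRingCat.ofHom
      (SymmetricAlgebra.lift (Module.Dual.eval k V v) :
        SymmetricAlgebra k (Module.Dual k V) →ₐ[k] k).toRingHom), by
    change Spec.map _ ≫ Spec.map _ = _
    rw [← Spec.map_comp, ← CommRingCat.ofHom_comp, ← Spec.map_id]
    congr 1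
    ext x
    simp⟩

/-- The fibre product `X ×_k Y` of two `k`-schemes. -/
abbrev prodOver (k : Type u) [Field k] (X Y : Scheme.{u}) [X.Over (Spec (.of k))]
    [Y.Over (Spec (.of k))] : Scheme.{u} :=
  pullback (X ↘ Spec (.of k)) (Y ↘ Spec (.of k))

instance (X Y : Scheme.{u}) [X.Over (Spec (.of k))] [Y.Over (Spec (.of k))] :
    (prodOver k X Y).Over (Spec (.of k)) where
  hom := pullback.fst _ _ ≫ (X ↘ Spec (.of k))

/-- The `k`-point `(p, q)` of `X ×_k Y`. -/
def Pt.prod {X Y : Scheme.{u}} [X.Over (Spec (.of k))] [Y.Over (Spec (.of k))]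
    (p : Pt k X) (q : Pt k Y) : Pt k (prodOver k X Y) :=
  ⟨pullback.lift p.1 q.1 (p.2.trans q.2.symm), by
    change _ ≫ pullback.fst _ _ ≫ _ = _
    rw [pullback.lift_fst_assoc, p.2]⟩

/-! ### The `k`-linear structure on functions -/

section Functions

variable (C : Scheme.{u}) [C.Over (Spec (.of k))]

instance (priority := 10000) sectionsAlgebra (U : C.Opens) : Algebra k Γ(C, U) :=
  (((Scheme.ΓSpecIso (.of k)).inv ≫ (C ↘ Spec (.of k)).appTop ≫
    C.presheaf.map (homOfLE le_top).op).hom : k →+* Γ(C, U)).toAlgebra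

instance (priority := 10000) stalkAlgebra (x : C) : Algebra k (C.presheaf.stalk x) :=
  (((Scheme.ΓSpecIso (.of k)).inv ≫ (C ↘ Spec (.of k)).appTop ≫
    C.presheaf.germ ⊤ x (Opens.mem_top x)).hom : k →+* C.presheaf.stalk x).toAlgebra

instance [IrreducibleSpace C] (x : C) :
    IsScalarTower k (C.presheaf.stalk x) C.functionField := by
  refine IsScalarTower.of_algebraMap_eq fun a => ?_
  exact (C.presheaf.germ_stalkSpecializes_apply (Opens.mem_top x)
    ((genericPoint_spec C).specializes trivial)
    (((Scheme.ΓSpecIso (.of k)).inv ≫ (C ↘ Spec (.of k)).appTop).hom a)).symm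

end Functions

/-! ### The genus of a curve -/

section Genus

variable (k) (C : Scheme.{u}) [C.Over (Spec (.of k))] [IrreducibleSpace C]

/-- The local ring `𝒪_{C,x}` as a `k`-subspace of the function field. -/
def localRing (x : C) : Submodule k C.functionField :=
  (IsScalarTower.toAlgHom k (C.presheaf.stalk x) C.functionField).range.toSubmodule

/-- The space of repartitions: families `(r_x)` of rational functions indexed by the closed points
of `C`, with `r_x ∈ 𝒪_{C,x}` for almost all `x`. -/
def repartitions : Submodule k (closedPoints C → C.functionField) where
  carrier := {r | {x | r x ∉ localRing k C x.1}.Finite}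
  zero_mem' := by
    refine Set.finite_empty.subset fun x hx => ?_
    exact hx (localRing k C x.1).zero_mem
  add_mem' := by
    intro r s hr hs
    refine Set.Finite.subset (Set.Finite.union hr hs) fun x hx => ?_
    by_contra h
    rw [Set.mem_union, not_or] at h
    have h1 : r x ∈ localRing k C x.1 := not_not.mp h.1
    have h2 : s x ∈ localRing k C x.1 := not_not.mp h.2
    exact hx ((localRing k C x.1).add_mem h1 h2)
  smul_mem' := by
    intro a r hr
    refine Set.Finite.subset hr fun x hx h => ?_
    exact hx ((localRing k C x.1).smul_mem a h)

/-- Families `(r_x)` with `r_x ∈ 𝒪_{C,x}` for all closed points `x`. -/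
def integralRepartitions : Submodule k (closedPoints C → C.functionField) :=
  Submodule.pi Set.univ fun x => localRing k C x.1

/-- Constant families of rational functions. -/
def principalRepartitions : Submodule k (closedPoints C → C.functionField) :=
  LinearMap.range (LinearMap.pi fun _ => LinearMap.id :
    C.functionField →ₗ[k] closedPoints C → C.functionField)

/-- The genus `dim_k H¹(C, 𝒪_C)` of a smooth projective curve `C` with function field `K`. The
flasque resolution `0 → 𝒪_C → K → ⨁ₓ K/𝒪_{C,x} → 0` identifies `H¹(C, 𝒪_C)` with the cokernel of
`K → ⨁ₓ K/𝒪_{C,x}`, that is, with `R/(R(0) + K)`, where `R` is the space of repartitions and `R(0)`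
is the space of integral ones. -/
def genus : ℕ :=
  Module.finrank k (repartitions k C ⧸
    (integralRepartitions k C ⊔ principalRepartitions k C).comap (repartitions k C).subtype)

end Genus

/-! ### Line bundles -/

/-- A line bundle on a scheme `C`, given by an open cover and transition functions
`g i j ∈ 𝒪(U i ∩ U j)ˣ` that satisfy the cocycle condition. -/
structure LineBundle (C : Scheme.{u}) where
  /-- the index set of the cover -/
  ι : Type u
  /-- the opens over which the bundle is trivialised -/
  U : ι → C.Opens
  /-- the opens cover `C` -/
  cover : ∀ x : C, ∃ i, x ∈ U i
  /-- the transition functions -/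
  g : ∀ i j, Γ(C, U i ⊓ U j)ˣ
  /-- the cocycle condition on `U i ∩ U j ∩ U l` -/
  cocycle : ∀ i j l,
    C.presheaf.map (homOfLE inf_le_left : U i ⊓ U j ⊓ U l ⟶ U i ⊓ U j).op (g i j).1 *
      C.presheaf.map (homOfLE (inf_le_inf_right _ inf_le_right) :
        U i ⊓ U j ⊓ U l ⟶ U j ⊓ U l).op (g j l).1 =
      C.presheaf.map (homOfLE (inf_le_inf_right _ inf_le_left) :
        U i ⊓ U j ⊓ U l ⟶ U i ⊓ U l).op (g i l).1

namespace LineBundle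

variable {C : Scheme.{u}} (L : LineBundle C)

/-- The tensor power `L^r`. -/
@[reducible] def pow (r : ℕ) : LineBundle C where
  ι := L.ι
  U := L.U
  cover := L.cover
  g i j := L.g i j ^ r
  cocycle i j l := by
    simp only [Units.val_pow_eq_pow_val, map_pow]
    rw [← mul_pow, L.cocycle]

/-- An index of a member of the cover that contains `x`. -/
def idx (x : C) : L.ι := (L.cover x).choose

lemma mem_idx (x : C) : x ∈ L.U (L.idx x) := (L.cover x).choose_spec

/-- The space `H⁰(C, L)` of global sections: families `s i ∈ 𝒪(U i)` with `s i = g i j * s j` on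
`U i ∩ U j`. -/
def H0 (k : Type u) [Field k] [C.Over (Spec (.of k))] : Submodule k (∀ i, Γ(C, L.U i)) where
  carrier := {s | ∀ i j,
    C.presheaf.map (homOfLE inf_le_left : L.U i ⊓ L.U j ⟶ L.U i).op (s i) =
      (L.g i j).1 * C.presheaf.map (homOfLE inf_le_right : L.U i ⊓ L.U j ⟶ L.U j).op (s j)}
  zero_mem' i j := by simp
  add_mem' {s t} hs ht i j := by
    simp only [Pi.add_apply, map_add, mul_add]
    rw [hs i j, ht i j]
  smul_mem' a s hs i j := by
    have key : ∀ (U V : C.Opens) (h : U ≤ V),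
        C.presheaf.map (homOfLE h).op (algebraMap k Γ(C, V) a) = algebraMap k Γ(C, U) a := by
      intro U V h
      have e : C.presheaf.map (homOfLE (le_top : U ≤ ⊤)).op =
          C.presheaf.map (homOfLE (le_top : V ≤ ⊤)).op ≫ C.presheaf.map (homOfLE h).op := by
        rw [← C.presheaf.map_comp]
        rfl
      change _ = C.presheaf.map (homOfLE (le_top : U ≤ ⊤)).op _
      rw [e]
      rfl
    simp only [Pi.smul_apply, Algebra.smul_def, map_mul]
    rw [hs i j, key, key]
    ring

/-- The order of vanishing `val_c(s)` of a global section `s` of `L` at a point `x`, read off in a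
local trivialisation around `x`; it is `⊤` for the zero section. -/
def val {k : Type u} [Field k] [C.Over (Spec (.of k))] (s : L.H0 k) (x : C) : ℕ∞ :=
  Ring.ord (C.presheaf.stalk x) (C.presheaf.germ (L.U (L.idx x)) x (L.mem_idx x) (s.1 (L.idx x)))

/-- The rational section of `L` that is `1` in the trivialisation around the generic point, written
as a rational function in the trivialisation around `x`. -/
def ratSection [IrreducibleSpace C] (x : C) : C.functionField :=
  C.presheaf.germ (L.U (L.idx x) ⊓ L.U (L.idx (genericPoint C))) (genericPoint C)
    ⟨((genericPoint_spec C).mem_open_set_iff (L.U (L.idx x)).isOpen).mpr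
      ⟨x, trivial, L.mem_idx x⟩, L.mem_idx _⟩
    (L.g (L.idx x) (L.idx (genericPoint C))).1

/-- The degree of a line bundle on a curve over an algebraically closed field: the degree of the
divisor of a nonzero rational section. -/
def degree (k : Type u) [Field k] [C.Over (Spec (.of k))]
    [LocallyOfFiniteType (C ↘ Spec (.of k))] [AlgebraicGeometry.IsIntegral C] : ℤ :=
  haveI : IsLocallyNoetherian C := LocallyOfFiniteType.isLocallyNoetherian (C ↘ Spec (.of k))
  ∑ᶠ x : C, C.ord (L.ratSection x) x

variable (k : Type u) [Field k] [C.Over (Spec (.of k))]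

/-- The space `V_r = H⁰(C, L^r)`. -/
abbrev V (r : ℕ) : Submodule k (∀ i, Γ(C, L.U i)) := (L.pow r).H0 k

variable {k}

/-- The discriminant `Δ = 4 a₄³ - 27 a₆² ∈ V₁₂`. -/
def disc (a₄ : L.V k 4) (a₆ : L.V k 6) : L.V k 12 :=
  ⟨fun i => 4 * a₄.1 i ^ 3 - 27 * a₆.1 i ^ 2, fun i j => by
    have h4 := a₄.2 i j
    have h6 := a₆.2 i j
    simp only [Units.val_pow_eq_pow_val] at h4 h6 ⊢
    simp only [map_sub, map_mul, map_pow, map_ofNat]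
    rw [h4, h6]
    ring⟩

/-! ### The loci -/

variable (k)

/-- The set `V₄ × V₆ × C(k)` of closed points of `𝔸(V₄ ⊕ V₆) × C`. -/
structure Param where
  /-- the section of `L⁴` -/
  a₄ : L.V k 4
  /-- the section of `L⁶` -/
  a₆ : L.V k 6
  /-- the point of the curve -/
  c : Pt k C

/-- The Zariski topology on `V₄ × V₆ × C(k)`, induced from the scheme `𝔸(V₄ ⊕ V₆) × C`. -/
instance : TopologicalSpace (L.Param k) :=
  TopologicalSpace.induced
    (fun p => ((vecPt (k := k) (p.a₄, p.a₆)).prod p.c).point) inferInstance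

/-- The set `V₄ × V₆ × (C × C - D)(k)` of closed points of `𝔸(V₄ ⊕ V₆) × (C × C - D)`, where `D` is
the diagonal. -/
structure Param₂ where
  /-- the section of `L⁴` -/
  a₄ : L.V k 4
  /-- the section of `L⁶` -/
  a₆ : L.V k 6
  /-- the first point of the curve -/
  c : Pt k C
  /-- the second point of the curve -/
  c' : Pt k C
  /-- the two points are distinct -/
  ne : c ≠ c'

/-- The Zariski topology on `V₄ × V₆ × (C × C - D)(k)`, induced from the scheme
`𝔸(V₄ ⊕ V₆) × (C × C)`. -/
instance : TopologicalSpace (L.Param₂ k) :=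
  TopologicalSpace.induced
    (fun p => ((vecPt (k := k) (p.a₄, p.a₆)).prod (p.c.prod p.c')).point) inferInstance

/-- The locus `𝒦_d` where `val_c(Δ) ≥ d`. -/
def K (d : ℕ) : Set (L.Param k) :=
  {p | (d : ℕ∞) ≤ (L.pow 12).val (L.disc p.a₄ p.a₆) p.c.point}

/-- The locus `𝒦₂⁺` where `val_c(Δ) ≥ 2` and `val_{c'}(Δ) ≥ 2`. -/
def K₂plus : Set (L.Param₂ k) :=
  {p | 2 ≤ (L.pow 12).val (L.disc p.a₄ p.a₆) p.c.point ∧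
    2 ≤ (L.pow 12).val (L.disc p.a₄ p.a₆) p.c'.point}

/-- The component `𝒦₂(I₂)` of `𝒦₂`: the closure in `𝒦₂` of the locus where `val_c(a₆) = 0`. -/
def K₂I₂ : Set (L.K k 2) :=
  closure {p | (L.pow 6).val p.1.a₆ p.1.c.point = 0}

/-- The component `𝒦₂(II)` of `𝒦₂`: the locus where `val_c(a₆) ≥ 1`. -/
def K₂II : Set (L.K k 2) :=
  {p | 1 ≤ (L.pow 6).val p.1.a₆ p.1.c.point}

end LineBundle

end EllBertini

end

/-! Local picture. In a coordinate t at c write a₄ = α + α't + … and a₆ = β + β't + … . Then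
val_c(Δ) ≥ 1 says that (α, β) lies on the cuspidal cubic 4α³ = 27β², that is, (α, β) = (3x², 2x³)
for some x. Given this, the next coefficient of Δ is 108x³(xα' − β'). Hence val_c(Δ) ≥ 2 happens in
exactly two ways: x ≠ 0 and β' = xα' (type `node`), or x = 0 (type `cusp`). The parametrization is
`Chart.holds_iff`. Global input. From 2h ≥ g + 1 come 4h ≥ 2g + 2 and 6h ≥ 2g + 3. Riemann–Roch for
repartitions (`Places.hasIndex`) gives H¹ = 0 in degree at least 2g − 1 (`Places.exists_approx`). So
at two distinct points one may prescribe jets of total length 3 for sections of L⁴ and of total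
length 4 for sections of L⁶ (`exists_section_sub_mem`, `Chart.exists_jet_eq`). The finiteness of
H¹(0) that this needs is `finiteDimensional_H1_curve`. Irreducibility. The locus of pairs of
sections with given types at two distinct points is irreducible (`isIrreducible_typeLocus`). A pair
of sections of given type extends, keeping its type, when either point moves
(`exists_ne_zero_forall_exists_mem`), and for fixed points two such pairs are joined by a family
over a line (`exists_mem_inter_of_eq`). Both rest on `exists_family`, where a family of sections is
corrected by Cramer's rule until its jets have the required form. Codimension. Below: closures of
type loci form strict chains such as any ⊃ singular ⊃ node or cusp, strictness being witnessed by
explicit jets, while 𝒦₂ is the union of the node and cusp loci and 𝒦₃ contains neither of them.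
Above: near a zero pair of sections 𝒦_d is cut out by d functions, the first Taylor coefficients of
Δ, and Krull's height theorem applies (`codim_le`). For 𝒦₂⁺ the same is done at both points.
Components. The closure of the node locus and the cusp locus cover 𝒦₂. The equation 3β'² = αα'²
holds on nodes but not on all cusps, so neither contains the other. -/

noncomputable section

namespace EllBertini

section

/-! ### Taylor expansions on an algebra whose differentials are generated by one `dt` -/

section Taylor

open scoped TensorProduct

variable {k B : Type*} [Field k] [CommRing B] [Algebra k B]

/-- The element `1 ⊗ t - t ⊗ 1` of the ideal of the diagonal. -/
def diagElt (k : Type*) {B : Type*} [Field k] [CommRing B] [Algebra k B] (t : B) : B ⊗[k] B :=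
  1 ⊗ₜ[k] t - t ⊗ₜ[k] 1

lemma diagElt_mem (t : B) : diagElt k t ∈ KaehlerDifferential.ideal k B := by
  simp [diagElt, KaehlerDifferential.ideal, RingHom.mem_ker]

/-- With J the ideal of the diagonal, Ω is J/J² and dt is the class of δ = 1 ⊗ t − t ⊗ 1, so
generation by dt is the assertion J ⊆ (δ) + J². -/
lemma diagIdeal_le (t : B) (ht : Submodule.span B {KaehlerDifferential.D k B t} = ⊤) :
    KaehlerDifferential.ideal k B ≤
      Ideal.span {diagElt k t} ⊔ KaehlerDifferential.ideal k B ^ 2 := by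
  intro x hx
  have h : KaehlerDifferential.fromIdeal k B ⟨x, hx⟩ ∈
      Submodule.span B {KaehlerDifferential.D k B t} := ht ▸ Submodule.mem_top
  obtain ⟨b, hb⟩ := Submodule.mem_span_singleton.mp h
  have e : KaehlerDifferential.D k B t =
      KaehlerDifferential.fromIdeal k B ⟨diagElt k t, diagElt_mem t⟩ := rfl
  have e2 : b • KaehlerDifferential.fromIdeal k B ⟨diagElt k t, diagElt_mem t⟩ =
      KaehlerDifferential.fromIdeal k B
        ((b ⊗ₜ[k] (1 : B)) • ⟨diagElt k t, diagElt_mem t⟩) := by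
    rw [map_smul, ← algebraMap_smul (B ⊗[k] B) b]
    rfl
  rw [e, e2] at hb
  have h3 := (Ideal.toCotangent_eq _).mp hb
  simp only [SetLike.val_smul, smul_eq_mul] at h3
  have : x = (b ⊗ₜ[k] (1 : B)) * diagElt k t - ((b ⊗ₜ[k] (1 : B)) * diagElt k t - x) := by ring
  rw [this]
  exact Submodule.sub_mem_sup (Ideal.mul_mem_left _ _ (Ideal.mem_span_singleton_self _)) h3

/-- Multiply the bound for J^d by the one for J: the only product of summands that does not already
lie in J^(d+2) is the one generated by δ^(d+1). -/
lemma diagIdeal_pow_le (t : B) (ht : Submodule.span B {KaehlerDifferential.D k B t} = ⊤) (d : ℕ) :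
    KaehlerDifferential.ideal k B ^ d ≤
      Ideal.span {diagElt k t ^ d} ⊔ KaehlerDifferential.ideal k B ^ (d + 1) := by
  set J := KaehlerDifferential.ideal k B
  have hδ : diagElt k t ∈ J := diagElt_mem t
  induction d with
  | zero => simp
  | succ d ih =>
    calc J ^ (d + 1) = J ^ d * J := pow_succ _ _
      _ ≤ (Ideal.span {diagElt k t ^ d} ⊔ J ^ (d + 1)) * (Ideal.span {diagElt k t} ⊔ J ^ 2) :=
        Ideal.mul_mono ih (diagIdeal_le t ht)
      _ ≤ _ := by
        rw [Ideal.sup_mul, Ideal.mul_sup, Ideal.mul_sup, Ideal.span_singleton_mul_span_singleton,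
          ← pow_succ, ← pow_add]
        refine sup_le (sup_le le_sup_left (le_sup_of_le_right ?_))
          (sup_le (le_sup_of_le_right ?_) (le_sup_of_le_right (Ideal.pow_le_pow_right (by omega))))
        · rw [pow_add _ d 2]
          refine Ideal.mul_mono_left ?_
          rw [Ideal.span_singleton_le_iff_mem]
          exact Ideal.pow_mem_pow hδ d
        · rw [pow_succ _ (d + 1)]
          refine Ideal.mul_mono_right ?_
          rwa [Ideal.span_singleton_le_iff_mem]

/-- Successive approximation: an error in J^d equals wδ^d modulo J^(d+1), and w may be replaced by
μ(w) ⊗ 1, with μ the multiplication map, because w − μ(w) ⊗ 1 lies in J. -/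
lemma exists_diag_expansion (t : B) (ht : Submodule.span B {KaehlerDifferential.D k B t} = ⊤)
    (d : ℕ) (z : B ⊗[k] B) : ∃ b : ℕ → B,
      z - ∑ l ∈ Finset.range d, (b l ⊗ₜ[k] (1 : B)) * diagElt k t ^ l ∈
        KaehlerDifferential.ideal k B ^ d := by
  set J := KaehlerDifferential.ideal k B
  induction d with
  | zero => exact ⟨0, by simp⟩
  | succ d ih =>
    obtain ⟨b, hb⟩ := ih
    obtain ⟨y, hy, y', hy', hyy⟩ := Submodule.mem_sup.mp (diagIdeal_pow_le t ht d hb)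
    obtain ⟨w, rfl⟩ := Ideal.mem_span_singleton'.mp hy
    let μ := Algebra.TensorProduct.lmul' (S := B) k
    have hw : w - μ w ⊗ₜ[k] (1 : B) ∈ J := by
      simp [J, KaehlerDifferential.ideal, RingHom.mem_ker, μ]
    refine ⟨Function.update b d (μ w), ?_⟩
    rw [Finset.sum_range_succ]
    have h1 : ∑ l ∈ Finset.range d,
        (Function.update b d (μ w) l ⊗ₜ[k] (1 : B)) * diagElt k t ^ l =
        ∑ l ∈ Finset.range d, (b l ⊗ₜ[k] (1 : B)) * diagElt k t ^ l :=
      Finset.sum_congr rfl fun l hl => by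
        rw [Function.update_of_ne (Finset.mem_range.mp hl).ne]
    rw [h1, Function.update_self, ← sub_sub, ← hyy]
    have : w * diagElt k t ^ d + y' - μ w ⊗ₜ[k] (1 : B) * diagElt k t ^ d =
      diagElt k t ^ d * (w - μ w ⊗ₜ[k] (1 : B)) + y' := by ring
    rw [this]
    exact Ideal.add_mem _ (pow_succ J d ▸
      Ideal.mul_mem_mul (Ideal.pow_mem_pow (diagElt_mem t) d) hw) hy'

/-- If the differentials of `B` are generated by `dt`, then there are `k`-linear operators `D l` on
`B` whose values at a `k`-point `c` are the Taylor coefficients at `c`. -/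
theorem exists_taylor (t : B) (ht : Submodule.span B {KaehlerDifferential.D k B t} = ⊤) (d : ℕ) :
    ∃ D : ℕ → (B →ₗ[k] B), ∀ (c : B →ₐ[k] k) (f : B),
      f - ∑ l ∈ Finset.range d,
        algebraMap k B (c (D l f)) * (t - algebraMap k B (c t)) ^ l ∈ RingHom.ker c ^ d := by
  choose b hb using fun f : B => exists_diag_expansion t ht d (1 ⊗ₜ[k] f)
  -- The coefficients were chosen for each f separately. Keeping the choice only on a `k`-basis and
  -- extending linearly makes the operators linear, and the congruence to be proved is linear in f.
  let e := Module.Basis.ofVectorSpace k B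
  refine ⟨fun l => e.constr k fun i => b (e i) l, fun c => ?_⟩
  -- Evaluation of the first factor at c. It sends 1 ⊗ t − t ⊗ 1 to t − t(c) and the ideal of the
  -- diagonal into ker c, so it turns the expansion along the diagonal into the Taylor expansion at
  -- c.
  let φ : B ⊗[k] B →ₐ[k] B :=
    Algebra.TensorProduct.lift ((Algebra.ofId k B).comp c) (AlgHom.id k B) fun _ _ => .all _ _
  have hφ : KaehlerDifferential.ideal k B ≤ (RingHom.ker c).comap φ := by
    intro x hx
    have h1 : c.comp φ = c.comp (Algebra.TensorProduct.lmul' (S := B) k) := by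
      ext a
      · simp [φ, Algebra.ofId_apply]
      · simp [φ]
    have h2 := DFunLike.congr_fun h1 x
    simp only [AlgHom.comp_apply] at h2
    rw [Ideal.mem_comap, RingHom.mem_ker, h2]
    have : Algebra.TensorProduct.lmul' (S := B) k x = 0 := hx
    rw [this, map_zero]
  have key : ∀ i, e i - ∑ l ∈ Finset.range d,
      algebraMap k B (c (b (e i) l)) * (t - algebraMap k B (c t)) ^ l ∈ RingHom.ker c ^ d := by
    intro i
    have h1 := Ideal.pow_right_mono hφ d (hb (e i))
    have h2 := Ideal.le_comap_pow _ _ h1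
    rw [Ideal.mem_comap] at h2
    simpa [φ, diagElt, Algebra.ofId_apply] using h2
  let T : B →ₗ[k] B := LinearMap.id - ∑ l ∈ Finset.range d,
    (LinearMap.mulRight k ((t - algebraMap k B (c t)) ^ l)).comp
      ((Algebra.linearMap k B).comp (c.toLinearMap.comp (e.constr k fun i => b (e i) l)))
  have hT : ∀ f, T f = f - ∑ l ∈ Finset.range d, algebraMap k B
      (c ((e.constr k fun i => b (e i) l) f)) * (t - algebraMap k B (c t)) ^ l := by
    intro f
    simp [T, LinearMap.sum_apply]
  intro f
  rw [← hT]
  have : (⊤ : Submodule k B) ≤ ((RingHom.ker c ^ d).restrictScalars k).comap T := by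
    rw [← e.span_eq, Submodule.span_le]
    rintro _ ⟨i, rfl⟩
    have := key i
    simp only [SetLike.mem_coe, Submodule.mem_comap, Submodule.restrictScalars_mem, hT]
    simpa using this
  exact this (Submodule.mem_top : f ∈ ⊤)

end Taylor

end

section

/-! ### Indices of pairs of subspaces -/

section Index

variable {k U W : Type*} [Field k] [AddCommGroup U] [Module k U] [AddCommGroup W] [Module k W]

/-- The linear map `ι : U → W` is Fredholm of index `n` relative to the subspace `X` of `W`. -/
def HasIndex (ι : U →ₗ[k] W) (X : Submodule k W) (n : ℤ) : Prop :=
  FiniteDimensional k (X.comap ι) ∧ FiniteDimensional k (W ⧸ (X ⊔ LinearMap.range ι)) ∧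
    (Module.finrank k (X.comap ι) : ℤ) = Module.finrank k (W ⧸ (X ⊔ LinearMap.range ι)) + n

lemma finrank_sup_span_singleton_of_notMem {S : Submodule k U} {u : U} (hu : u ∉ S)
    [FiniteDimensional k S] :
    Module.finrank k ↥(S ⊔ Submodule.span k {u}) = Module.finrank k S + 1 := by
  have hu0 : u ≠ 0 := fun h => hu (h ▸ S.zero_mem)
  have h := Submodule.finrank_sup_add_finrank_inf_eq S (Submodule.span k {u})
  have h2 : S ⊓ Submodule.span k {u} = ⊥ :=
    (Submodule.disjoint_span_singleton' hu0 |>.mpr hu).eq_bot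
  rw [h2, finrank_bot, finrank_span_singleton hu0] at h
  omega

lemma finiteDimensional_quotient_sup_span_singleton {Y : Submodule k W} {w : W}
    (hw : w ∉ Y) :
    (FiniteDimensional k (W ⧸ Y) ↔ FiniteDimensional k (W ⧸ (Y ⊔ Submodule.span k {w}))) ∧
    (FiniteDimensional k (W ⧸ Y) →
      Module.finrank k (W ⧸ Y) = Module.finrank k (W ⧸ (Y ⊔ Submodule.span k {w})) + 1) := by
  have e := Submodule.quotientQuotientEquivQuotientSup Y (Submodule.span k {w})
  have hm : (Submodule.span k {w}).map Y.mkQ = Submodule.span k {Y.mkQ w} := by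
    rw [Submodule.map_span, Set.image_singleton]
  rw [hm] at e
  have h0 : Y.mkQ w ≠ 0 := by simpa using hw
  refine ⟨⟨fun _ => Module.Finite.equiv e, fun _ => ?_⟩, fun _ => ?_⟩
  · have := Module.Finite.equiv e.symm
    exact Module.Finite.of_submodule_quotient (Submodule.span k {Y.mkQ w})
  · have h := Submodule.finrank_quotient_add_finrank (Submodule.span k {Y.mkQ w})
    rw [finrank_span_singleton h0, e.finrank_eq] at h
    omega

/-- If w already lies in X + range ι, the new vector enlarges the preimage by one dimension and
leaves the cokernel alone; otherwise it shrinks the cokernel by one dimension and leaves the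
preimage alone. Either way the index grows by one. -/
lemma hasIndex_sup_span_singleton (ι : U →ₗ[k] W) (X : Submodule k W) {w : W} (hw : w ∉ X)
    (n : ℤ) : HasIndex ι X n ↔ HasIndex ι (X ⊔ Submodule.span k {w}) (n + 1) := by
  unfold HasIndex
  have hsup : X ⊔ Submodule.span k {w} ⊔ LinearMap.range ι =
      X ⊔ LinearMap.range ι ⊔ Submodule.span k {w} := sup_right_comm _ _ _
  rw [hsup]
  by_cases h : w ∈ X ⊔ LinearMap.range ι
  · obtain ⟨x, hx, _, ⟨u, rfl⟩, rfl⟩ := Submodule.mem_sup.mp h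
    have h1 : X ⊔ LinearMap.range ι ⊔ Submodule.span k {x + ι u} = X ⊔ LinearMap.range ι :=
      sup_eq_left.mpr ((Submodule.span_singleton_le_iff_mem _ _).mpr h)
    have hu : u ∉ X.comap ι := fun hu => hw (X.add_mem hx hu)
    have h2 : (X ⊔ Submodule.span k {x + ι u}).comap ι = X.comap ι ⊔ Submodule.span k {u} := by
      apply le_antisymm
      · intro y hy
        obtain ⟨x', hx', a, ha⟩ := Submodule.mem_sup.mp hy
        obtain ⟨ha, hay⟩ := ha
        obtain ⟨b, rfl⟩ := Submodule.mem_span_singleton.mp ha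
        have : y = (y - b • u) + b • u := by abel
        rw [this]
        refine Submodule.add_mem_sup ?_ (Submodule.smul_mem _ _ (Submodule.mem_span_singleton_self u))
        rw [Submodule.mem_comap, map_sub, map_smul, ← hay, smul_add]
        have : x' + (b • x + b • ι u) - b • ι u = x' + b • x := by abel
        rw [this]
        exact X.add_mem hx' (X.smul_mem _ hx)
      · refine sup_le (Submodule.comap_mono le_sup_left) ?_
        rw [Submodule.span_singleton_le_iff_mem, Submodule.mem_comap]
        have := Submodule.add_mem_sup (X.neg_mem hx)
          (Submodule.mem_span_singleton_self (R := k) (x + ι u))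
        rwa [neg_add_cancel_left] at this
    rw [h1, h2]
    constructor
    · rintro ⟨h3, h4, h5⟩
      refine ⟨inferInstance, h4, ?_⟩
      rw [finrank_sup_span_singleton_of_notMem hu]
      push_cast
      linarith
    · rintro ⟨h3, h4, h5⟩
      have : FiniteDimensional k (X.comap ι) :=
        Submodule.finiteDimensional_of_le (le_sup_left (b := Submodule.span k {u}))
      refine ⟨this, h4, ?_⟩
      rw [finrank_sup_span_singleton_of_notMem hu] at h5
      push_cast at h5
      linarith
  · have h2 : (X ⊔ Submodule.span k {w}).comap ι = X.comap ι := by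
      refine le_antisymm (fun y hy => ?_) (Submodule.comap_mono le_sup_left)
      obtain ⟨x', hx', a, ha, hay⟩ := Submodule.mem_sup.mp hy
      obtain ⟨b, rfl⟩ := Submodule.mem_span_singleton.mp ha
      by_cases hb : b = 0
      · rw [Submodule.mem_comap, ← hay, hb, zero_smul, add_zero]
        exact hx'
      · exfalso
        apply h
        have : w = b⁻¹ • (-x' + ι y) := by
          rw [← hay, neg_add_cancel_left, smul_smul, inv_mul_cancel₀ hb, one_smul]
        rw [this]
        exact Submodule.smul_mem _ _ (Submodule.add_mem_sup (X.neg_mem hx') ⟨y, rfl⟩)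
    rw [h2]
    obtain ⟨hf, hr⟩ := finiteDimensional_quotient_sup_span_singleton h
    constructor
    · rintro ⟨h3, h4, h5⟩
      refine ⟨h3, hf.mp h4, ?_⟩
      rw [hr h4] at h5
      push_cast at h5
      linarith
    · rintro ⟨h3, h4, h5⟩
      refine ⟨h3, hf.mpr h4, ?_⟩
      rw [hr (hf.mpr h4)]
      push_cast
      linarith

end Index

/-! ### Repartitions on a family of places -/

open WithZero

/-- A family of discrete valuations on a field `K` over `k`, with residue field `k`, such that an
element of `K` has finitely many poles, and none only if it is constant. -/
structure Places (k K P : Type*) [Field k] [Field K] [Algebra k K] where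
  /-- the valuation rings -/
  O : P → Submodule k K
  /-- the valuations -/
  v : P → Valuation K ℤᵐ⁰
  mem_O : ∀ c x, x ∈ O c ↔ v c x ≤ 1
  /-- the uniformizers -/
  π : P → K
  v_π : ∀ c, v c (π c) = exp (-1)
  residue : ∀ c x, v c x ≤ 1 → ∃ a : k, v c (x - algebraMap k K a) ≤ exp (-1)
  finite : ∀ x, {c | x ∉ O c}.Finite
  const : ∀ x, (∀ c, x ∈ O c) → ∃ a : k, algebraMap k K a = x

namespace Places

variable {k K P : Type*} [Field k] [Field K] [Algebra k K] (S : Places k K P)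

lemma v_algebraMap_le (c : P) (a : k) : S.v c (algebraMap k K a) ≤ 1 := by
  rw [← S.mem_O, Algebra.algebraMap_eq_smul_one]
  exact (S.O c).smul_mem _ ((S.mem_O c 1).mpr (map_one _).le)

lemma v_smul_le (c : P) (a : k) (x : K) : S.v c (a • x) ≤ S.v c x := by
  rw [Algebra.smul_def, map_mul]
  exact mul_le_of_le_one_left' (S.v_algebraMap_le c a)

lemma π_ne (c : P) : S.π c ≠ 0 := by
  intro h
  have := S.v_π c
  rw [h, map_zero] at this
  exact exp_ne_zero this.symm

lemma v_π_zpow (c : P) (n : ℤ) : S.v c (S.π c ^ n) = exp (-n) := by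
  rw [map_zpow₀, S.v_π, ← exp_zsmul]
  simp

/-- The space of repartitions of a family of subspaces. -/
def reps (O : P → Submodule k K) : Submodule k (P → K) where
  carrier := {r | {x | r x ∉ O x}.Finite}
  zero_mem' := Set.finite_empty.subset fun x hx => hx (O x).zero_mem
  add_mem' {r s} hr hs := (Set.Finite.union hr hs).subset fun x hx => by
    by_contra h
    rw [Set.mem_union, not_or] at h
    exact hx ((O x).add_mem (not_not.mp h.1) (not_not.mp h.2))
  smul_mem' a r hr := Set.Finite.subset hr fun x hx h => hx ((O x).smul_mem a h)

/-- The repartitions with poles bounded by a divisor. -/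
def bounded (E : P →₀ ℤ) : Submodule k (reps S.O) where
  carrier := {r | ∀ c, S.v c (r.1 c) ≤ exp (E c)}
  zero_mem' c := by simp
  add_mem' {r s} hr hs c := (Valuation.map_add_le _ (hr c) (hs c))
  smul_mem' a r hr c := (S.v_smul_le c a _).trans (hr c)

/-- The rational functions as constant repartitions. -/
def diag : K →ₗ[k] reps S.O where
  toFun x := ⟨fun _ => x, S.finite x⟩
  map_add' _ _ := rfl
  map_smul' _ _ := rfl

/-- Multiplication of repartitions by rational functions. -/
def mulRep : K →ₗ[k] reps S.O →ₗ[k] reps S.O :=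
  LinearMap.mk₂ k (fun f r => ⟨fun c => f * r.1 c, by
      refine Set.Finite.subset ((S.finite f).union r.2) fun c hc => ?_
      by_contra h
      rw [Set.mem_union, not_or] at h
      have h1 := not_not.mp h.1
      have h2 := not_not.mp h.2
      rw [S.mem_O] at h1 h2
      refine hc ?_
      rw [S.mem_O, map_mul]
      exact mul_le_one' h1 h2⟩)
    (fun _ _ _ => Subtype.ext (funext fun _ => add_mul _ _ _))
    (fun _ _ _ => Subtype.ext (funext fun _ => smul_mul_assoc _ _ _))
    (fun _ _ _ => Subtype.ext (funext fun _ => mul_add _ _ _))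
    (fun _ _ _ => Subtype.ext (funext fun _ => mul_smul_comm _ _ _))

lemma mulRep_apply (f : K) (r : reps S.O) (c : P) : (S.mulRep f r).1 c = f * r.1 c := rfl

/-- Take w equal to π^(−E(c)−1) at c and to 0 elsewhere. The residue field is `k`, so the leading
coefficient at c of any repartition bounded by E + c is removed by a scalar multiple of w. -/
lemma bounded_add_single (E : P →₀ ℤ) (c : P) : ∃ w : reps S.O, w ∉ S.bounded E ∧
    S.bounded (E + Finsupp.single c 1) = S.bounded E ⊔ Submodule.span k {w} := by
  classical
  let p : K := S.π c ^ (-(E c + 1))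
  have hp : S.v c p = exp (E c + 1) := by rw [S.v_π_zpow, neg_neg]
  let w : reps S.O := ⟨Pi.single c p, (Set.finite_singleton c).subset fun x hx => by
    by_contra h
    refine hx ?_
    rw [Pi.single_eq_of_ne h]
    exact (S.O x).zero_mem⟩
  have hwc : w.1 c = p := by simp [w]
  have hwx : ∀ x, x ≠ c → w.1 x = 0 := fun x hx => by simp [w, hx]
  have hE : ∀ x, x ≠ c → (E + Finsupp.single c (1 : ℤ) : P →₀ ℤ) x = E x := fun x hx => by
    simp [hx]
  have hEc : (E + Finsupp.single c (1 : ℤ) : P →₀ ℤ) c = E c + 1 := by simp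
  refine ⟨w, fun h => ?_, le_antisymm (fun r hr => ?_) (sup_le (fun r hr x => ?_) ?_)⟩
  · have := h c
    rw [hwc, hp, exp_le_exp] at this
    omega
  · have h1 := hr c
    rw [hEc] at h1
    have h2 : S.v c (r.1 c * S.π c ^ (E c + 1)) ≤ 1 := by
      rw [map_mul, S.v_π_zpow]
      calc _ ≤ exp (E c + 1) * exp (-(E c + 1)) := mul_le_mul_left h1 _
        _ = 1 := by rw [← exp_add, add_neg_cancel, exp_zero]
    obtain ⟨a, ha⟩ := S.residue c _ h2
    have : r = (r - a • w) + a • w := by abel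
    rw [this]
    refine Submodule.add_mem_sup (fun x => ?_)
      (Submodule.smul_mem _ _ (Submodule.mem_span_singleton_self w))
    change S.v x (r.1 x - a • w.1 x) ≤ _
    by_cases hx : x = c
    · subst hx
      rw [hwc]
      have h3 : r.1 x - a • p = (r.1 x * S.π x ^ (E x + 1) - algebraMap k K a) * p := by
        have : S.π x ^ (E x + 1) * p = 1 := by
          rw [← zpow_add₀ (S.π_ne x), add_neg_cancel, zpow_zero]
        rw [sub_mul, mul_assoc, this, mul_one, Algebra.smul_def]
      rw [h3, map_mul, hp]
      calc _ ≤ exp (-1) * exp (E x + 1) := mul_le_mul_left ha _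
        _ = exp (E x) := by rw [← exp_add]; congr 1; ring
    · rw [hwx x hx, smul_zero, sub_zero, ← hE x hx]
      exact hr x
  · refine (hr x).trans ?_
    rw [exp_le_exp]
    by_cases hx : x = c
    · subst hx; rw [hEc]; omega
    · rw [hE x hx]
  · rw [Submodule.span_singleton_le_iff_mem]
    intro x
    by_cases hx : x = c
    · subst hx; rw [hwc, hEc, hp]
    · rw [hwx x hx, map_zero]; exact zero_le

/-- The degree of a divisor. -/
def deg (E : P →₀ ℤ) : ℤ := E.sum fun _ n => n

lemma deg_add (E E' : P →₀ ℤ) : deg (E + E') = deg E + deg E' :=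
  Finsupp.sum_add_index' (fun _ => rfl) (fun _ _ _ => rfl)

lemma deg_single (c : P) (n : ℤ) : deg (Finsupp.single c n) = n :=
  Finsupp.sum_single_index rfl

/-- The space `H¹(E)`. -/
abbrev H1 (E : P →₀ ℤ) : Type _ := reps S.O ⧸ (S.bounded E ⊔ LinearMap.range S.diag)

/-- The space `H⁰(E)`. -/
abbrev H0 (E : P →₀ ℤ) : Submodule k K := (S.bounded E).comap S.diag

lemma mem_H0 {E : P →₀ ℤ} {f : K} : f ∈ S.H0 E ↔ ∀ c, S.v c f ≤ exp (E c) := Iff.rfl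

lemma finrank_H0_zero : FiniteDimensional k (S.H0 0) ∧ Module.finrank k (S.H0 0) = 1 := by
  have : S.H0 0 = Submodule.span k {1} := by
    ext f
    rw [mem_H0, Submodule.mem_span_singleton]
    constructor
    · intro h
      obtain ⟨a, ha⟩ := S.const f fun c => (S.mem_O c f).mpr (by simpa using h c)
      exact ⟨a, by rw [← ha, Algebra.algebraMap_eq_smul_one]⟩
    · rintro ⟨a, rfl⟩ c
      simpa using (S.v_smul_le c a 1)
  rw [this]
  exact ⟨inferInstance, finrank_span_singleton one_ne_zero⟩

/-- The Riemann–Roch theorem in the form `h⁰(E) - h¹(E) = deg E + 1 - h¹(0)`. -/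
theorem hasIndex (h : FiniteDimensional k (S.H1 0)) (E : P →₀ ℤ) :
    HasIndex S.diag (S.bounded E) (deg E + 1 - Module.finrank k (S.H1 0)) := by
  -- Adding a point raises both the degree and the index by one. The equivalence is used in both
  -- directions, so every divisor is reached from 0.
  have step : ∀ (E : P →₀ ℤ) (c : P),
      HasIndex S.diag (S.bounded E) (deg E + 1 - Module.finrank k (S.H1 0)) ↔
      HasIndex S.diag (S.bounded (E + Finsupp.single c 1))
        (deg (E + Finsupp.single c 1) + 1 - Module.finrank k (S.H1 0)) := by
    intro E c
    obtain ⟨w, hw, hE⟩ := S.bounded_add_single E c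
    rw [hE, hasIndex_sup_span_singleton _ _ hw, deg_add, deg_single]
    ring_nf
  have step' : ∀ (E : P →₀ ℤ) (c : P) (n : ℤ),
      HasIndex S.diag (S.bounded E) (deg E + 1 - Module.finrank k (S.H1 0)) →
      HasIndex S.diag (S.bounded (E + Finsupp.single c n))
        (deg (E + Finsupp.single c n) + 1 - Module.finrank k (S.H1 0)) := by
    intro E c n hE
    induction n using Int.induction_on with
    | zero => simpa using hE
    | succ n ih =>
      rw [step _ c, add_assoc, ← Finsupp.single_add] at ih
      exact ih
    | pred n ih =>
      rw [step _ c, add_assoc, ← Finsupp.single_add]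
      simpa using ih
  induction E using Finsupp.induction with
  | zero =>
    refine ⟨S.finrank_H0_zero.1, h, ?_⟩
    have : (Module.finrank k (S.H0 0) : ℤ) = 1 := by exact_mod_cast S.finrank_H0_zero.2
    rw [this, deg, Finsupp.sum_zero_index]
    ring
  | single_add c n E _ _ ih =>
    rw [add_comm]
    exact step' E c n ih

/-- If `deg E ≥ 2g - 1`, then `H¹(E) = 0`. -/
theorem exists_approx (h : FiniteDimensional k (S.H1 0)) {E : P →₀ ℤ}
    (hE : 2 * (Module.finrank k (S.H1 0) : ℤ) - 1 ≤ deg E) (r : reps S.O) :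
    ∃ f : K, ∀ c, S.v c (r.1 c - f) ≤ exp (E c) := by
  obtain ⟨h0, h1, hi⟩ := S.hasIndex h E
  -- Suppose H¹(E) ≠ 0 and let ω be a nonzero functional on repartitions that kills the sum. Then f
  -- ↦ ω(f·) embeds H⁰(E) into the dual of H¹(0), so h⁰(E) ≤ g. But h⁰(E) = h¹(E) + deg E + 1 − g ≥
  -- g + 1.
  have htop : S.bounded E ⊔ LinearMap.range S.diag = ⊤ := by
    by_contra hne
    obtain ⟨ω, hω, hker⟩ := Submodule.exists_le_ker_of_lt_top _ (lt_top_iff_ne_top.mpr hne)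
    have hpos : 0 < Module.finrank k (S.H1 E) := by
      have : Nontrivial (S.H1 E) := Submodule.Quotient.nontrivial_iff.mpr hne
      exact Module.finrank_pos
    let Φ : S.H0 E →ₗ[k] Module.Dual k (reps S.O) :=
      (LinearMap.llcomp k (reps S.O) (reps S.O) k ω) ∘ₗ S.mulRep ∘ₗ (S.H0 E).subtype
    have hΦ : ∀ f r, Φ f r = ω (S.mulRep f.1 r) := fun _ _ => rfl
    have hmem : ∀ f, Φ f ∈ (S.bounded 0 ⊔ LinearMap.range S.diag).dualAnnihilator := by
      intro f
      rw [Submodule.mem_dualAnnihilator]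
      intro r hr
      rw [hΦ]
      refine hker ?_
      obtain ⟨x, hx, _, ⟨y, rfl⟩, rfl⟩ := Submodule.mem_sup.mp hr
      rw [map_add]
      refine Submodule.add_mem_sup (fun c => ?_) ⟨f.1 * y, rfl⟩
      rw [mulRep_apply, map_mul]
      have h2 : S.v c (x.1 c) ≤ 1 := by simpa using hx c
      exact (mul_le_of_le_one_right' h2).trans (f.2 c)
    let Ψ : S.H0 E →ₗ[k] Module.Dual k (S.H1 0) :=
      (Submodule.dualQuotEquivDualAnnihilator _).symm.toLinearMap ∘ₗ Φ.codRestrict _ hmem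
    -- Multiplication by a nonzero f is bijective on repartitions, so ω(f·) = 0 would force ω = 0.
    have hinj : Function.Injective Ψ := by
      refine (LinearEquiv.injective (Submodule.dualQuotEquivDualAnnihilator _).symm).comp ?_
      refine (injective_iff_map_eq_zero (Φ.codRestrict _ hmem)).mpr fun f hf => ?_
      replace hf : Φ f = 0 := congrArg Subtype.val hf
      by_contra hf0
      have hf1 : f.1 ≠ 0 := fun h => hf0 (Subtype.ext h)
      refine hω (LinearMap.ext fun r => ?_)
      have := LinearMap.congr_fun hf (S.mulRep f.1⁻¹ r)
      rw [hΦ] at this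
      have hr : S.mulRep f.1 (S.mulRep f.1⁻¹ r) = r := by
        refine Subtype.ext (funext fun c => ?_)
        rw [mulRep_apply, mulRep_apply, mul_inv_cancel_left₀ hf1]
      rwa [hr] at this
    have hle := LinearMap.finrank_le_finrank_of_injective hinj
    rw [Subspace.dual_finrank_eq] at hle
    have h3 : (Module.finrank k (S.H0 E) : ℤ) ≤ Module.finrank k (S.H1 0) := by exact_mod_cast hle
    have h4 : (0 : ℤ) < Module.finrank k (S.H1 E) := by exact_mod_cast hpos
    change (Module.finrank k (S.H0 E) : ℤ) = Module.finrank k (S.H1 E) + _ at hi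
    linarith
  have hr : r ∈ S.bounded E ⊔ LinearMap.range S.diag := htop ▸ Submodule.mem_top
  obtain ⟨x, hx, _, ⟨f, rfl⟩, rfl⟩ := Submodule.mem_sup.mp hr
  refine ⟨f, fun c => ?_⟩
  have : (x + S.diag f).1 c - f = x.1 c := add_sub_cancel_right _ _
  rw [this]
  exact hx c

theorem finiteDimensional_H0 (h : FiniteDimensional k (S.H1 0)) (E : P →₀ ℤ) :
    FiniteDimensional k (S.H0 E) := (S.hasIndex h E).1

end Places

end

section

open WithZero

lemma eventually_lt_pow {a b : ℤᵐ⁰} (hb : 1 < b) : ∀ᶠ n in Filter.atTop, a < b ^ n := by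
  obtain ⟨N, hN⟩ := MulArchimedean.arch a hb
  filter_upwards [Filter.eventually_gt_atTop N] with n hn
  exact hN.trans_lt (pow_lt_pow_right₀ hb hn)

lemma eventually_pow_le {a b : ℤᵐ⁰} (hb : b < 1) (ha : a ≠ 0) :
    ∀ᶠ n in Filter.atTop, b ^ n ≤ a := by
  by_cases h0 : b = 0
  · filter_upwards [Filter.eventually_gt_atTop 0] with n hn
    rw [h0, zero_pow hn.ne']
    exact zero_le
  · have hb' : 1 < b⁻¹ := (one_lt_inv₀ (zero_lt_iff.mpr h0)).mpr hb
    filter_upwards [eventually_lt_pow (a := a⁻¹) hb'] with n hn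
    rw [inv_pow, inv_lt_inv₀ (zero_lt_iff.mpr ha) (zero_lt_iff.mpr (pow_ne_zero _ h0))] at hn
    exact hn.le

namespace Places

variable {k K P : Type*} [Field k] [Field K] [Algebra k K] (S : Places k K P)

/-! ### Weak approximation -/

lemma exists_lt_one_one_lt (sep : ∀ c c', c ≠ c' → ∃ a ∈ S.O c, a ∉ S.O c') {c c' : P}
    (h : c ≠ c') : ∃ f, S.v c f < 1 ∧ 1 < S.v c' f := by
  obtain ⟨a, ha, ha'⟩ := sep c c' h
  obtain ⟨b, hb, hb'⟩ := sep c' c h.symm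
  rw [S.mem_O] at ha ha' hb hb'
  rw [not_le] at ha' hb'
  refine ⟨a / b, ?_, ?_⟩
  · rw [map_div₀]
    exact (div_lt_one₀ (zero_lt_one.trans hb')).mpr (ha.trans_lt hb')
  · rw [map_div₀]
    have hb0 : S.v c' b ≠ 0 := by
      rw [Valuation.ne_zero_iff]
      rintro rfl
      simp at hb'
    exact (one_lt_div₀ (zero_lt_iff.mpr hb0)).mpr (hb.trans_lt ha')

/-- Given f for T and g for the new place s, use f + g^N. For large N the term g^N dominates
wherever g has a pole, and at a place of T where g has none f dominates. -/
lemma exists_lt_one_forall_one_lt (sep : ∀ c c', c ≠ c' → ∃ a ∈ S.O c, a ∉ S.O c') {c : P}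
    (T : Finset P) (h : c ∉ T) : ∃ f, S.v c f < 1 ∧ ∀ c' ∈ T, 1 < S.v c' f := by
  classical
  induction T using Finset.induction_on with
  | empty => exact ⟨0, by simp, by simp⟩
  | insert s T hs ih =>
    rw [Finset.mem_insert, not_or] at h
    obtain ⟨f, hf, hfT⟩ := ih h.2
    obtain ⟨g, hg, hgs⟩ := S.exists_lt_one_one_lt sep h.1
    have hev : ∀ᶠ n in Filter.atTop, ∀ c' ∈ insert s T,
        1 < S.v c' g → S.v c' f < S.v c' g ^ n := by
      rw [Filter.eventually_all_finset]
      intro c' _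
      by_cases h1 : 1 < S.v c' g
      · filter_upwards [eventually_lt_pow (a := S.v c' f) h1] with n hn _ using hn
      · exact Filter.Eventually.of_forall fun n h => absurd h h1
    obtain ⟨N, hN, hN0⟩ := (hev.and (Filter.eventually_gt_atTop 0)).exists
    have key : ∀ c' ∈ insert s T, 1 < S.v c' g → 1 < S.v c' (f + g ^ N) := by
      intro c' hc' h1
      have h2 := hN c' hc' h1
      rw [← map_pow] at h2
      rw [Valuation.map_add_eq_of_lt_right _ h2, map_pow]
      exact one_lt_pow₀ h1 hN0.ne'
    refine ⟨f + g ^ N, ?_, fun c' hc' => ?_⟩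
    · refine Valuation.map_add_lt _ hf ?_
      rw [map_pow]
      exact pow_lt_one₀ zero_le hg hN0.ne'
    · by_cases h1 : 1 < S.v c' g
      · exact key c' hc' h1
      · rcases Finset.mem_insert.mp hc' with rfl | hT
        · exact absurd hgs h1
        · have h2 := hfT c' hT
          have h3 : S.v c' (g ^ N) < S.v c' f := by
            rw [map_pow]
            exact (pow_le_one₀ zero_le (not_lt.mp h1)).trans_lt h2
          rw [Valuation.map_add_eq_of_lt_left _ h3]
          exact h2

/-- With f small at c and large on T, the element 1/(1 + f^N) tends to 1 at c and to 0 at the places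
of T. -/
lemma exists_near_one_near_zero (sep : ∀ c c', c ≠ c' → ∃ a ∈ S.O c, a ∉ S.O c') {c : P}
    (T : Finset P) (h : c ∉ T) {B : ℤᵐ⁰} (hB : B ≠ 0) :
    ∃ z, S.v c (z - 1) ≤ B ∧ ∀ c' ∈ T, S.v c' z ≤ B := by
  obtain ⟨f, hf, hfT⟩ := S.exists_lt_one_forall_one_lt sep T h
  have hev : ∀ᶠ n in Filter.atTop, ∀ c' ∈ T, (S.v c' f)⁻¹ ^ n ≤ B := by
    rw [Filter.eventually_all_finset]
    intro c' hc'
    exact eventually_pow_le (inv_lt_one_of_one_lt₀ (hfT c' hc')) hB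
  obtain ⟨N, ⟨hN, hN'⟩, hN0⟩ :=
    ((hev.and (eventually_pow_le hf hB)).and (Filter.eventually_gt_atTop 0)).exists
  have hfN : S.v c (f ^ N) < 1 := by
    rw [map_pow]
    exact pow_lt_one₀ zero_le hf hN0.ne'
  have h1 : S.v c (1 + f ^ N) = 1 := by
    rw [Valuation.map_add_eq_of_lt_left _ (by rwa [map_one]), map_one]
  have hne : 1 + f ^ N ≠ 0 := by
    intro h
    rw [h, map_zero] at h1
    exact zero_ne_one h1
  refine ⟨(1 + f ^ N)⁻¹, ?_, fun c' hc' => ?_⟩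
  · have : (1 + f ^ N)⁻¹ - 1 = -(f ^ N) * (1 + f ^ N)⁻¹ := by
      field_simp
      ring
    rw [this, map_mul, map_inv₀, h1, Valuation.map_neg, inv_one, mul_one, map_pow]
    exact hN'
  · have h2 : 1 < S.v c' (f ^ N) := by
      rw [map_pow]
      exact one_lt_pow₀ (hfT c' hc') hN0.ne'
    rw [map_inv₀, Valuation.map_add_eq_of_lt_right _ (by rwa [map_one]), map_pow, ← inv_pow]
    exact hN c' hc'

/-- Weak approximation. -/
theorem weak_approx (sep : ∀ c c', c ≠ c' → ∃ a ∈ S.O c, a ∉ S.O c') (T : Finset P) (y : P → K) :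
    ∃ f, ∀ c ∈ T, S.v c (y c - f) ≤ 1 := by
  classical
  -- N bounds the poles of all the prescribed elements at all places of T. Approximate idempotents z
  -- of precision N then produce errors that are still integral after multiplication by any of the
  -- y.
  have hev : ∀ᶠ n in Filter.atTop, ∀ c ∈ T, ∀ c' ∈ T, S.v c (y c') < exp (1 : ℤ) ^ n := by
    rw [Filter.eventually_all_finset]
    intro c _
    rw [Filter.eventually_all_finset]
    intro c' _
    refine eventually_lt_pow ?_
    rw [← exp_zero, exp_lt_exp]
    exact one_pos
  obtain ⟨N, hN⟩ := hev.exists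
  have hB : ((exp (1 : ℤ) ^ N)⁻¹ : ℤᵐ⁰) ≠ 0 := inv_ne_zero (pow_ne_zero _ exp_ne_zero)
  choose! z hz hz' using fun c (_ : c ∈ T) =>
    S.exists_near_one_near_zero sep (T.erase c) (Finset.notMem_erase c T) hB
  have hmul : ∀ c ∈ T, ∀ c' ∈ T, ∀ w, S.v c w ≤ (exp (1 : ℤ) ^ N)⁻¹ →
      S.v c (w * y c') ≤ 1 := by
    intro c hc c' hc' w hw
    rw [map_mul]
    calc _ ≤ (exp (1 : ℤ) ^ N)⁻¹ * exp (1 : ℤ) ^ N :=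
          mul_le_mul' hw (hN c hc c' hc').le
      _ = 1 := inv_mul_cancel₀ (pow_ne_zero _ exp_ne_zero)
  refine ⟨∑ c ∈ T, z c * y c, fun c hc => ?_⟩
  have : y c - ∑ c' ∈ T, z c' * y c' =
      -((z c - 1) * y c + ∑ c' ∈ T.erase c, z c' * y c') := by
    rw [← Finset.add_sum_erase T _ hc]
    ring
  rw [this, Valuation.map_neg]
  refine Valuation.map_add_le _ (hmul c hc c hc _ (hz c hc)) (Valuation.map_sum_le _ fun c' hc' => ?_)
  have hc'T := Finset.mem_of_mem_erase hc'
  exact hmul c hc c' hc'T _ (hz' c' hc'T c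
    (Finset.mem_erase.mpr ⟨(Finset.ne_of_mem_erase hc').symm, hc⟩))

/-! ### Finiteness of `H¹` -/

open Polynomial

lemma v_algebraMap (c : P) {a : k} (ha : a ≠ 0) : S.v c (algebraMap k K a) = 1 := by
  refine le_antisymm (S.v_algebraMap_le c a) ?_
  have h := S.v_algebraMap_le c a⁻¹
  rw [map_inv₀, map_inv₀] at h
  refine (inv_le_one₀ (zero_lt_iff.mpr ?_)).mp h
  rw [Valuation.ne_zero_iff]
  exact (_root_.map_ne_zero _).mpr ha

lemma v_aeval_le (c : P) {x : K} (hx : 1 < S.v c x) (p : k[X]) {n : ℕ} (hn : p.natDegree ≤ n) :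
    S.v c (aeval x p) ≤ S.v c x ^ n := by
  rw [aeval_eq_sum_range]
  refine Valuation.map_sum_le _ fun i hi => (S.v_smul_le c _ _).trans ?_
  rw [map_pow]
  exact pow_le_pow_right₀ hx.le ((Finset.mem_range_succ_iff.mp hi).trans hn)

/-- At a pole of x the leading term dominates all the others. -/
lemma v_aeval (c : P) {x : K} (hx : 1 < S.v c x) {p : k[X]} (hp : p ≠ 0) :
    S.v c (aeval x p) = S.v c x ^ p.natDegree := by
  have hx0 : x ≠ 0 := by rintro rfl; simp at hx
  have hlead : S.v c (aeval x (monomial p.natDegree p.leadingCoeff)) =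
      S.v c x ^ p.natDegree := by
    rw [aeval_monomial, map_mul, map_pow, S.v_algebraMap c (leadingCoeff_ne_zero.mpr hp), one_mul]
  by_cases h0 : p.natDegree = 0
  · rw [eq_C_of_natDegree_eq_zero h0] at hp ⊢
    rw [aeval_C, natDegree_C, pow_zero, S.v_algebraMap c (by rintro h; simp [h] at hp)]
  · conv_lhs => rw [← p.eraseLead_add_monomial_natDegree_leadingCoeff]
    rw [map_add, Valuation.map_add_eq_of_lt_right, hlead]
    rw [hlead]
    refine (S.v_aeval_le c hx _ p.eraseLead_natDegree_le).trans_lt (pow_lt_pow_right₀ hx ?_)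
    omega

lemma v_aeval_mod_le (c : P) {x : K} (hx : 1 < S.v c x) (p : k[X]) {q : k[X]} (hq : q ≠ 0) :
    S.v c (aeval x (p % q)) ≤ S.v c (aeval x q) := by
  rw [S.v_aeval c hx hq]
  exact S.v_aeval_le c hx _ (natDegree_le_natDegree (degree_mod_lt p hq).le)

open Classical in
/-- The repartition that is `f` at the places of a finite set and zero elsewhere. -/
def extend (T : Finset P) : K →ₗ[k] reps S.O where
  toFun f := ⟨fun c => if c ∈ T then f else 0, T.finite_toSet.subset fun c hc => by
    by_contra h
    refine hc ?_
    change (if c ∈ T then f else 0) ∈ S.O c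
    rw [if_neg (by simpa using h)]
    exact (S.O c).zero_mem⟩
  map_add' f g := Subtype.ext <| funext fun c => by
    by_cases h : c ∈ T <;> simp [h]
  map_smul' a f := Subtype.ext <| funext fun c => by
    by_cases h : c ∈ T <;> simp [h]

/-- `H¹` is finite-dimensional if the places outside a finite set `T` are those of an affine curve
whose coordinate ring `R` is a finite module over `k[x]`. -/
theorem finiteDimensional_H1 (sep : ∀ c c', c ≠ c' → ∃ a ∈ S.O c, a ∉ S.O c') (T : Finset P)
    (R : Subalgebra k K) (hR : ∀ c ∉ T, ∀ a ∈ R, S.v c a ≤ 1)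
    (strong : ∀ r : reps S.O, ∃ g, ∀ c ∉ T, S.v c (r.1 c - g) ≤ 1)
    (x : K) (hxR : x ∈ R) (hx : ∀ c ∈ T, 1 < S.v c x) (G : Finset K) (hG : ∀ r ∈ G, r ∈ R)
    (hspan : ∀ a ∈ R, ∃ p : K → k[X], a = ∑ r ∈ G, aeval x (p r) * r)
    (hfrac : ∀ f : K, ∃ D : k[X], aeval x D ≠ 0 ∧ aeval x D * f ∈ R)
    (hx0 : x ≠ 0) : FiniteDimensional k (S.H1 0) := by
  classical
  have haev : ∀ p : k[X], aeval x p ∈ R := fun p => by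
    rw [aeval_eq_sum_range]
    exact R.sum_mem fun i _ => R.smul_mem (R.pow_mem hxR i) _
  -- Strong approximation off T and weak approximation on T show that every class of H¹ comes from
  -- one function placed at the places of T. The kernel contains the functions integral on T, and
  -- also R, since an element of R is a global function up to a repartition integral off T.
  let Ψ : K →ₗ[k] S.H1 0 := (Submodule.mkQ _) ∘ₗ S.extend T
  have hin : ∀ c ∈ T, ∀ f, (S.extend T f).1 c = f := fun c hc f => if_pos hc
  have hout : ∀ c ∉ T, ∀ f, (S.extend T f).1 c = 0 := fun c hc f => if_neg hc
  have hO : ∀ f, (∀ c ∈ T, S.v c f ≤ 1) → f ∈ LinearMap.ker Ψ := by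
    intro f hf
    rw [LinearMap.mem_ker]
    refine (Submodule.Quotient.mk_eq_zero _).mpr (Submodule.mem_sup_left fun c => ?_)
    by_cases hc : c ∈ T
    · rw [hin c hc]; simpa using hf c hc
    · rw [hout c hc]; simp
  have hRk : ∀ f ∈ R, f ∈ LinearMap.ker Ψ := by
    intro f hf
    rw [LinearMap.mem_ker]
    refine (Submodule.Quotient.mk_eq_zero _).mpr ?_
    have : S.extend T f = (S.extend T f - S.diag f) + S.diag f := by abel
    rw [this]
    refine Submodule.add_mem_sup (fun c => ?_) ⟨f, rfl⟩
    change S.v c ((S.extend T f).1 c - f) ≤ _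
    by_cases hc : c ∈ T
    · rw [hin c hc]; simp
    · rw [hout c hc, zero_sub, Valuation.map_neg]; simpa using hR c hc f hf
  have hsurj : Function.Surjective Ψ := by
    intro q
    obtain ⟨r, rfl⟩ := Submodule.mkQ_surjective _ q
    obtain ⟨g, hg⟩ := strong r
    obtain ⟨f, hf⟩ := S.weak_approx sep T fun c => r.1 c - g
    refine ⟨f, ?_⟩
    refine ((Submodule.Quotient.eq _).mpr ?_).symm
    have : r - S.extend T f = (r - S.extend T f - S.diag g) + S.diag g := by abel
    rw [this]
    refine Submodule.add_mem_sup (fun c => ?_) ⟨g, rfl⟩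
    change S.v c (r.1 c - (S.extend T f).1 c - g) ≤ _
    by_cases hc : c ∈ T
    · rw [hin c hc, sub_right_comm]; simpa using hf c hc
    · rw [hout c hc, sub_zero]; simpa using hg c hc
  -- m is chosen so that x^(−m)r is integral on T for every generator r.
  have hm : ∀ᶠ m in Filter.atTop, ∀ c ∈ T, ∀ r ∈ G, S.v c r < S.v c x ^ m := by
    rw [Filter.eventually_all_finset]
    intro c hc
    rw [Filter.eventually_all_finset]
    exact fun r _ => eventually_lt_pow (hx c hc)
  obtain ⟨m, hm⟩ := hm.exists
  have hxm : x ^ m ≠ 0 := pow_ne_zero _ hx0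
  let B : Finset K := (Finset.range m ×ˢ G).image fun ir => (x ^ m)⁻¹ * (x ^ ir.1 * ir.2)
  have htop : Submodule.span k (B : Set K) ⊔ LinearMap.ker Ψ = ⊤ := by
    rw [eq_top_iff]
    intro f _
    have hmono : ∀ i, ∀ r ∈ G, (x ^ m)⁻¹ * (x ^ i * r) ∈
        Submodule.span k (B : Set K) ⊔ LinearMap.ker Ψ := by
      intro i r hr
      by_cases hi : i < m
      · refine Submodule.mem_sup_left (Submodule.subset_span ?_)
        exact Finset.mem_coe.mpr (Finset.mem_image.mpr
          ⟨(i, r), Finset.mem_product.mpr ⟨Finset.mem_range.mpr hi, hr⟩, rfl⟩)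
      · refine Submodule.mem_sup_right (hRk _ ?_)
        obtain ⟨j, rfl⟩ := Nat.exists_eq_add_of_le (not_lt.mp hi)
        have : (x ^ m)⁻¹ * (x ^ (m + j) * r) = x ^ j * r := by
          rw [pow_add]
          field_simp
        rw [this]
        exact R.mul_mem (R.pow_mem hxR j) (hG r hr)
    have hpoly : ∀ p : k[X], ∀ r ∈ G, (x ^ m)⁻¹ * (aeval x p * r) ∈
        Submodule.span k (B : Set K) ⊔ LinearMap.ker Ψ := by
      intro p r hr
      rw [aeval_eq_sum_range, Finset.sum_mul, Finset.mul_sum]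
      refine Submodule.sum_mem _ fun i _ => ?_
      rw [smul_mul_assoc, mul_smul_comm]
      exact Submodule.smul_mem _ _ (hmono i r hr)
    obtain ⟨D, hD, hDf⟩ := hfrac f
    have hD0 : D ≠ 0 := by rintro rfl; simp at hD
    obtain ⟨p, hp⟩ := hspan _ hDf
    -- With f = Σ p_r(x) r / D(x), divide X^m p_r by D. The remainder over D is integral at the
    -- poles of x, and so is x^(−m)r. The quotient contributes multiples of x^(i−m)r, which lie in R
    -- for i ≥ m and in the finite set B for i < m.
    have hdm : ∀ r, x ^ m * aeval x (p r) =
        aeval x D * aeval x (X ^ m * p r / D) + aeval x (X ^ m * p r % D) := by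
      intro r
      rw [← map_mul, ← map_add, EuclideanDomain.div_add_mod, map_mul, map_pow, aeval_X]
    have hf : f = ∑ r ∈ G, (x ^ m)⁻¹ * (aeval x (X ^ m * p r / D) * r) +
        ∑ r ∈ G, (x ^ m)⁻¹ * (aeval x (X ^ m * p r % D) / aeval x D * r) := by
      have h1 : f = (aeval x D)⁻¹ * ∑ r ∈ G, aeval x (p r) * r := by
        rw [← hp, inv_mul_cancel_left₀ hD]
      rw [h1, Finset.mul_sum, ← Finset.sum_add_distrib]
      refine Finset.sum_congr rfl fun r _ => ?_
      have h2 : aeval x (p r) = (x ^ m)⁻¹ *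
          (aeval x D * aeval x (X ^ m * p r / D) + aeval x (X ^ m * p r % D)) := by
        rw [← hdm, inv_mul_cancel_left₀ hxm]
      rw [h2]
      field_simp
    rw [hf]
    refine Submodule.add_mem _ (Submodule.sum_mem _ fun r hr => hpoly _ r hr)
      (Submodule.mem_sup_right (Submodule.sum_mem _ fun r hr => hO _ fun c hc => ?_))
    have h1 : S.v c (aeval x (X ^ m * p r % D) / aeval x D) ≤ 1 := by
      rw [map_div₀]
      exact div_le_one_of_le₀ (S.v_aeval_mod_le c (hx c hc) _ hD0) zero_le
    have h2 : S.v c ((x ^ m)⁻¹ * r) ≤ 1 := by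
      rw [map_mul, map_inv₀, map_pow]
      refine (inv_mul_le_one₀ ?_).mpr (hm c hc r hr).le
      exact zero_lt_one.trans_le (one_le_pow₀ (hx c hc).le)
    rw [mul_left_comm, map_mul]
    exact mul_le_one' h1 h2
  have hmap : (Submodule.span k (B : Set K)).map Ψ = ⊤ := by
    have := congrArg (Submodule.map Ψ) htop
    rwa [Submodule.map_sup, LinearMap.le_ker_iff_map.mp le_rfl, sup_bot_eq, Submodule.map_top,
      LinearMap.range_eq_top.mpr hsurj] at this
  refine ⟨?_⟩
  rw [← hmap]
  exact (Submodule.fg_span B.finite_toSet).map Ψ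

end Places

end

/-! ### Values of functions at `k`-points -/

section Eval

variable {k : Type u} [Field k] {X : Scheme.{u}} [X.Over (Spec (.of k))]

lemma le_preimage_top (U : X.Opens) : U ≤ (X ↘ Spec (.of k)) ⁻¹ᵁ ⊤ := le_top

lemma algebraMap_sections (U : X.Opens) : algebraMap k Γ(X, U) =
    ((Scheme.ΓSpecIso (.of k)).inv ≫
      (X ↘ Spec (.of k)).appLE ⊤ U (le_preimage_top U)).hom := by
  rfl

lemma map_algebraMap_sections {U V : X.Opens} (h : U ≤ V) (a : k) :
    X.presheaf.map (homOfLE h).op (algebraMap k Γ(X, V) a) = algebraMap k Γ(X, U) a := by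
  have : (X ↘ Spec (.of k)).appLE ⊤ V (le_preimage_top V) ≫ X.presheaf.map (homOfLE h).op =
      (X ↘ Spec (.of k)).appLE ⊤ U (le_preimage_top U) := Scheme.Hom.appLE_map _ _ _
  exact congrArg (fun g => g.hom ((Scheme.ΓSpecIso (.of k)).inv a)) this

/-- Restriction of functions as a homomorphism of `k`-algebras. -/
def restr {U V : X.Opens} (h : U ≤ V) : Γ(X, V) →ₐ[k] Γ(X, U) where
  __ := (X.presheaf.map (homOfLE h).op).hom
  commutes' a := map_algebraMap_sections h a

lemma Pt.mem_preimage (p : Pt k X) {U : X.Opens} (h : p.point ∈ U) : ⊤ ≤ p.1 ⁻¹ᵁ U := by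
  intro x _
  rw [Subsingleton.elim x (IsLocalRing.closedPoint k)]
  exact h

/-- The value of a function at a `k`-point. -/
def Pt.eval (p : Pt k X) (U : X.Opens) (h : p.point ∈ U) : Γ(X, U) →ₐ[k] k where
  __ := (p.1.appLE U ⊤ (p.mem_preimage h) ≫ (Scheme.ΓSpecIso (.of k)).hom).hom
  commutes' a := by
    have h1 : (X ↘ Spec (.of k)).appLE ⊤ U (le_preimage_top U) ≫ p.1.appLE U ⊤ (p.mem_preimage h) =
        𝟙 _ := by
      rw [Scheme.Hom.appLE_comp_appLE]
      have := p.2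
      simp only [this]
      simp only [Scheme.Hom.appLE, Scheme.Hom.id_app]
      exact (Spec (.of k)).presheaf.map_id _
    have h2 : ((Scheme.ΓSpecIso (.of k)).inv ≫ (X ↘ Spec (.of k)).appLE ⊤ U (le_preimage_top U)) ≫
        p.1.appLE U ⊤ (p.mem_preimage h) ≫ (Scheme.ΓSpecIso (.of k)).hom = 𝟙 _ := by
      rw [Category.assoc, reassoc_of% h1, Iso.inv_hom_id]
    exact congrArg (fun g => g.hom a) h2

lemma Pt.eval_ne_zero_iff (p : Pt k X) {U : X.Opens} (h : p.point ∈ U) (f : Γ(X, U)) :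
    p.eval U h f ≠ 0 ↔ p.point ∈ X.basicOpen f := by
  have h1 : p.point ∈ X.basicOpen f ↔ IsLocalRing.closedPoint k ∈ p.1 ⁻¹ᵁ (X.basicOpen f) := Iff.rfl
  have h2 : p.eval U h f ≠ 0 ↔ p.1.appLE U ⊤ (p.mem_preimage h) f ≠ 0 :=
    map_ne_zero_iff (Scheme.ΓSpecIso (.of k)).commRingCatIsoToRingEquiv (RingEquiv.injective _)
  have h3 : p.1.appLE U ⊤ (p.mem_preimage h) f =
      (Spec (.of k)).presheaf.map (homOfLE (p.mem_preimage h)).op (p.1.app U f) := rfl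
  have h4 : (Spec (.of k)).basicOpen (p.1.appLE U ⊤ (p.mem_preimage h) f) =
      p.1 ⁻¹ᵁ (X.basicOpen f) := by
    rw [h3, Scheme.basicOpen_res, Scheme.preimage_basicOpen, top_inf_eq]
  rw [h1, h2, ← h4, Ne, ← basicOpen_eq_bot_iff]
  constructor
  · intro hne
    obtain ⟨y, hy⟩ := (Opens.ne_bot_iff_nonempty _).mp hne
    rwa [Subsingleton.elim y (IsLocalRing.closedPoint k)] at hy
  · intro hu hb
    rw [hb] at hu
    exact hu

end Eval

/-! ### Local coordinates on a smooth curve -/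

section Chart

variable (k : Type u) [Field k] {C : Scheme.{u}} [C.Over (Spec (.of k))]
  [SmoothOfRelativeDimension 1 (C ↘ Spec (.of k))]

/-- The base has a single point, so the affine open of the base in the definition of smoothness is
everything, and standard smoothness survives the passage to a basic open inside W. -/
lemma exists_affine_standardSmooth (x : C) (W : C.Opens) (hx : x ∈ W) :
    ∃ V : C.Opens, IsAffineOpen V ∧ x ∈ V ∧ V ≤ W ∧
      Algebra.IsStandardSmoothOfRelativeDimension 1 k Γ(C, V) := by
  obtain ⟨U, hU, V, hV, hxV, e, hf⟩ :=
    SmoothOfRelativeDimension.exists_isStandardSmoothOfRelativeDimension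
      (n := 1) (f := C ↘ Spec (.of k)) x
  obtain rfl : U = ⊤ := by
    ext y
    simp only [SetLike.mem_coe, Opens.coe_top, Set.mem_univ, iff_true]
    rw [Subsingleton.elim y ((C ↘ Spec (.of k)) x)]
    exact e hxV
  obtain ⟨g, hgW, hxg⟩ := hV.exists_basicOpen_le ⟨x, hx⟩ hxV
  have := hV.isLocalization_basicOpen g
  refine ⟨C.basicOpen g, hV.basicOpen g, hxg, hgW, ?_⟩
  rw [← RingHom.isStandardSmoothOfRelativeDimension_algebraMap]
  have h1 : RingHom.IsStandardSmoothOfRelativeDimension 1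
      ((algebraMap Γ(C, V) Γ(C, C.basicOpen g)).comp ((C ↘ Spec (.of k)).appLE ⊤ V e).hom) :=
    (RingHom.isStandardSmoothOfRelativeDimension_stableUnderCompositionWithLocalizationAway
      1).right Γ(C, C.basicOpen g) g ((C ↘ Spec (.of k)).appLE ⊤ V e).hom hf
  have h2 := RingHom.IsStandardSmoothOfRelativeDimension.comp h1
    (RingHom.IsStandardSmoothOfRelativeDimension.equiv
      (Scheme.ΓSpecIso (.of k)).symm.commRingCatIsoToRingEquiv)
  have h3 : (C ↘ Spec (.of k)).appLE ⊤ (C.basicOpen g) (le_preimage_top _) =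
    (C ↘ Spec (.of k)).appLE ⊤ V e ≫ C.presheaf.map (homOfLE (C.basicOpen_le g)).op :=
      (Scheme.Hom.appLE_map _ _ _).symm
  rw [algebraMap_sections, h3]
  exact h2

/-- Around every point there is an affine open with a function `t` such that `dt` is a basis of the
differentials. -/
lemma exists_affine_coordinate (x : C) (W : C.Opens) (hx : x ∈ W) :
    ∃ V : C.Opens, IsAffineOpen V ∧ x ∈ V ∧ V ≤ W ∧ Nontrivial (Ω[Γ(C, V)⁄k]) ∧
      ∃ t : Γ(C, V), Submodule.span Γ(C, V) {KaehlerDifferential.D k Γ(C, V) t} = ⊤ := by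
  obtain ⟨V, hV, hxV, hVW, ι, σ, _, _, P, hP⟩ := exists_affine_standardSmooth k x W hx
  have : Nonempty V := ⟨⟨x, hxV⟩⟩
  have hnt : Nontrivial Γ(C, V) := inferInstance
  have hr := P.rank_kaehlerDifferential
  rw [hP] at hr
  have : Module.Free Γ(C, V) (Ω[Γ(C, V)⁄k]) := P.free_kaehlerDifferential
  -- The standard smooth presentation gives a basis of Ω formed by differentials of some of its
  -- generators. Relative dimension one leaves exactly one such generator, and that is the
  -- coordinate.
  have hb := Module.finrank_eq_nat_card_basis P.basisKaehler
  rw [Module.finrank, hr, Nat.cast_one, map_one, eq_comm,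
    Nat.card_eq_one_iff_unique] at hb
  obtain ⟨hs, ⟨i⟩⟩ := hb
  refine ⟨V, hV, hxV, hVW, ⟨P.basisKaehler i, 0, P.basisKaehler.ne_zero i⟩, P.val i, ?_⟩
  rw [← P.basisKaehler_apply, ← P.basisKaehler.span_eq]
  congr 1
  ext y
  simp only [Set.mem_singleton_iff, Set.mem_range]
  exact ⟨fun h => ⟨i, h.symm⟩, fun ⟨j, h⟩ => by rw [← h, Subsingleton.elim j i]⟩

end Chart

/-! ### The local rings of a smooth curve -/

section LocalRings

variable {k : Type u} [Field k] {C : Scheme.{u}} [C.Over (Spec (.of k))]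

lemma germ_algebraMap (U : C.Opens) (x : C) (h : x ∈ U) (a : k) :
    C.presheaf.germ U x h (algebraMap k Γ(C, U) a) = algebraMap k (C.presheaf.stalk x) a := by
  change C.presheaf.germ U x h (C.presheaf.map (homOfLE le_top).op _) = _
  rw [TopCat.Presheaf.germ_res_apply]
  rfl

/-- The germ at a point as a homomorphism of `k`-algebras. -/
def germₐ (k : Type u) [Field k] {C : Scheme.{u}} [C.Over (Spec (.of k))]
    (U : C.Opens) (x : C) (h : x ∈ U) : Γ(C, U) →ₐ[k] C.presheaf.stalk x where
  __ := (C.presheaf.germ U x h).hom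
  commutes' a := germ_algebraMap U x h a

lemma Pt.germ_mem_maximalIdeal_iff (c : Pt k C) {U : C.Opens} (h : c.point ∈ U) (f : Γ(C, U)) :
    germₐ k U c.point h f ∈ IsLocalRing.maximalIdeal (C.presheaf.stalk c.point) ↔
      c.eval U h f = 0 := by
  rw [IsLocalRing.mem_maximalIdeal, mem_nonunits_iff, ← not_iff_not, not_not, ← Ne,
    c.eval_ne_zero_iff, Scheme.mem_basicOpen _ _ _ h]
  rfl

lemma Pt.exists_germ_mul_eq (c : Pt k C) {V : C.Opens} (hV : IsAffineOpen V) (h : c.point ∈ V)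
    (x : C.presheaf.stalk c.point) :
    ∃ a s : Γ(C, V), c.eval V h s ≠ 0 ∧
      x * germₐ k V c.point h s = germₐ k V c.point h a := by
  let : Algebra Γ(C, V) (C.presheaf.stalk c.point) :=
    TopCat.Presheaf.algebra_section_stalk C.presheaf ⟨c.point, h⟩
  have : IsLocalization.AtPrime (C.presheaf.stalk c.point)
    (hV.primeIdealOf ⟨c.point, h⟩).asIdeal := hV.isLocalization_stalk ⟨c.point, h⟩
  obtain ⟨⟨a, s⟩, has⟩ := IsLocalization.surj (hV.primeIdealOf ⟨c.point, h⟩).asIdeal.primeCompl x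
  refine ⟨a, s.1, ?_, has⟩
  have hu : IsUnit (germₐ k V c.point h s.1) :=
    IsLocalization.map_units (C.presheaf.stalk c.point) s
  rw [c.eval_ne_zero_iff, Scheme.mem_basicOpen _ _ _ h]
  exact hu

lemma Pt.maximalIdeal_eq_map (c : Pt k C) {V : C.Opens} (hV : IsAffineOpen V) (h : c.point ∈ V) :
    IsLocalRing.maximalIdeal (C.presheaf.stalk c.point) =
      (RingHom.ker (c.eval V h)).map (germₐ k V c.point h) := by
  apply le_antisymm
  · intro x hx
    obtain ⟨a, s, hs, has⟩ := c.exists_germ_mul_eq hV h x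
    have hu : IsUnit (germₐ k V c.point h s) := by
      by_contra hu
      exact hs ((c.germ_mem_maximalIdeal_iff h s).mp hu)
    have ha : a ∈ RingHom.ker (c.eval V h) :=
      (c.germ_mem_maximalIdeal_iff h a).mp (has ▸ Ideal.mul_mem_right _ _ hx)
    have := Ideal.mem_map_of_mem (germₐ k V c.point h) ha
    rw [← has] at this
    exact (Ideal.mul_unit_mem_iff_mem _ hu).mp this
  · rw [Ideal.map_le_iff_le_comap]
    intro f hf
    exact (c.germ_mem_maximalIdeal_iff h f).mpr hf

/-- Every element of the local ring at a `k`-point is congruent to a constant. -/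
lemma Pt.exists_sub_algebraMap_mem (c : Pt k C) (x : C.presheaf.stalk c.point) :
    ∃ a : k, x - algebraMap k _ a ∈ IsLocalRing.maximalIdeal (C.presheaf.stalk c.point) := by
  obtain ⟨U, h, f, rfl⟩ := TopCat.Presheaf.exists_germ_eq C.presheaf x
  refine ⟨c.eval U h f, ?_⟩
  have := (c.germ_mem_maximalIdeal_iff h (f - algebraMap k _ (c.eval U h f))).mpr (by simp)
  rw [map_sub, AlgHom.commutes] at this
  exact this

/-- The function `t - t(c)`. -/
def Pt.shift (c : Pt k C) {V : C.Opens} (h : c.point ∈ V) (t : Γ(C, V)) :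
    C.presheaf.stalk c.point :=
  germₐ k V c.point h t - algebraMap k _ (c.eval V h t)

lemma Pt.shift_eq (c : Pt k C) {V : C.Opens} (h : c.point ∈ V) (t : Γ(C, V)) :
    c.shift h t = germₐ k V c.point h (t - algebraMap k _ (c.eval V h t)) := by
  rw [map_sub, AlgHom.commutes, shift]

lemma exists_taylor_stalk {V : C.Opens} (hV : IsAffineOpen V) {t : Γ(C, V)}
    (ht : Submodule.span Γ(C, V) {KaehlerDifferential.D k Γ(C, V) t} = ⊤) (d : ℕ) :
    ∃ D : ℕ → (Γ(C, V) →ₗ[k] Γ(C, V)), ∀ (c : Pt k C) (h : c.point ∈ V) (f : Γ(C, V)),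
      germₐ k V c.point h f - ∑ l ∈ Finset.range d,
        algebraMap k _ (c.eval V h (D l f)) * c.shift h t ^ l ∈
          IsLocalRing.maximalIdeal (C.presheaf.stalk c.point) ^ d := by
  obtain ⟨D, hD⟩ := exists_taylor t ht d
  refine ⟨D, fun c h f => ?_⟩
  have := Ideal.mem_map_of_mem (germₐ k V c.point h) (hD (c.eval V h) f)
  rw [Ideal.map_pow, ← c.maximalIdeal_eq_map hV h, map_sub, map_sum] at this
  simpa [Pt.shift] using this

/-- The first order Taylor expansion of a function vanishing at c has no constant term, so 𝔪 ⊆ (t −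
t(c)) + 𝔪², and Nakayama's lemma finishes. -/
lemma Pt.maximalIdeal_eq_span (c : Pt k C) [IsNoetherianRing (C.presheaf.stalk c.point)]
    {V : C.Opens} (hV : IsAffineOpen V) (h : c.point ∈ V) {t : Γ(C, V)}
    (ht : Submodule.span Γ(C, V) {KaehlerDifferential.D k Γ(C, V) t} = ⊤) :
    IsLocalRing.maximalIdeal (C.presheaf.stalk c.point) = Ideal.span {c.shift h t} := by
  set 𝔪 := IsLocalRing.maximalIdeal (C.presheaf.stalk c.point)
  have hτ : c.shift h t ∈ 𝔪 := by
    rw [shift_eq, c.germ_mem_maximalIdeal_iff]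
    simp
  have hle : Ideal.span {c.shift h t} ≤ 𝔪 := (Ideal.span_singleton_le_iff_mem _).mpr hτ
  refine le_antisymm ?_ hle
  refine Submodule.le_of_le_smul_of_le_jacobson_bot (I := 𝔪) (IsNoetherian.noetherian 𝔪)
    (IsLocalRing.jacobson_eq_maximalIdeal ⊥ bot_ne_top).ge ?_
  rw [smul_eq_mul]
  conv_lhs => rw [show 𝔪 = _ from c.maximalIdeal_eq_map hV h]
  rw [Ideal.map_le_iff_le_comap]
  intro f hf
  obtain ⟨D, hD⟩ := exists_taylor_stalk (k := k) hV ht 2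
  have h1 := hD c h f
  rw [Finset.sum_range_succ, Finset.sum_range_one, pow_zero, mul_one, pow_one] at h1
  have hf' : germₐ k V c.point h f ∈ 𝔪 := (c.germ_mem_maximalIdeal_iff h f).mpr hf
  have h2 : algebraMap k (C.presheaf.stalk c.point) (c.eval V h (D 0 f)) ∈ 𝔪 := by
    have h3 := Ideal.pow_le_self two_ne_zero h1
    have h4 : algebraMap k (C.presheaf.stalk c.point) (c.eval V h (D 0 f)) =
        germₐ k V c.point h f - (algebraMap k _ (c.eval V h (D 1 f))) * c.shift h t -
        (germₐ k V c.point h f - (algebraMap k _ (c.eval V h (D 0 f)) +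
        algebraMap k _ (c.eval V h (D 1 f)) * c.shift h t)) := by ring
    rw [h4]
    exact Ideal.sub_mem _ (Ideal.sub_mem _ hf' (Ideal.mul_mem_left _ _ hτ)) h3
  have h5 : c.eval V h (D 0 f) = 0 := by
    by_contra h6
    exact (IsLocalRing.maximalIdeal.isMaximal _).ne_top (Ideal.eq_top_of_isUnit_mem _ h2
      ((IsUnit.mk0 _ h6).map (algebraMap k (C.presheaf.stalk c.point))))
  rw [h5, map_zero, zero_add, pow_two] at h1
  rw [Ideal.mem_comap]
  have h7 : germₐ k V c.point h f = algebraMap k _ (c.eval V h (D 1 f)) * c.shift h t +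
    (germₐ k V c.point h f - algebraMap k _ (c.eval V h (D 1 f)) * c.shift h t) := by ring
  rw [h7]
  exact Submodule.add_mem_sup
    (Ideal.mul_mem_left _ _ (Ideal.mem_span_singleton_self _)) h1

lemma isLocallyNoetherian_of_smooth (k : Type u) [Field k] (C : Scheme.{u})
    [C.Over (Spec (.of k))] [SmoothOfRelativeDimension 1 (C ↘ Spec (.of k))] :
    IsLocallyNoetherian C := by
  have : Smooth (C ↘ Spec (.of k)) := SmoothOfRelativeDimension.smooth 1 _
  exact LocallyOfFiniteType.isLocallyNoetherian (C ↘ Spec (.of k))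

variable [SmoothOfRelativeDimension 1 (C ↘ Spec (.of k))] [AlgebraicGeometry.IsIntegral C]

/-- If the local ring were a field, every function on an affine neighbourhood would equal the
constant f(c), because germs are injective on an integral scheme. The differentials would then
vanish, contrary to smoothness of relative dimension one. -/
lemma Pt.not_isField_stalk (c : Pt k C) : ¬ IsField (C.presheaf.stalk c.point) := by
  intro hF
  obtain ⟨V, hV, h, -, hnt, t, ht⟩ := exists_affine_coordinate k c.point ⊤ trivial
  have : Nonempty V := ⟨⟨_, h⟩⟩
  have hbot := IsLocalRing.isField_iff_maximalIdeal_eq.mp hF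
  have hsurj : Function.Surjective (algebraMap k Γ(C, V)) := by
    intro f
    refine ⟨c.eval V h f, ?_⟩
    have h1 : germₐ k V c.point h (f - algebraMap k _ (c.eval V h f)) ∈
      IsLocalRing.maximalIdeal (C.presheaf.stalk c.point) :=
      (c.germ_mem_maximalIdeal_iff h _).mpr (by simp)
    rw [hbot, Ideal.mem_bot] at h1
    have h2 := (germ_injective_of_isIntegral C c.point h) (h1.trans (map_zero _).symm)
    exact (sub_eq_zero.mp h2).symm
  have := KaehlerDifferential.subsingleton_of_surjective k Γ(C, V) hsurj
  exact not_subsingleton _ this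

lemma Pt.isDiscreteValuationRing_stalk (c : Pt k C) :
    IsDiscreteValuationRing (C.presheaf.stalk c.point) := by
  have := isLocallyNoetherian_of_smooth k C
  obtain ⟨V, hV, h, -, hnt, t, ht⟩ := exists_affine_coordinate k c.point ⊤ trivial
  refine ((IsDiscreteValuationRing.TFAE _ c.not_isField_stalk).out 0 4).mpr ?_
  exact ⟨_, c.maximalIdeal_eq_span hV h ht⟩

end LocalRings

/-! ### The topology of a curve -/

section Topology

lemma locallyOfFiniteType_of_smooth (k : Type u) [Field k] {C : Scheme.{u}} [C.Over (Spec (.of k))]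
    [SmoothOfRelativeDimension 1 (C ↘ Spec (.of k))] :
    LocallyOfFiniteType (C ↘ Spec (.of k)) := by
  have : Smooth (C ↘ Spec (.of k)) := SmoothOfRelativeDimension.smooth 1 _
  infer_instance

variable (k : Type u) [Field k] [IsAlgClosed k]

/-- The `k`-point at a closed point. -/
def ptOf {X : Scheme.{u}} [X.Over (Spec (.of k))] [LocallyOfFiniteType (X ↘ Spec (.of k))]
    (x : closedPoints X) : Pt k X :=
  (pointEquivClosedPoint (X ↘ Spec (.of k))).symm x

lemma ptOf_point {X : Scheme.{u}} [X.Over (Spec (.of k))]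
    [LocallyOfFiniteType (X ↘ Spec (.of k))] (x : closedPoints X) : (ptOf k x).point = x.1 :=
  congrArg Subtype.val ((pointEquivClosedPoint (X ↘ Spec (.of k))).apply_symm_apply x)

variable {k} in
lemma Pt.isClosed_point {X : Scheme.{u}} [X.Over (Spec (.of k))]
    [LocallyOfFiniteType (X ↘ Spec (.of k))] (c : Pt k X) : c.point ∈ closedPoints X :=
  ((pointEquivClosedPoint (X ↘ Spec (.of k))) c).2

variable {k} in
lemma Pt.point_injective {X : Scheme.{u}} [X.Over (Spec (.of k))]
    [LocallyOfFiniteType (X ↘ Spec (.of k))] : Function.Injective (Pt.point : Pt k X → X) :=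
  fun _ _ h => (pointEquivClosedPoint (X ↘ Spec (.of k))).injective (Subtype.ext h)

lemma isDiscreteValuationRing_stalk {C : Scheme.{u}} [C.Over (Spec (.of k))]
    [SmoothOfRelativeDimension 1 (C ↘ Spec (.of k))] [AlgebraicGeometry.IsIntegral C]
    (c : closedPoints C) :
    IsDiscreteValuationRing (C.presheaf.stalk c.1) := by
  have := locallyOfFiniteType_of_smooth k (C := C)
  rw [← ptOf_point k c]
  exact (ptOf k c).isDiscreteValuationRing_stalk

/-- Since C is Jacobson, x specializes to a closed point c and hence comes from the spectrum of the
local ring at c. That ring is a discrete valuation ring, so the spectrum has only a generic and a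
closed point. -/
lemma isClosed_or_eq_genericPoint {C : Scheme.{u}} [C.Over (Spec (.of k))]
    [SmoothOfRelativeDimension 1 (C ↘ Spec (.of k))] [AlgebraicGeometry.IsIntegral C]
    (x : C) : x ∈ closedPoints C ∨ x = genericPoint C := by
  have := locallyOfFiniteType_of_smooth k (C := C)
  have := LocallyOfFiniteType.jacobsonSpace (C ↘ Spec (.of k))
  obtain ⟨c, hc, hcl⟩ := nonempty_inter_closedPoints (X := C) (Z := closure {x})
    ⟨x, subset_closure rfl⟩ isClosed_closure.isLocallyClosed
  have hxc : x ⤳ c := specializes_iff_mem_closure.mpr hc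
  have := isDiscreteValuationRing_stalk k ⟨c, hcl⟩
  have hrange : ∀ y : C, y ⤳ c → ∃ p, C.fromSpecStalk c p = y := by
    intro y hy
    have : y ∈ Set.range (C.fromSpecStalk c) := by
      rw [Scheme.range_fromSpecStalk]
      exact hy
    exact this
  have hcases : ∀ p : Spec (C.presheaf.stalk c), p.asIdeal = ⊥ ∨
      p = IsLocalRing.closedPoint (C.presheaf.stalk c) := by
    intro p
    by_cases hp : p.asIdeal = ⊥
    · exact Or.inl hp
    · right
      have h1 : p.asIdeal.IsMaximal := p.2.isMaximal hp
      exact PrimeSpectrum.ext (IsLocalRing.eq_maximalIdeal h1)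
  obtain ⟨p, rfl⟩ := hrange x hxc
  obtain ⟨q, hq⟩ := hrange (genericPoint C) (genericPoint_specializes c)
  rcases hcases p with hp | rfl
  · right
    have h1 : p ⤳ q := (PrimeSpectrum.le_iff_specializes p q).mp <|
      (PrimeSpectrum.asIdeal_le_asIdeal p q).mp (hp.trans_le bot_le)
    have h2 := h1.map (C.fromSpecStalk c).continuous
    rw [hq] at h2
    exact (h2.antisymm (genericPoint_specializes _)).eq
  · left
    rw [Scheme.fromSpecStalk_closedPoint]
    exact hcl

/-- A proper closed subset misses the generic point, so all its points are closed. Its finitely many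
irreducible components are then single points. -/
lemma finite_of_isClosed {C : Scheme.{u}} [C.Over (Spec (.of k))]
    [SmoothOfRelativeDimension 1 (C ↘ Spec (.of k))] [AlgebraicGeometry.IsIntegral C]
    [CompactSpace C] {Z : Set C} (hZ : IsClosed Z) (hne : Z ≠ Set.univ) :
    Z.Finite ∧ Z ⊆ closedPoints C := by
  have := isLocallyNoetherian_of_smooth k C
  have : IsNoetherian C := {}
  have hsub : Z ⊆ closedPoints C := by
    intro x hx
    refine (isClosed_or_eq_genericPoint k x).resolve_right ?_
    rintro rfl
    exact hne (Set.eq_univ_of_univ_subset ((genericPoint_spec C) ▸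
      hZ.closure_subset_iff.mpr (Set.singleton_subset_iff.mpr hx)))
  refine ⟨?_, hsub⟩
  obtain ⟨S, hS, hcl, hirr, rfl⟩ :=
    NoetherianSpace.exists_finite_set_isClosed_irreducible hZ
  refine Set.Finite.sUnion hS fun t ht => ?_
  obtain ⟨x, hx⟩ := QuasiSober.sober (hirr t ht) (hcl t ht)
  have hxt : x ∈ t := hx.mem
  have hxc : IsClosed {x} := hsub (Set.mem_sUnion_of_mem hxt ht)
  have : t = {x} := by rw [← hx.def, hxc.closure_eq]
  rw [this]
  exact Set.finite_singleton x

end Topology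

section

open WithZero

/-! ### The places of a smooth proper curve -/

section Glue

variable {C : Scheme.{u}} [AlgebraicGeometry.IsIntegral C]

lemma genericPoint_mem {U : C.Opens} {x : C} (hx : x ∈ U) : genericPoint C ∈ U :=
  ((genericPoint_spec C).mem_open_set_iff U.isOpen).mpr ⟨x, trivial, hx⟩

lemma algebraMap_germ {U : C.Opens} {x : C} (hx : x ∈ U) (s : Γ(C, U)) :
    algebraMap (C.presheaf.stalk x) C.functionField (C.presheaf.germ U x hx s) =
      C.presheaf.germ U (genericPoint C) (genericPoint_mem hx) s :=
  C.presheaf.germ_stalkSpecializes_apply hx ((genericPoint_spec C).specializes trivial) s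

/-- A rational function that is regular at all closed points of `U` is a section over `U`. -/
lemma exists_section_of_forall_mem [JacobsonSpace C] (f : C.functionField) (U : C.Opens)
    (hf : ∀ c ∈ closedPoints C, c ∈ U →
      ∃ a : C.presheaf.stalk c, algebraMap _ C.functionField a = f) :
    ∃ s : Γ(C, U), ∀ h : genericPoint C ∈ U,
      C.presheaf.germ U (genericPoint C) h s = f := by
  let ι := {c : C // c ∈ closedPoints C ∧ c ∈ U}
  have hex : ∀ c : ι, ∃ (W : C.Opens) (_ : c.1 ∈ W) (_ : W ≤ U) (s : Γ(C, W)),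
      ∀ h : genericPoint C ∈ W, C.presheaf.germ W (genericPoint C) h s = f := by
    intro c
    obtain ⟨a, ha⟩ := hf c.1 c.2.1 c.2.2
    obtain ⟨W, hW, s, rfl⟩ := TopCat.Presheaf.exists_germ_eq C.presheaf a
    refine ⟨W ⊓ U, ⟨hW, c.2.2⟩, inf_le_right, C.presheaf.map (homOfLE inf_le_left).op s, ?_⟩
    intro h
    rw [TopCat.Presheaf.germ_res_apply, ← algebraMap_germ hW]
    exact ha
  choose W hcW hWU s hs using hex
  -- Neighbourhoods of the closed points of U suffice: by the Jacobson property every point of U has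
  -- a specialization that is closed in C and lies in U.
  have hcov : U ≤ iSup W := by
    intro x hx
    obtain ⟨c, ⟨hc, hcU⟩, hcl⟩ := nonempty_inter_closedPoints (X := C) (Z := closure {x} ∩ U)
      ⟨x, subset_closure rfl, hx⟩
      (isClosed_closure.isLocallyClosed.inter U.isOpen.isLocallyClosed)
    have hxc : x ⤳ c := specializes_iff_mem_closure.mpr hc
    exact Opens.mem_iSup.mpr ⟨⟨c, hcl, hcU⟩, hxc.mem_open (W ⟨c, hcl, hcU⟩).isOpen (hcW _)⟩
  obtain ⟨t, ht, -⟩ := C.sheaf.existsUnique_gluing' W U (fun i => homOfLE (hWU i)) hcov s (by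
    intro i j
    have hg : genericPoint C ∈ W i ⊓ W j :=
      ⟨genericPoint_mem (hcW i), genericPoint_mem (hcW j)⟩
    refine germ_injective_of_isIntegral C (genericPoint C) hg ?_
    change C.presheaf.germ _ _ _ (C.presheaf.map _ _) = C.presheaf.germ _ _ _ (C.presheaf.map _ _)
    rw [TopCat.Presheaf.germ_res_apply, TopCat.Presheaf.germ_res_apply, hs, hs])
  refine ⟨t, fun h => ?_⟩
  obtain ⟨i, hi⟩ := Opens.mem_iSup.mp (hcov h)
  rw [← hs i hi, ← ht i]
  exact (TopCat.Presheaf.germ_res_apply C.presheaf _ _ _ _).symm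

end Glue

section Separated

variable {C : Scheme.{u}} [AlgebraicGeometry.IsIntegral C] [C.IsSeparated]

/-- If the canonical morphism from the generic point extends through `j` over the local ring at `c`,
then `c` lies in the image of `j`. -/
lemma mem_range_of_extends {A : CommRingCat.{u}} (j : Spec A ⟶ C) (c : C)
    (φ : A ⟶ C.presheaf.stalk c)
    (h : Spec.map (φ ≫ CommRingCat.ofHom (algebraMap (C.presheaf.stalk c) C.functionField)) ≫ j =
      C.fromSpecStalk (genericPoint C)) : c ∈ Set.range j := by
  let ι := Spec.map (CommRingCat.ofHom (algebraMap (C.presheaf.stalk c) C.functionField))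
  have : IsDominant ι := by
    refine ⟨?_⟩
    have hinj : Function.Injective (algebraMap (C.presheaf.stalk c) C.functionField) :=
      IsFractionRing.injective _ _
    refine (PrimeSpectrum.denseRange_comap_iff_ker_le_nilRadical _).mpr ?_
    exact ((RingHom.injective_iff_ker_eq_bot _).mp hinj).trans_le bot_le
  -- The two morphisms agree on the generic point, which is dense in the reduced scheme `Spec` of
  -- the local ring at c, and C is separated.
  have key : Spec.map φ ≫ j = C.fromSpecStalk c := by
    refine ext_of_isDominant ι ?_
    have h2 : ι ≫ C.fromSpecStalk c = C.fromSpecStalk (genericPoint C) :=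
      Scheme.SpecMap_stalkSpecializes_fromSpecStalk (genericPoint_specializes c)
    have h4 : Spec.map (φ ≫ CommRingCat.ofHom
        (algebraMap (C.presheaf.stalk c) C.functionField)) = ι ≫ Spec.map φ := Spec.map_comp _ _
    exact ((Category.assoc _ _ _).symm.trans (congrArg (· ≫ j) h4.symm)).trans (h.trans h2.symm)
  refine ⟨Spec.map φ (IsLocalRing.closedPoint _), ?_⟩
  have h3 := congrArg (fun g : Spec (C.presheaf.stalk c) ⟶ C => g (IsLocalRing.closedPoint _)) key
  exact h3.trans Scheme.fromSpecStalk_closedPoint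

/-- If the local ring at c were contained in that at c', then by separatedness c' would lie in the
image of `Spec` of the local ring at c. So c' would specialize to c, which is impossible for a
closed point c' ≠ c. -/
lemma exists_notMem_of_ne {c c' : C} (hc' : c' ∈ closedPoints C) (h : c ≠ c') :
    ∃ a : C.presheaf.stalk c, ∀ b : C.presheaf.stalk c',
      algebraMap _ C.functionField b ≠ algebraMap _ C.functionField a := by
  by_contra! hcon
  choose φ hφ using hcon
  have hinj : Function.Injective (algebraMap (C.presheaf.stalk c') C.functionField) :=
    IsFractionRing.injective _ _
  let Φ : C.presheaf.stalk c →+* C.presheaf.stalk c' :=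
    { toFun := φ
      map_one' := hinj (by simp [hφ])
      map_mul' := fun x y => hinj (by simp [hφ])
      map_zero' := hinj (by simp [hφ])
      map_add' := fun x y => hinj (by simp [hφ]) }
  have := mem_range_of_extends (C.fromSpecStalk c) c' (CommRingCat.ofHom Φ) (by
    have : CommRingCat.ofHom Φ ≫
        CommRingCat.ofHom (algebraMap (C.presheaf.stalk c') C.functionField) =
        C.presheaf.stalkSpecializes (genericPoint_specializes c) := by
      ext x
      exact hφ x
    exact (congrArg (fun g => Spec.map g ≫ C.fromSpecStalk c) this).trans
      (Scheme.SpecMap_stalkSpecializes_fromSpecStalk _))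
  rw [Scheme.range_fromSpecStalk] at this
  have h2 : c ∈ closure {c'} := specializes_iff_mem_closure.mp this
  rw [IsClosed.closure_eq hc'] at h2
  exact h h2

/-- By the same argument with `Spec` of the functions on U: if all of them were regular at c, then c
would lie in U. This supplies the poles at the places outside an affine open. -/
lemma exists_notMem_of_notMem {U : C.Opens} (hU : IsAffineOpen U) (hη : genericPoint C ∈ U)
    {c : C} (h : c ∉ U) : ∃ a : Γ(C, U), ∀ b : C.presheaf.stalk c,
      algebraMap _ C.functionField b ≠ C.presheaf.germ U (genericPoint C) hη a := by
  by_contra! hcon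
  choose φ hφ using hcon
  have hinj : Function.Injective (algebraMap (C.presheaf.stalk c) C.functionField) :=
    IsFractionRing.injective _ _
  let Φ : Γ(C, U) →+* C.presheaf.stalk c :=
    { toFun := φ
      map_one' := hinj (by simp [hφ])
      map_mul' := fun x y => hinj (by simp [hφ])
      map_zero' := hinj (by simp [hφ])
      map_add' := fun x y => hinj (by simp [hφ]) }
  have := mem_range_of_extends hU.fromSpec c (CommRingCat.ofHom Φ) (by
    have : CommRingCat.ofHom Φ ≫
        CommRingCat.ofHom (algebraMap (C.presheaf.stalk c) C.functionField) =
        C.presheaf.germ U (genericPoint C) hη := by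
      ext x
      exact hφ x
    exact (congrArg (fun g => Spec.map g ≫ hU.fromSpec) this).trans
      (hU.fromSpecStalk_eq_fromSpecStalk hη))
  rw [hU.range_fromSpec] at this
  exact h this

end Separated

section Places

section Valuation

variable (k : Type u) [Field k] [IsAlgClosed k] (C : Scheme.{u}) [C.Over (Spec (.of k))]
    [AlgebraicGeometry.IsIntegral C] [SmoothOfRelativeDimension 1 (C ↘ Spec (.of k))]

/-- The valuation of the function field at a closed point. -/
def valuationAt (c : closedPoints C) : Valuation C.functionField ℤᵐ⁰ :=
  haveI := isDiscreteValuationRing_stalk k c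
  (IsDiscreteValuationRing.maximalIdeal (C.presheaf.stalk c.1)).valuation C.functionField

variable {C}

lemma valuationAt_le_one_iff (c : closedPoints C) (x : C.functionField) :
    valuationAt k C c x ≤ 1 ↔ ∃ a : C.presheaf.stalk c.1, algebraMap _ _ a = x := by
  have := isDiscreteValuationRing_stalk k c
  constructor
  · exact IsDiscreteValuationRing.exists_lift_of_le_one
  · rintro ⟨a, rfl⟩
    exact IsDedekindDomain.HeightOneSpectrum.valuation_le_one _ a

lemma valuationAt_irreducible (c : closedPoints C) {ϖ : C.presheaf.stalk c.1}
    (h : Irreducible ϖ) : valuationAt k C c (algebraMap _ _ ϖ) = exp (-1) := by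
  have := isDiscreteValuationRing_stalk k c
  have h1 := Ring.ordFrac_irreducible (K := C.functionField) h
  rw [Ring.ordFrac_eq_valuation_inv] at h1
  change ((valuationAt k C c) (algebraMap _ _ ϖ))⁻¹ = _ at h1
  rw [exp_neg, ← h1, inv_inv]

lemma exists_irreducible_stalk (k : Type u) [Field k] [IsAlgClosed k] {C : Scheme.{u}}
    [C.Over (Spec (.of k))] [AlgebraicGeometry.IsIntegral C]
    [SmoothOfRelativeDimension 1 (C ↘ Spec (.of k))] (c : closedPoints C) :
    ∃ ϖ : C.presheaf.stalk c.1, Irreducible ϖ := by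
  have := isDiscreteValuationRing_stalk k c
  exact IsDiscreteValuationRing.exists_irreducible _

end Valuation

lemma compactSpace_of_proper (k : Type u) [Field k] (C : Scheme.{u})
    [C.Over (Spec (.of k))] [IsProper (C ↘ Spec (.of k))] : CompactSpace C :=
  (quasiCompact_iff_compactSpace (C ↘ Spec (.of k))).mp inferInstance

lemma isSeparated_of_proper (k : Type u) [Field k] (C : Scheme.{u})
    [C.Over (Spec (.of k))] [IsProper (C ↘ Spec (.of k))] : C.IsSeparated :=
  ⟨by rw [← terminal.comp_from (C ↘ Spec (.of k))]; infer_instance⟩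

variable (k : Type u) [Field k] [IsAlgClosed k] {C : Scheme.{u}} [C.Over (Spec (.of k))]
    [AlgebraicGeometry.IsIntegral C] [IsProper (C ↘ Spec (.of k))]

/-- Properness makes the ring of global functions finite over `k`; it is a domain and `k` is
algebraically closed. -/
lemma exists_algebraMap_eq_of_section (s : Γ(C, ⊤)) :
    ∃ a : k, algebraMap k Γ(C, ⊤) a = s := by
  have h1 := finite_appTop_of_universallyClosed k (C ↘ Spec (.of k))
  have h2 : (algebraMap k Γ(C, ⊤)).Finite := by
    have h3 : (Scheme.ΓSpecIso (.of k)).inv.hom.Finite :=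
      RingHom.Finite.of_surjective _
        (Scheme.ΓSpecIso (.of k)).symm.commRingCatIsoToRingEquiv.surjective
    have h4 := h1.comp h3
    have h5 : algebraMap k Γ(C, ⊤) = ((C ↘ Spec (.of k)).appTop.hom).comp
        (Scheme.ΓSpecIso (.of k)).inv.hom := by
      rw [algebraMap_sections]
      have : (C ↘ Spec (.of k)).appLE ⊤ ⊤ (le_preimage_top ⊤) = (C ↘ Spec (.of k)).appTop :=
        Scheme.Hom.appLE_eq_app _
      rw [this]
      rfl
    rw [h5]
    exact h4
  have : Module.Finite k Γ(C, ⊤) := h2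
  exact IsAlgClosed.algebraMap_bijective_of_isIntegral.2 s

variable (C) [SmoothOfRelativeDimension 1 (C ↘ Spec (.of k))]

/-- The places of a smooth proper curve. -/
def curvePlaces : Places k C.functionField (closedPoints C) where
  O c := localRing k C c.1
  v c := valuationAt k C c
  mem_O c x := (valuationAt_le_one_iff k c x).symm
  π c := algebraMap _ _ (exists_irreducible_stalk k c).choose
  v_π c := valuationAt_irreducible k c (exists_irreducible_stalk k c).choose_spec
  residue c x hx := by
    obtain ⟨a, rfl⟩ := (valuationAt_le_one_iff k c x).mp hx
    have := locallyOfFiniteType_of_smooth k (C := C)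
    have := isDiscreteValuationRing_stalk k c
    have hres : ∃ b : k, a - algebraMap k _ b ∈ IsLocalRing.maximalIdeal (C.presheaf.stalk c.1) := by
      have h := fun a => (ptOf k c).exists_sub_algebraMap_mem a
      rw [ptOf_point] at h
      exact h a
    obtain ⟨b, hb⟩ := hres
    obtain ⟨ϖ, hϖ⟩ := exists_irreducible_stalk k c
    rw [hϖ.maximalIdeal_eq] at hb
    obtain ⟨y, hy⟩ := Ideal.mem_span_singleton'.mp hb
    refine ⟨b, ?_⟩
    have : algebraMap (C.presheaf.stalk c.1) C.functionField a - algebraMap k _ b =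
        algebraMap _ _ y * algebraMap _ _ ϖ := by
      rw [← map_mul, hy, map_sub, ← IsScalarTower.algebraMap_apply]
    rw [this, map_mul, valuationAt_irreducible k c hϖ]
    exact mul_le_of_le_one_left' ((valuationAt_le_one_iff k c _).mpr ⟨y, rfl⟩)
  finite x := by
    have := compactSpace_of_proper k C
    obtain ⟨W, hW, s, rfl⟩ := TopCat.Presheaf.exists_germ_eq C.presheaf x
    have hfin := (finite_of_isClosed k (C := C) (Z := (W : Set C)ᶜ) W.isOpen.isClosed_compl
      (fun h => by
        have : genericPoint C ∈ (W : Set C)ᶜ := h ▸ trivial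
        exact this hW)).1
    refine Set.Finite.subset (hfin.preimage Subtype.val_injective.injOn) fun c hc hcW => hc ?_
    exact ⟨C.presheaf.germ W c.1 hcW s, algebraMap_germ hcW s⟩
  const x hx := by
    have := locallyOfFiniteType_of_smooth k (C := C)
    have := LocallyOfFiniteType.jacobsonSpace (C ↘ Spec (.of k))
    obtain ⟨s, hs⟩ := exists_section_of_forall_mem x ⊤ fun c hc _ => hx ⟨c, hc⟩
    obtain ⟨a, rfl⟩ := exists_algebraMap_eq_of_section k s
    refine ⟨a, ?_⟩
    rw [← hs trivial]
    exact (germ_algebraMap ⊤ _ _ a).symm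

end Places

end

section

open WithZero Polynomial

/-! ### Finiteness of `H¹` -/

namespace Places

variable {k K P : Type*} [Field k] [Field K] [Algebra k K] (S : Places k K P)

/-- Elements of `R` approximate integral elements at one place to any order. -/
lemma exists_mem_sub_le (R : Subalgebra k K) (c : P)
    (unif : ∃ p ∈ R, S.v c p = exp (-1)) (n : ℕ) (x : K) (hx : S.v c x ≤ 1) :
    ∃ a ∈ R, S.v c (x - a) ≤ exp (-n : ℤ) := by
  obtain ⟨p, hpR, hp⟩ := unif
  have hp0 : p ≠ 0 := by
    rintro rfl
    rw [map_zero] at hp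
    exact exp_ne_zero hp.symm
  have hpn : ∀ n : ℕ, S.v c (p ^ n) = exp (-n : ℤ) := fun n => by
    rw [map_pow, hp, ← exp_nsmul]
    simp
  induction n with
  | zero => exact ⟨0, R.zero_mem, by simpa using hx⟩
  | succ n ih =>
    obtain ⟨a, ha, hxa⟩ := ih
    have h1 : S.v c ((x - a) / p ^ n) ≤ 1 := by
      rw [map_div₀, hpn]
      exact div_le_one_of_le₀ hxa zero_le
    obtain ⟨b, hb⟩ := S.residue c _ h1
    refine ⟨a + algebraMap k K b * p ^ n,
      R.add_mem ha (R.mul_mem (R.algebraMap_mem b) (R.pow_mem hpR n)), ?_⟩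
    have h2 : x - (a + algebraMap k K b * p ^ n) = ((x - a) / p ^ n - algebraMap k K b) * p ^ n := by
      field_simp
      ring
    rw [h2, map_mul, hpn]
    calc _ ≤ exp (-1) * exp (-n : ℤ) := mul_le_mul_left hb _
      _ = _ := by rw [← exp_add]; congr 1; push_cast; ring

/-- A Chinese remainder argument. For each c, a power y of a product of separating elements is a
unit at c and vanishes to order n at the other places of Q. Approximating x_c/y at c by b in R, the
element by has the required jet at c and is small elsewhere; these are then added up. -/
lemma exists_mem_forall_sub_le (R : Subalgebra k K) (Q : Finset P)
    (hR : ∀ c ∈ Q, ∀ a ∈ R, S.v c a ≤ 1)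
    (unif : ∀ c ∈ Q, ∃ p ∈ R, S.v c p = exp (-1))
    (sepR : ∀ c ∈ Q, ∀ c' ∈ Q, c ≠ c' → ∃ a ∈ R, S.v c a < 1 ∧ S.v c' a = 1)
    (n : ℕ) (x : P → K) (hx : ∀ c ∈ Q, S.v c (x c) ≤ 1) :
    ∃ a ∈ R, ∀ c ∈ Q, S.v c (x c - a) ≤ exp (-n : ℤ) := by
  classical
  have key : ∀ c ∈ Q, ∃ a ∈ R, S.v c (x c - a) ≤ exp (-n : ℤ) ∧
      ∀ c' ∈ Q, c' ≠ c → S.v c' a ≤ exp (-n : ℤ) := by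
    intro c hc
    have h1 : ∀ c' : P, ∃ a ∈ R, c' ∈ Q → c' ≠ c → S.v c' a < 1 ∧ S.v c a = 1 := by
      intro c'
      by_cases h : c' ∈ Q ∧ c' ≠ c
      · obtain ⟨a, ha, ha'⟩ := sepR c' h.1 c hc h.2
        exact ⟨a, ha, fun _ _ => ha'⟩
      · exact ⟨0, R.zero_mem, fun h1 h2 => (h ⟨h1, h2⟩).elim⟩
    choose w hwR hw using h1
    set y := (∏ c' ∈ Q.erase c, w c') ^ n with hy
    have hyR : y ∈ R := R.pow_mem (R.prod_mem fun c' _ => hwR c') n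
    have hyc : S.v c y = 1 := by
      rw [hy, map_pow, map_prod, Finset.prod_eq_one, one_pow]
      intro c' hc'
      exact (hw c' (Finset.mem_of_mem_erase hc') (Finset.ne_of_mem_erase hc')).2
    have hyc' : ∀ c' ∈ Q, c' ≠ c → S.v c' y ≤ exp (-n : ℤ) := by
      intro c' hc' hne
      have h2 : S.v c' (∏ c'' ∈ Q.erase c, w c'') ≤ exp (-1) := by
        rw [← Finset.mul_prod_erase _ _ (Finset.mem_erase.mpr ⟨hne, hc'⟩), map_mul]
        have h3 : S.v c' (w c') ≤ exp (-1) := by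
          have h4 := (hw c' hc' hne).1
          by_cases h5 : S.v c' (w c') = 0
          · rw [h5]
            exact zero_le
          · rw [← exp_log h5, exp_le_exp]
            rw [← exp_log h5, ← exp_zero, exp_lt_exp] at h4
            omega
        refine (mul_le_of_le_one_right' ?_).trans h3
        exact hR c' hc' _ (R.prod_mem fun c'' _ => hwR c'')
      rw [hy, map_pow]
      refine (pow_le_pow_left' h2 n).trans ?_
      rw [← exp_nsmul]
      simp
    have hy0 : y ≠ 0 := by
      intro h
      rw [h, map_zero] at hyc
      exact zero_ne_one hyc
    obtain ⟨b, hb, hxb⟩ := S.exists_mem_sub_le R c (unif c hc) n (x c / y)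
      (by rw [map_div₀, hyc, div_one]; exact hx c hc)
    refine ⟨b * y, R.mul_mem hb hyR, ?_, fun c' hc' hne => ?_⟩
    · have : x c - b * y = (x c / y - b) * y := by
        field_simp
      rw [this, map_mul, hyc, mul_one]
      exact hxb
    · rw [map_mul]
      exact (mul_le_of_le_one_left' (hR c' hc' b hb)).trans (hyc' c' hc' hne)
  choose! a haR ha ha' using key
  refine ⟨∑ c ∈ Q, a c, R.sum_mem haR, fun c hc => ?_⟩
  rw [← Finset.add_sum_erase _ _ hc, ← sub_sub]
  refine Valuation.map_sub_le _ (ha c hc) (Valuation.map_sum_le _ fun c' hc' => ?_)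
  exact ha' c' (Finset.mem_of_mem_erase hc') c hc (Finset.ne_of_mem_erase hc').symm

/-- Strong approximation off `T`. -/
lemma strong_approx (T : Finset P) (R : Subalgebra k K) (hR : ∀ c ∉ T, ∀ a ∈ R, S.v c a ≤ 1)
    (unif : ∀ c ∉ T, ∃ p ∈ R, S.v c p = exp (-1))
    (sepR : ∀ c ∉ T, ∀ c' ∉ T, c ≠ c' → ∃ a ∈ R, S.v c a < 1 ∧ S.v c' a = 1)
    (r : reps S.O) : ∃ g, ∀ c ∉ T, S.v c (r.1 c - g) ≤ 1 := by
  classical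
  let B : Finset P := r.2.toFinset \ T
  have hB : ∀ c ∈ B, c ∉ T := fun c hc => (Finset.mem_sdiff.mp hc).2
  have hBr : ∀ c ∉ T, c ∉ B → S.v c (r.1 c) ≤ 1 := by
    intro c hc hcB
    by_contra h
    refine hcB (Finset.mem_sdiff.mpr ⟨?_, hc⟩)
    exact r.2.mem_toFinset.mpr fun h' => h ((S.mem_O c _).mp h')
  have hun : ∀ c, ∃ p ∈ R, p ≠ 0 ∧ (c ∉ T → S.v c p < 1) := by
    intro c
    by_cases hc : c ∈ T
    · exact ⟨1, R.one_mem, one_ne_zero, fun h => (h hc).elim⟩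
    · obtain ⟨p, hp, hpv⟩ := unif c hc
      refine ⟨p, hp, ?_, fun _ => ?_⟩
      · rintro rfl
        rw [map_zero] at hpv
        exact exp_ne_zero hpv.symm
      · rw [hpv, ← exp_zero, exp_lt_exp]
        omega
  choose p hpR hp0 hp1 using hun
  have hN : ∃ N : ℕ, ∀ c ∈ B, S.v c (p c ^ N * r.1 c) ≤ 1 := by
    have h1 : ∀ c ∈ B, ∀ᶠ N : ℕ in Filter.atTop, S.v c (p c ^ N * r.1 c) ≤ 1 := by
      intro c hc
      by_cases h0 : r.1 c = 0
      · simp [h0]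
      · have h2 : (S.v c (r.1 c))⁻¹ ≠ 0 := inv_ne_zero ((_root_.map_ne_zero _).mpr h0)
        filter_upwards [eventually_pow_le (hp1 c (hB c hc)) h2] with N hN
        rw [map_mul, map_pow]
        calc _ ≤ (S.v c (r.1 c))⁻¹ * S.v c (r.1 c) := mul_le_mul_left hN _
          _ = 1 := inv_mul_cancel₀ ((_root_.map_ne_zero _).mpr h0)
    exact ((Filter.eventually_all_finset B).mpr h1).exists
  obtain ⟨N, hN⟩ := hN
  -- A common denominator in R: h·r is integral off T. It remains to approximate h·r by an element a
  -- of R, to the precision of h, at the bad places B and at the zeros Q of h off T, and to take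
  -- a/h. Elsewhere off T both r and a/h are integral.
  set h := ∏ c ∈ B, p c ^ N with hh
  have hhR : h ∈ R := R.prod_mem fun c _ => R.pow_mem (hpR c) N
  have hh0 : h ≠ 0 := Finset.prod_ne_zero_iff.mpr fun c _ => pow_ne_zero _ (hp0 c)
  have hhr : ∀ c ∈ B, S.v c (h * r.1 c) ≤ 1 := by
    intro c hc
    rw [hh, ← Finset.prod_erase_mul _ _ hc, mul_assoc, map_mul]
    exact mul_le_one' (hR c (hB c hc) _ (R.prod_mem fun c _ => R.pow_mem (hpR c) N)) (hN c hc)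
  have hhr' : ∀ c ∉ T, S.v c (h * r.1 c) ≤ 1 := by
    intro c hc
    by_cases hcB : c ∈ B
    · exact hhr c hcB
    · rw [map_mul]
      exact mul_le_one' (hR c hc h hhR) (hBr c hc hcB)
  let Q : Finset P := (S.finite h⁻¹).toFinset \ T
  have hQ : ∀ c ∈ B ∪ Q, c ∉ T := by
    intro c hc
    rcases Finset.mem_union.mp hc with hc | hc
    exacts [hB c hc, (Finset.mem_sdiff.mp hc).2]
  have hn : ∃ n : ℕ, ∀ c ∈ B ∪ Q, exp (-n : ℤ) ≤ S.v c h := by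
    have h1 : ∀ c ∈ B ∪ Q, ∀ᶠ n : ℕ in Filter.atTop, exp (-n : ℤ) ≤ S.v c h := by
      intro c hc
      have h2 : exp (-1 : ℤ) < 1 := by
        rw [← exp_zero, exp_lt_exp]
        omega
      filter_upwards [eventually_pow_le h2 ((_root_.map_ne_zero (S.v c)).mpr hh0)] with n hn
      refine le_trans (le_of_eq ?_) hn
      rw [← exp_nsmul]
      simp
    exact ((Filter.eventually_all_finset _).mpr h1).exists
  obtain ⟨n, hn⟩ := hn
  obtain ⟨a, ha, hra⟩ := S.exists_mem_forall_sub_le R (B ∪ Q) (fun c hc => hR c (hQ c hc))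
    (fun c hc => unif c (hQ c hc)) (fun c hc c' hc' => sepR c (hQ c hc) c' (hQ c' hc')) n
    (fun c => h * r.1 c) (fun c hc => hhr' c (hQ c hc))
  refine ⟨a / h, fun c hc => ?_⟩
  by_cases hcQ : c ∈ B ∪ Q
  · have h1 : r.1 c - a / h = (h * r.1 c - a) / h := by
      field_simp
    rw [h1, map_div₀]
    exact div_le_one_of_le₀ ((hra c hcQ).trans (hn c hcQ)) zero_le
  · rw [Finset.mem_union, not_or] at hcQ
    refine Valuation.map_sub_le _ (hBr c hc hcQ.1) ?_
    rw [div_eq_mul_inv, map_mul]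
    refine mul_le_one' (hR c hc a ha) ?_
    by_contra h1
    refine hcQ.2 (Finset.mem_sdiff.mpr ⟨?_, hc⟩)
    exact (S.finite h⁻¹).mem_toFinset.mpr fun h' => h1 ((S.mem_O c _).mp h')

end Places

/-- Noether normalization of a finitely generated domain of dimension one. -/
lemma exists_finite_injective_fin_one {k R : Type*} [Field k] [CommRing R] [IsDomain R]
    [Algebra k R] [Algebra.FiniteType k R] (hR : ¬ IsField R)
    (hmax : ∀ p : Ideal R, p.IsPrime → p ≠ ⊥ → p.IsMaximal) :
    ∃ g : MvPolynomial (Fin 1) k →ₐ[k] R, Function.Injective g ∧ g.Finite := by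
  obtain ⟨s, g, hg, hfin⟩ := exists_finite_inj_algHom_of_fg k R
  have hint : g.toRingHom.IsIntegral := hfin.to_isIntegral
  let := g.toRingHom.toAlgebra
  have : Algebra.IsIntegral (MvPolynomial (Fin s) k) R := ⟨hint⟩
  rcases s with _ | _ | s
  -- With no variables, R would be integral over a field and hence a field.
  · exfalso
    refine hR (isField_of_isIntegral_of_isField' (R := MvPolynomial (Fin 0) k) ?_)
    exact (MvPolynomial.isEmptyAlgEquiv k (Fin 0)).toMulEquiv.isField (Field.toIsField k)
  · exact ⟨g, hg, hfin⟩
  · exfalso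
    -- With at least two variables, the kernel P of X₀ ↦ 0 is a nonzero prime. A prime Q of R over
    -- it is nonzero, hence maximal, so P is maximal too. But P is strictly contained in the ideal
    -- of the origin, which contains X₁.
    let φ : MvPolynomial (Fin (s + 2)) k →ₐ[k] MvPolynomial (Fin (s + 2)) k :=
      MvPolynomial.aeval fun i => if i = 0 then 0 else MvPolynomial.X i
    let P := RingHom.ker φ
    have hP : P.IsPrime := RingHom.ker_isPrime _
    obtain ⟨Q, hQ, hQP⟩ := Ideal.exists_ideal_over_prime_of_isIntegral_of_isDomain
      (S := R) P (by
        rw [(RingHom.injective_iff_ker_eq_bot (algebraMap (MvPolynomial (Fin (s + 2)) k) R)).mp hg]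
        exact bot_le)
    have hX0 : (MvPolynomial.X 0 : MvPolynomial (Fin (s + 2)) k) ∈ P := by
      simp [P, φ, RingHom.mem_ker]
    have hQ0 : Q ≠ ⊥ := by
      rintro rfl
      rw [← hQP] at hX0
      have h1 : g (MvPolynomial.X 0) = 0 := hX0
      rw [map_eq_zero_iff g hg] at h1
      exact MvPolynomial.X_ne_zero _ h1
    have := hmax Q hQ hQ0
    have hPm : P.IsMaximal := by
      rw [← hQP]
      exact Ideal.isMaximal_comap_of_isIntegral_of_isMaximal Q
    let ψ : MvPolynomial (Fin (s + 2)) k →ₐ[k] k := MvPolynomial.aeval fun _ => 0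
    have hle : P ≤ RingHom.ker ψ := by
      intro p hp
      have h1 : ψ = ψ.comp φ := by
        ext i
        by_cases hi : i = 0 <;> simp [ψ, φ, hi]
      rw [RingHom.mem_ker] at hp ⊢
      rw [h1, AlgHom.comp_apply, hp, map_zero]
    have heq := hPm.eq_of_le (RingHom.ker_ne_top _) hle
    have h1 : (MvPolynomial.X 1 : MvPolynomial (Fin (s + 2)) k) ∈ P := by
      rw [heq]
      simp [ψ, RingHom.mem_ker]
    simp [P, φ, RingHom.mem_ker] at h1

namespace Places

variable {k K P : Type*} [Field k] [Field K] [Algebra k K] (S : Places k K P)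

/-- Reduces `finiteDimensional_H1` to intrinsic properties of R: Noether normalization supplies the
element x over which R is a finite module. -/
theorem finiteDimensional_H1_of_subalgebra
    (sep : ∀ c c', c ≠ c' → ∃ a ∈ S.O c, a ∉ S.O c') (T : Finset P)
    (R : Subalgebra k K) (hR : ∀ c ∉ T, ∀ a ∈ R, S.v c a ≤ 1)
    (unif : ∀ c ∉ T, ∃ p ∈ R, S.v c p = exp (-1))
    (sepR : ∀ c ∉ T, ∀ c' ∉ T, c ≠ c' → ∃ a ∈ R, S.v c a < 1 ∧ S.v c' a = 1)
    (hT : ∀ c ∈ T, ∃ a ∈ R, 1 < S.v c a) (hne : ∃ c, c ∉ T)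
    (hfg : Algebra.FiniteType k R) (hmax : ∀ p : Ideal R, p.IsPrime → p ≠ ⊥ → p.IsMaximal)
    (hfrac : ∀ f : K, ∃ b ∈ R, b ≠ 0 ∧ b * f ∈ R) : FiniteDimensional k (S.H1 0) := by
  classical
  have hnf : ¬ IsField R := by
    intro hF
    obtain ⟨c, hc⟩ := hne
    obtain ⟨p, hp, hpv⟩ := unif c hc
    have hp0 : (⟨p, hp⟩ : R) ≠ 0 := by
      intro h
      have h1 : p = 0 := congrArg Subtype.val h
      rw [h1, map_zero] at hpv
      exact exp_ne_zero hpv.symm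
    obtain ⟨q, hq⟩ := hF.mul_inv_cancel hp0
    have h1 : p * q.1 = 1 := congrArg Subtype.val hq
    have h2 := congrArg (S.v c) h1
    rw [map_mul, map_one, hpv] at h2
    have h3 : exp (-1 : ℤ) * S.v c q.1 ≤ exp (-1) := mul_le_of_le_one_right' (hR c hc _ q.2)
    rw [h2, ← exp_zero, exp_le_exp] at h3
    omega
  obtain ⟨g, hg, hfin⟩ := exists_finite_injective_fin_one (k := k) hnf hmax
  have hint : g.toRingHom.IsIntegral := hfin.to_isIntegral
  let := g.toRingHom.toAlgebra
  have hinst : Algebra.IsIntegral (MvPolynomial (Fin 1) k) R := ⟨hint⟩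
  set x : R := g (MvPolynomial.X 0) with hxdef
  have hgx : ∀ q, ∃ p : k[X], (g q : K) = aeval (x : K) p := by
    intro q
    induction q using MvPolynomial.induction_on with
    | C a => exact ⟨Polynomial.C a, by
        rw [aeval_C, ← MvPolynomial.algebraMap_eq, AlgHom.commutes]
        rfl⟩
    | add p q hp hq =>
      obtain ⟨p', hp'⟩ := hp
      obtain ⟨q', hq'⟩ := hq
      exact ⟨p' + q', by simp [hp', hq']⟩
    | mul_X p i hp =>
      obtain ⟨p', hp'⟩ := hp
      refine ⟨p' * Polynomial.X, ?_⟩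
      rw [Subsingleton.elim i 0, map_mul, map_mul, aeval_X, ← hp']
      rfl
  -- If x had no pole at c, then k[x], and with it R, which is integral over k[x], would be
  -- contained in the valuation ring at c. This contradicts `hT`.
  have hx : ∀ c ∈ T, 1 < S.v c x := by
    intro c hc
    by_contra! hle
    obtain ⟨a, ha, hav⟩ := hT c hc
    refine hav.not_ge ?_
    have hmem : ∀ q, (g q : K) ∈ (S.v c).integer := by
      intro q
      obtain ⟨p, hp⟩ := hgx q
      rw [hp, aeval_eq_sum_range]
      refine sum_mem fun i _ => ?_
      change S.v c _ ≤ 1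
      refine (S.v_smul_le c _ _).trans ?_
      rw [map_pow]
      exact pow_le_one' hle i
    obtain ⟨p, hp, hp0⟩ := hint ⟨a, ha⟩
    let φ : MvPolynomial (Fin 1) k →+* (S.v c).integer :=
      (R.val.toRingHom.comp g.toRingHom).codRestrict _ hmem
    refine (Valuation.integer.integers (S.v c)).mem_of_integral (x := a) ⟨p.map φ, hp.map φ, ?_⟩
    rw [eval₂_map]
    have h2 := congrArg R.val.toRingHom hp0
    rw [hom_eval₂, map_zero] at h2
    exact h2
  have hx0 : (x : K) ≠ 0 := by
    intro h
    have h1 : x = 0 := Subtype.ext h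
    rw [hxdef, map_eq_zero_iff g hg] at h1
    exact MvPolynomial.X_ne_zero _ h1
  obtain ⟨G, hG⟩ := (show Module.Finite (MvPolynomial (Fin 1) k) R from hfin).fg_top
  refine S.finiteDimensional_H1 sep T R hR (S.strong_approx T R hR unif sepR) x x.2 hx
    (G.image Subtype.val) (fun r hr => ?_) (fun a ha => ?_) (fun f => ?_) hx0
  · obtain ⟨r', -, rfl⟩ := Finset.mem_image.mp hr
    exact r'.2
  · have h1 : (⟨a, ha⟩ : R) ∈ Submodule.span (MvPolynomial (Fin 1) k) (G : Set R) := by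
      rw [hG]
      trivial
    obtain ⟨f, -, hf⟩ := Submodule.mem_span_finset.mp h1
    choose p hp using hgx
    refine ⟨fun y => if hy : y ∈ R then p (f ⟨y, hy⟩) else 0, ?_⟩
    rw [Finset.sum_image Subtype.val_injective.injOn]
    have h2 := congrArg (R.val) hf
    rw [map_sum] at h2
    refine h2.symm.trans (Finset.sum_congr rfl fun r _ => ?_)
    beta_reduce
    rw [dif_pos r.2, ← hp]
    rfl
  · obtain ⟨b, hb, hb0, hbf⟩ := hfrac f
    -- A denominator b in R can be traded for one in k[x], because a nonzero ideal of R meets k[x]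
    -- in a nonzero ideal by integrality.
    let I : Ideal R := Ideal.span {⟨b, hb⟩}
    have h1 : I.comap (algebraMap (MvPolynomial (Fin 1) k) R) ≠ ⊥ :=
      Ideal.comap_ne_bot_of_integral_mem (x := ⟨b, hb⟩)
        (fun h => hb0 (congrArg Subtype.val h)) (Ideal.mem_span_singleton_self _) (hint _)
    obtain ⟨q, hq, hq0⟩ := Submodule.exists_mem_ne_zero_of_ne_bot h1
    obtain ⟨p, hp⟩ := hgx q
    obtain ⟨y, hy⟩ := Ideal.mem_span_singleton'.mp (Ideal.mem_comap.mp hq)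
    refine ⟨p, ?_, ?_⟩
    · rw [← hp]
      intro h
      exact hq0 ((map_eq_zero_iff g hg).mp (Subtype.ext h))
    · have h2 : (g q : K) = y.1 * b := (congrArg Subtype.val hy).symm
      rw [← hp, h2, mul_assoc]
      exact R.mul_mem y.2 hbf

end Places

end

/-! ### Finiteness of H¹ for a smooth proper curve and its relation to the genus -/

section

open WithZero

section Genus

lemma finiteType_sections (k : Type u) [Field k] {X : Scheme.{u}} [X.Over (Spec (.of k))]
    [LocallyOfFiniteType (X ↘ Spec (.of k))] {U : X.Opens} (hU : IsAffineOpen U) :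
    Algebra.FiniteType k Γ(X, U) := by
  have h1 : ((X ↘ Spec (.of k)).appLE ⊤ U (le_preimage_top U)).hom.FiniteType :=
    LocallyOfFiniteType.finiteType_appLE (X ↘ Spec (.of k)) (isAffineOpen_top _) hU _
  have h2 : (algebraMap k Γ(X, U)).FiniteType := by
    rw [algebraMap_sections]
    exact h1.comp (RingHom.FiniteType.of_surjective (Scheme.ΓSpecIso (.of k)).inv.hom
      (Scheme.ΓSpecIso (.of k)).symm.commRingCatIsoToRingEquiv.surjective)
  exact h2

lemma isMaximal_of_isPrime (k : Type u) [Field k] [IsAlgClosed k] {C : Scheme.{u}}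
    [C.Over (Spec (.of k))] [AlgebraicGeometry.IsIntegral C]
    [SmoothOfRelativeDimension 1 (C ↘ Spec (.of k))] {U : C.Opens} (hU : IsAffineOpen U) (p : Ideal Γ(C, U)) (hp : p.IsPrime)
    (h0 : p ≠ ⊥) : p.IsMaximal := by
  let q : Spec Γ(C, U) := ⟨p, hp⟩
  rcases isClosed_or_eq_genericPoint k (hU.fromSpec q) with h | h
  · have h1 : IsClosed ({q} : Set (Spec Γ(C, U))) := by
      have h2 := IsClosed.preimage hU.fromSpec.continuous h
      have h3 : hU.fromSpec ⁻¹' {hU.fromSpec q} = {q} := by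
        ext y
        simp only [Set.mem_preimage, Set.mem_singleton_iff]
        exact hU.fromSpec.isOpenEmbedding.injective.eq_iff
      rwa [h3] at h2
    exact (PrimeSpectrum.isClosed_singleton_iff_isMaximal q).mp h1
  · exfalso
    have hUne : Nonempty U := ⟨⟨hU.fromSpec q, by
      rw [← SetLike.mem_coe, ← hU.range_fromSpec]
      exact ⟨q, rfl⟩⟩⟩
    let z : Spec Γ(C, U) := ⟨⊥, Ideal.isPrime_bot⟩
    have h1 : q ⤳ z := by
      refine hU.fromSpec.isOpenEmbedding.isInducing.specializes_iff.mp ?_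
      rw [h]
      exact genericPoint_specializes _
    have h2 := (PrimeSpectrum.asIdeal_le_asIdeal q z).mpr
      ((PrimeSpectrum.le_iff_specializes q z).mpr h1)
    exact h0 (le_bot_iff.mp h2)

variable (k : Type u) [Field k] [IsAlgClosed k] {C : Scheme.{u}} [C.Over (Spec (.of k))]
    [AlgebraicGeometry.IsIntegral C] [SmoothOfRelativeDimension 1 (C ↘ Spec (.of k))]

/-- Take an affine open U, let T be the finite set of closed points outside U, and let R be the ring
of functions on U inside the function field. Separatedness gives functions on U with a pole at any
given point of T. -/
lemma finiteDimensional_H1_curve [IsProper (C ↘ Spec (.of k))] :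
    FiniteDimensional k ((curvePlaces k C).H1 0) := by
  have := compactSpace_of_proper k C
  have := isSeparated_of_proper k C
  have := locallyOfFiniteType_of_smooth k (C := C)
  obtain ⟨U, hU, hη, -⟩ := exists_isAffineOpen_mem_and_subset (X := C) (x := genericPoint C)
    (U := ⊤) trivial
  have hUne : Nonempty U := ⟨⟨_, hη⟩⟩
  have hTfin : {c : closedPoints C | c.1 ∉ U}.Finite := by
    refine Set.Finite.preimage Subtype.val_injective.injOn (s := (U : Set C)ᶜ)
      (finite_of_isClosed k U.isOpen.isClosed_compl fun h => ?_).1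
    have : genericPoint C ∈ (U : Set C)ᶜ := h ▸ trivial
    exact this hη
  let T := hTfin.toFinset
  have hT : ∀ c : closedPoints C, c ∉ T ↔ c.1 ∈ U := fun c => by simp [T]
  let G := germₐ k U (genericPoint C) hη
  have hGinj : Function.Injective G := germ_injective_of_isIntegral C _ hη
  let e := AlgEquiv.ofInjective G hGinj
  have hGv : ∀ (c : closedPoints C) (h : c.1 ∈ U) (f : Γ(C, U)),
      G f = algebraMap (C.presheaf.stalk c.1) C.functionField (C.presheaf.germ U c.1 h f) :=
    fun c h f => (algebraMap_germ h f).symm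
  have hfrac := functionField_isFractionRing_of_isAffineOpen C U hU
  refine (curvePlaces k C).finiteDimensional_H1_of_subalgebra ?_ T G.range ?_ ?_ ?_ ?_ ?_ ?_ ?_ ?_
  · intro c c' hne
    obtain ⟨a, ha⟩ := exists_notMem_of_ne c'.2 (fun h => hne (Subtype.ext h))
    exact ⟨algebraMap _ _ a, ⟨a, rfl⟩, fun ⟨b, hb⟩ => ha b hb⟩
  · rintro c hc _ ⟨f, rfl⟩
    exact (valuationAt_le_one_iff k c _).mpr ⟨_, (hGv c ((hT c).mp hc) f).symm⟩
  · intro c hc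
    have hcU := (hT c).mp hc
    obtain ⟨ϖ, hϖ⟩ := exists_irreducible_stalk k c
    have key : ∃ a s : Γ(C, U), IsUnit (C.presheaf.germ U c.1 hcU s) ∧
        ϖ * C.presheaf.germ U c.1 hcU s = C.presheaf.germ U c.1 hcU a := by
      have h1 : ∀ (d : Pt k C) (hd : d.point ∈ U) (x : C.presheaf.stalk d.point),
          ∃ a s : Γ(C, U), IsUnit (C.presheaf.germ U d.point hd s) ∧
            x * C.presheaf.germ U d.point hd s = C.presheaf.germ U d.point hd a := by
        intro d hd x
        obtain ⟨a, s, hs, h⟩ := d.exists_germ_mul_eq hU hd x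
        refine ⟨a, s, ?_, h⟩
        rw [d.eval_ne_zero_iff, Scheme.mem_basicOpen _ _ _ hd] at hs
        exact hs
      have h2 := h1 (ptOf k c)
      rw [ptOf_point] at h2
      exact h2 hcU ϖ
    obtain ⟨a, s, hs, h⟩ := key
    refine ⟨G a, ⟨a, rfl⟩, ?_⟩
    have := isDiscreteValuationRing_stalk k c
    rw [hGv c hcU, ← h]
    exact valuationAt_irreducible k c ((irreducible_mul_isUnit hs).mpr hϖ)
  · intro c hc c' hc' hne
    have hcU := (hT c).mp hc
    have hcU' := (hT c').mp hc'
    let W : C.Opens := ⟨{c.1}ᶜ, c.2.isOpen_compl⟩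
    have hW : c'.1 ∈ W := fun h => hne (Subtype.ext h.symm)
    obtain ⟨f, hf, hcf⟩ := hU.exists_basicOpen_le (V := W) ⟨c'.1, hW⟩ hcU'
    have hcu' : IsUnit (C.presheaf.germ U c'.1 hcU' f) :=
      (Scheme.mem_basicOpen _ _ _ hcU').mp hcf
    have hcu : ¬ IsUnit (C.presheaf.germ U c.1 hcU f) := fun h =>
      hf ((Scheme.mem_basicOpen _ _ _ hcU).mpr h) rfl
    have := isDiscreteValuationRing_stalk k c
    have := isDiscreteValuationRing_stalk k c'
    refine ⟨G f, ⟨f, rfl⟩, ?_, ?_⟩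
    · rw [hGv c hcU]
      exact (IsDedekindDomain.HeightOneSpectrum.valuation_lt_one_iff_mem _ _).mpr hcu
    · rw [hGv c' hcU']
      exact le_antisymm (IsDedekindDomain.HeightOneSpectrum.valuation_le_one _ _)
        (not_lt.mp fun h => (IsDedekindDomain.HeightOneSpectrum.valuation_lt_one_iff_mem _ _).mp h
          hcu')
  · intro c hc
    have hcU : c.1 ∉ U := fun h => (hT c).mpr h hc
    obtain ⟨a, ha⟩ := exists_notMem_of_notMem hU hη hcU
    refine ⟨G a, ⟨a, rfl⟩, ?_⟩
    by_contra! hle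
    obtain ⟨b, hb⟩ := (valuationAt_le_one_iff k c _).mp hle
    exact ha b hb
  · have := LocallyOfFiniteType.jacobsonSpace (C ↘ Spec (.of k))
    obtain ⟨c, hcU, hc⟩ := nonempty_inter_closedPoints (X := C) (Z := U) ⟨_, hη⟩
      U.isOpen.isLocallyClosed
    exact ⟨⟨c, hc⟩, (hT _).mpr hcU⟩
  · have := finiteType_sections k hU
    exact Algebra.FiniteType.equiv this e
  · intro p hp h0
    have h1 : p = (p.comap (e : Γ(C, U) →+* G.range)).comap (e.symm : G.range →+* Γ(C, U)) := by
      ext x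
      simp [Ideal.mem_comap]
    have h2 := isMaximal_of_isPrime k hU (p.comap (e : Γ(C, U) →+* G.range)) inferInstance (by
      intro h
      rw [h] at h1
      refine h0 (h1.trans ?_)
      exact (RingHom.injective_iff_ker_eq_bot _).mp e.symm.injective)
    rw [h1]
    exact Ideal.comap_isMaximal_of_surjective _ e.symm.surjective
  · intro f
    obtain ⟨a, b, hb, rfl⟩ := IsFractionRing.div_surjective (A := Γ(C, U)) f
    have hGa : ∀ a : Γ(C, U), algebraMap Γ(C, U) C.functionField a = G a := fun a => rfl
    have hb0 : G b ≠ 0 := (map_ne_zero_iff G hGinj).mpr (nonZeroDivisors.ne_zero hb)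
    refine ⟨G b, ⟨b, rfl⟩, hb0, a, ?_⟩
    rw [hGa, hGa]
    exact (mul_div_cancel₀ (G a) hb0).symm

lemma genus_eq [IsProper (C ↘ Spec (.of k))] :
    genus k C = Module.finrank k ((curvePlaces k C).H1 0) := by
  let S := curvePlaces k C
  have hreps : repartitions k C = Places.reps S.O := rfl
  have key : ∀ r : Places.reps S.O, r.1 ∈ integralRepartitions k C ⊔ principalRepartitions k C ↔
      r ∈ S.bounded 0 ⊔ LinearMap.range S.diag := by
    intro r
    refine Submodule.mem_sup.trans (Iff.trans ?_ Submodule.mem_sup.symm)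
    constructor
    · rintro ⟨y, hy, z, ⟨f, rfl⟩, hyz⟩
      have hyr : y ∈ Places.reps S.O :=
        Set.finite_empty.subset fun x hx => hx (hy x trivial)
      exact ⟨⟨y, hyr⟩, fun c => (S.mem_O c _).mp (hy c trivial), S.diag f, ⟨f, rfl⟩,
        Subtype.ext hyz⟩
    · rintro ⟨y, hy, _, ⟨f, rfl⟩, rfl⟩
      exact ⟨y.1, fun c _ => (S.mem_O c _).mpr (hy c), _, ⟨f, rfl⟩, rfl⟩
  have : (integralRepartitions k C ⊔ principalRepartitions k C).comap (repartitions k C).subtype =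
      S.bounded 0 ⊔ LinearMap.range S.diag := Submodule.ext key
  rw [genus, this]
  rfl

end Genus

end

/-! ### Orders of vanishing, and sections of line bundles as rational functions -/

section

open WithZero Polynomial

section DVR

variable {k A : Type*} [Field k] [CommRing A] [IsDomain A] [IsDiscreteValuationRing A] [Algebra k A]

lemma le_ord_iff_mem_pow (x : A) (n : ℕ) :
    (n : ℕ∞) ≤ Ring.ord A x ↔ x ∈ IsLocalRing.maximalIdeal A ^ n := by
  obtain ⟨ϖ, hϖ⟩ := IsDiscreteValuationRing.exists_irreducible A
  rw [Ring.ord_eq_addVal, hϖ.maximalIdeal_eq, Ideal.span_singleton_pow,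
    Ideal.mem_span_singleton, ← IsDiscreteValuationRing.addVal_le_iff_dvd,
    IsDiscreteValuationRing.addVal_pow, IsDiscreteValuationRing.addVal_uniformizer hϖ]
  simp

/-- A polynomial in a uniformizer lies in `𝔪ⁿ` if and only if its first `n` coefficients vanish. -/
lemma aeval_mem_pow_iff {τ : A} (hτ : IsLocalRing.maximalIdeal A = Ideal.span {τ}) (p : k[X])
    (n : ℕ) : aeval τ p ∈ IsLocalRing.maximalIdeal A ^ n ↔ ∀ l < n, p.coeff l = 0 := by
  have hτ0 : τ ≠ 0 := by
    rintro rfl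
    refine IsDiscreteValuationRing.not_a_field A ?_
    rw [hτ, Ideal.span_singleton_eq_bot]
  rw [hτ, Ideal.span_singleton_pow, Ideal.mem_span_singleton, ← X_pow_dvd_iff]
  refine ⟨fun h => ?_, fun ⟨q, hq⟩ => ⟨aeval τ q, by rw [hq]; simp⟩⟩
  by_cases hp : p = 0
  · rw [hp]
    exact dvd_zero _
  -- Write p = X^m q with q(0) ≠ 0. Then q(τ) is a unit, since q(0) is a nonzero constant and the
  -- rest lies in 𝔪, so p(τ) has order exactly m.
  obtain ⟨q, hq, hq0⟩ := exists_eq_pow_rootMultiplicity_mul_and_not_dvd p hp 0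
  rw [C_0, sub_zero] at hq hq0
  set m := p.rootMultiplicity 0
  have hunit : IsUnit (aeval τ q) := by
    rw [X_dvd_iff] at hq0
    have h1 : aeval τ q = algebraMap k A (q.coeff 0) + τ * aeval τ q.divX := by
      conv_lhs => rw [← divX_mul_X_add q]
      simp
      ring
    rw [h1]
    by_contra hn
    have h2 : τ * aeval τ q.divX ∈ IsLocalRing.maximalIdeal A := by
      rw [hτ]
      exact Ideal.mul_mem_right _ _ (Ideal.mem_span_singleton_self τ)
    have h3 := (Ideal.add_mem_iff_left _ h2).mp ((IsLocalRing.mem_maximalIdeal _).mpr hn)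
    exact (IsLocalRing.mem_maximalIdeal _).mp h3 ((IsUnit.mk0 _ hq0).map (algebraMap k A))
  have h1 : τ ^ n ∣ τ ^ m := by
    rw [hq, map_mul, map_pow, aeval_X] at h
    exact (hunit.dvd_mul_right).mp h
  have hnu : ¬ IsUnit τ := by
    rw [← mem_nonunits_iff, ← IsLocalRing.mem_maximalIdeal, hτ]
    exact Ideal.mem_span_singleton_self τ
  have h2 : n ≤ m := (pow_dvd_pow_iff hτ0 hnu).mp h1
  rw [hq]
  exact Dvd.dvd.mul_right (pow_dvd_pow _ h2) _

end DVR

section Order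

variable (k : Type u) [Field k] [IsAlgClosed k] {C : Scheme.{u}} [C.Over (Spec (.of k))]
    [AlgebraicGeometry.IsIntegral C] [SmoothOfRelativeDimension 1 (C ↘ Spec (.of k))]

lemma coheight_eq_one (k : Type u) [Field k] [IsAlgClosed k] {C : Scheme.{u}}
    [C.Over (Spec (.of k))] [AlgebraicGeometry.IsIntegral C]
    [SmoothOfRelativeDimension 1 (C ↘ Spec (.of k))] (c : closedPoints C) :
    Order.coheight c.1 = 1 := by
  have := isDiscreteValuationRing_stalk k c
  have h1 := ringKrullDim_stalk_eq_coheight c.1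
  rw [IsDiscreteValuationRing.ringKrullDim_eq_one] at h1
  exact_mod_cast h1.symm

lemma valuationAt_eq_exp_ord [IsLocallyNoetherian C] (c : closedPoints C) {f : C.functionField}
    (hf : f ≠ 0) : valuationAt k C c f = exp (-(C.ord f c.1)) := by
  have := isDiscreteValuationRing_stalk k c
  have hz := coheight_eq_one k c
  have h1 := (Scheme.ord_eq_iff hz hf).mp rfl
  have h2 : Ring.ordFrac (C.presheaf.stalk c.1) f = exp (C.ord f c.1) := h1
  rw [Ring.ordFrac_eq_valuation_inv] at h2
  rw [exp_neg, ← h2, inv_inv]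
  rfl

lemma algebraMap_mem_pow_iff (c : closedPoints C) (x : C.presheaf.stalk c.1) (n : ℕ) :
    x ∈ IsLocalRing.maximalIdeal (C.presheaf.stalk c.1) ^ n ↔
      valuationAt k C c (algebraMap _ _ x) ≤ exp (-n : ℤ) := by
  have := isDiscreteValuationRing_stalk k c
  obtain ⟨ϖ, hϖ⟩ := exists_irreducible_stalk k c
  have hv : valuationAt k C c (algebraMap _ _ (ϖ ^ n)) = exp (-n : ℤ) := by
    rw [map_pow, map_pow, valuationAt_irreducible k c hϖ, ← exp_nsmul]
    simp
  have h0 : algebraMap (C.presheaf.stalk c.1) C.functionField (ϖ ^ n) ≠ 0 := by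
    intro h
    rw [h, map_zero] at hv
    exact exp_ne_zero hv.symm
  rw [hϖ.maximalIdeal_eq, Ideal.span_singleton_pow, Ideal.mem_span_singleton]
  constructor
  · rintro ⟨y, rfl⟩
    rw [map_mul, map_mul, hv]
    exact mul_le_of_le_one_right' ((valuationAt_le_one_iff k c _).mpr ⟨y, rfl⟩)
  · intro h
    obtain ⟨y, hy⟩ := (valuationAt_le_one_iff k c (algebraMap _ _ x / algebraMap _ _ (ϖ ^ n))).mp (by
      rw [map_div₀, hv]
      exact div_le_one_of_le₀ h zero_le)
    refine ⟨y, IsFractionRing.injective (C.presheaf.stalk c.1) C.functionField ?_⟩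
    rw [map_mul, hy, mul_div_cancel₀ _ h0]

end Order

namespace LineBundle

section Generic

variable {C : Scheme.{u}} [AlgebraicGeometry.IsIntegral C] (L : LineBundle C)

/-- The transition function `g i j` as a rational function. -/
def gen (i j : L.ι) (hi : genericPoint C ∈ L.U i) (hj : genericPoint C ∈ L.U j) : C.functionField :=
  C.presheaf.germ (L.U i ⊓ L.U j) (genericPoint C) ⟨hi, hj⟩ (L.g i j).1

lemma gen_ne_zero (i j : L.ι) (hi : genericPoint C ∈ L.U i) (hj : genericPoint C ∈ L.U j) :
    L.gen i j hi hj ≠ 0 :=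
  ((L.g i j).isUnit.map (C.presheaf.germ (L.U i ⊓ L.U j) (genericPoint C) ⟨hi, hj⟩).hom).ne_zero

lemma gen_mul (i j l : L.ι) (hi : genericPoint C ∈ L.U i) (hj : genericPoint C ∈ L.U j)
    (hl : genericPoint C ∈ L.U l) : L.gen i j hi hj * L.gen j l hj hl = L.gen i l hi hl := by
  have key : ∀ {U V : C.Opens} (h : U ≤ V) (hx : genericPoint C ∈ U) (s : Γ(C, V)),
      C.presheaf.germ U (genericPoint C) hx (C.presheaf.map (homOfLE h).op s) =
        C.presheaf.germ V (genericPoint C) (h hx) s :=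
    fun h hx s => TopCat.Presheaf.germ_res_apply C.presheaf _ _ _ _
  have hx : genericPoint C ∈ L.U i ⊓ L.U j ⊓ L.U l := ⟨⟨hi, hj⟩, hl⟩
  have h := congrArg (C.presheaf.germ (L.U i ⊓ L.U j ⊓ L.U l) (genericPoint C) hx)
    (L.cocycle i j l)
  exact (congrArg₂ (· * ·) (key _ hx _).symm (key _ hx _).symm).trans
    ((map_mul _ _ _).symm.trans (h.trans (key _ hx _)))

lemma exists_isUnit_gen (i j : L.ι) {x : C} (hi : x ∈ L.U i) (hj : x ∈ L.U j) :
    ∃ a : C.presheaf.stalk x, IsUnit a ∧ algebraMap _ _ a =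
      L.gen i j (genericPoint_mem hi) (genericPoint_mem hj) :=
  ⟨C.presheaf.germ (L.U i ⊓ L.U j) x ⟨hi, hj⟩ (L.g i j).1,
    (L.g i j).isUnit.map (C.presheaf.germ (L.U i ⊓ L.U j) x ⟨hi, hj⟩).hom,
    algebraMap_germ (U := L.U i ⊓ L.U j) ⟨hi, hj⟩ _⟩

lemma ratSection_eq (x : C) : L.ratSection x =
    L.gen (L.idx x) (L.idx (genericPoint C)) (genericPoint_mem (L.mem_idx x)) (L.mem_idx _) := rfl

lemma pow_gen (r : ℕ) (i j : L.ι) (hi : genericPoint C ∈ L.U i) (hj : genericPoint C ∈ L.U j) :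
    C.presheaf.germ (L.U i ⊓ L.U j) (genericPoint C) ⟨hi, hj⟩ ((L.pow r).g i j).1 =
      L.gen i j hi hj ^ r := by
  rw [gen, ← map_pow]
  rfl

variable (k : Type u) [Field k] [C.Over (Spec (.of k))]

/-- A section of `L^r` as a rational function in the trivialization at the generic point. -/
def ratFun (r : ℕ) : L.V k r →ₗ[k] C.functionField where
  toFun s := germₐ k (L.U (L.idx (genericPoint C))) (genericPoint C) (L.mem_idx _)
    (s.1 (L.idx (genericPoint C)))
  map_add' _ _ := map_add _ _ _
  map_smul' a _ := map_smul (germₐ k (L.U (L.idx (genericPoint C))) _ _) a _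

lemma germ_eq_mul_ratFun {r : ℕ} (s : L.V k r) (i : L.ι) (hi : genericPoint C ∈ L.U i) :
    C.presheaf.germ (L.U i) (genericPoint C) hi (s.1 i) =
      L.gen i (L.idx (genericPoint C)) hi (L.mem_idx _) ^ r * L.ratFun k r s := by
  have h := congrArg (C.presheaf.germ (L.U i ⊓ L.U (L.idx (genericPoint C))) (genericPoint C)
    ⟨hi, L.mem_idx _⟩) (s.2 i (L.idx (genericPoint C)))
  rw [map_mul, L.pow_gen r i (L.idx (genericPoint C)) hi (L.mem_idx _)] at h
  have h1 := TopCat.Presheaf.germ_res_apply C.presheaf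
    (homOfLE (inf_le_left : L.U i ⊓ L.U (L.idx (genericPoint C)) ≤ _)) (genericPoint C)
    ⟨hi, L.mem_idx _⟩ (s.1 i)
  have h2 := TopCat.Presheaf.germ_res_apply C.presheaf
    (homOfLE (inf_le_right : L.U i ⊓ L.U (L.idx (genericPoint C)) ≤ _)) (genericPoint C)
    ⟨hi, L.mem_idx _⟩ (s.1 (L.idx (genericPoint C)))
  exact h1.symm.trans (h.trans (congrArg _ h2))

lemma ratFun_injective (r : ℕ) : Function.Injective (L.ratFun k r) := by
  intro s t h
  refine Subtype.ext (funext fun i => ?_)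
  by_cases hi : genericPoint C ∈ L.U i
  · refine germ_injective_of_isIntegral C (genericPoint C) hi ?_
    rw [germ_eq_mul_ratFun, germ_eq_mul_ratFun, h]
  -- A member of the cover that misses the generic point is empty, and its ring of functions is
  -- zero.
  · have hbot : L.U i = ⊥ := by
      by_contra hne
      obtain ⟨x, hx⟩ := Opens.ne_bot_iff_nonempty _ |>.mp hne
      exact hi (genericPoint_mem hx)
    have : Subsingleton Γ(C, L.U i) := by
      rw [hbot]
      infer_instance
    exact Subsingleton.elim _ _

/-- Rational functions that are regular in all trivializations come from sections. -/
lemma exists_section [JacobsonSpace C] (r : ℕ) (f : C.functionField)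
    (hf : ∀ c ∈ closedPoints C, ∃ a : C.presheaf.stalk c,
      algebraMap _ C.functionField a = L.ratSection c ^ r * f) : ∃ s : L.V k r, L.ratFun k r s = f := by
  have h1 : ∀ i, ∃ s : Γ(C, L.U i), ∀ h : genericPoint C ∈ L.U i,
      C.presheaf.germ (L.U i) (genericPoint C) h s =
        L.gen i (L.idx (genericPoint C)) h (L.mem_idx _) ^ r * f := by
    intro i
    by_cases hi : genericPoint C ∈ L.U i
    · obtain ⟨s, hs⟩ := exists_section_of_forall_mem
        (L.gen i (L.idx (genericPoint C)) hi (L.mem_idx _) ^ r * f) (L.U i) (fun c hc hci => by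
          obtain ⟨a, ha⟩ := hf c hc
          obtain ⟨b, -, hb⟩ := L.exists_isUnit_gen i (L.idx c) hci (L.mem_idx c)
          refine ⟨b ^ r * a, ?_⟩
          rw [map_mul, map_pow, hb, ha, ratSection_eq, ← mul_assoc, ← mul_pow, gen_mul])
      exact ⟨s, hs⟩
    · exact ⟨0, fun h => (hi h).elim⟩
  choose s hs using h1
  refine ⟨⟨s, fun i j => ?_⟩, ?_⟩
  · by_cases hij : genericPoint C ∈ L.U i ⊓ L.U j
    · refine germ_injective_of_isIntegral C (genericPoint C) hij ?_
      rw [map_mul, L.pow_gen r i j hij.1 hij.2]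
      have h1 := TopCat.Presheaf.germ_res_apply C.presheaf
        (homOfLE (inf_le_left : L.U i ⊓ L.U j ≤ _)) (genericPoint C) hij (s i)
      have h2 := TopCat.Presheaf.germ_res_apply C.presheaf
        (homOfLE (inf_le_right : L.U i ⊓ L.U j ≤ _)) (genericPoint C) hij (s j)
      refine h1.trans (Eq.trans ?_ (congrArg _ h2.symm))
      rw [hs i hij.1, hs j hij.2, ← mul_assoc, ← mul_pow, gen_mul]
    · have hbot : L.U i ⊓ L.U j = ⊥ := by
        by_contra hne
        obtain ⟨x, hx⟩ := Opens.ne_bot_iff_nonempty _ |>.mp hne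
        exact hij (genericPoint_mem hx)
      have : Subsingleton Γ(C, L.U i ⊓ L.U j) := by
        rw [hbot]
        infer_instance
      exact Subsingleton.elim _ _
  · have h2 := hs (L.idx (genericPoint C)) (L.mem_idx _)
    refine h2.trans ?_
    -- The cocycle condition with three equal indices forces the diagonal transition function to be
    -- 1.
    have h3 := L.gen_mul _ _ _ (L.mem_idx (genericPoint C)) (L.mem_idx (genericPoint C))
      (L.mem_idx (genericPoint C))
    rw [mul_eq_left₀ (L.gen_ne_zero _ _ _ _)] at h3
    rw [h3, one_pow, one_mul]

end Generic

end LineBundle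

end

/-! ### The divisor of a line bundle and sections with prescribed jets -/

section

open WithZero Polynomial

namespace LineBundle

section Divisor

variable (k : Type u) [Field k] [IsAlgClosed k] {C : Scheme.{u}} [C.Over (Spec (.of k))]
    [AlgebraicGeometry.IsIntegral C] [IsProper (C ↘ Spec (.of k))]
    [SmoothOfRelativeDimension 1 (C ↘ Spec (.of k))] (L : LineBundle C)

lemma ratSection_ne_zero {C : Scheme.{u}} [AlgebraicGeometry.IsIntegral C] (L : LineBundle C)
    (x : C) : L.ratSection x ≠ 0 :=
  L.gen_ne_zero _ _ (genericPoint_mem (L.mem_idx x)) (L.mem_idx _)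

/-- On the open set where the bundle is trivialized around the generic point, the rational section
is a transition function and hence a unit. The complement of this open set is finite. -/
lemma finite_ord_ratSection (k : Type u) [Field k] [IsAlgClosed k] {C : Scheme.{u}}
    [C.Over (Spec (.of k))] [AlgebraicGeometry.IsIntegral C] [IsProper (C ↘ Spec (.of k))]
    [SmoothOfRelativeDimension 1 (C ↘ Spec (.of k))] (L : LineBundle C) [IsLocallyNoetherian C] :
    {c : closedPoints C | C.ord (L.ratSection c.1) c.1 ≠ 0}.Finite := by
  have := compactSpace_of_proper k C
  let W := L.U (L.idx (genericPoint C))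
  have hfin : (W : Set C)ᶜ.Finite :=
    (finite_of_isClosed k W.isOpen.isClosed_compl fun h => by
      have : genericPoint C ∈ (W : Set C)ᶜ := h ▸ trivial
      exact this (L.mem_idx _)).1
  refine (hfin.preimage Subtype.val_injective.injOn).subset fun c hc hcW => hc ?_
  have hx : c.1 ∈ L.U (L.idx c.1) ⊓ W := ⟨L.mem_idx _, hcW⟩
  have : Nonempty ((L.U (L.idx c.1) ⊓ W : C.Opens)) := ⟨⟨_, hx⟩⟩
  exact Scheme.ord_of_isUnit (L.g (L.idx c.1) (L.idx (genericPoint C))).isUnit hx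

/-- The divisor of the rational section of `L`. -/
def divisor : closedPoints C →₀ ℤ :=
  haveI := isLocallyNoetherian_of_smooth k C
  Finsupp.ofSupportFinite (fun c => C.ord (L.ratSection c.1) c.1) (finite_ord_ratSection k L)

lemma degree_eq : haveI := locallyOfFiniteType_of_smooth k (C := C)
    L.degree k = Places.deg (L.divisor k) := by
  have := locallyOfFiniteType_of_smooth k (C := C)
  have := isLocallyNoetherian_of_smooth k C
  have h1 : L.degree k = ∑ᶠ x : C, C.ord (L.ratSection x) x := rfl
  have h2 : ∑ᶠ x : C, C.ord (L.ratSection x) x =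
      ∑ᶠ x ∈ closedPoints C, C.ord (L.ratSection x) x := by
    -- The only point that is not closed is the generic one. It has coheight 0, so its order is 0 by
    -- convention.
    refine finsum_congr fun x => ?_
    by_cases hx : x ∈ closedPoints C
    · simp [hx]
    · simp only [hx, finsum_false]
      have hg := (isClosed_or_eq_genericPoint k x).resolve_left hx
      refine Scheme.ord_eq_zero_of_coheight_neq_one (fun h => ?_) _
      have h3 : IsMax x := by
        rw [hg]
        intro y _
        exact genericPoint_specializes y
      rw [Order.coheight_eq_zero.mpr h3] at h
      exact zero_ne_one h
  rw [h1, h2, ← finsum_set_coe_eq_finsum_mem]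
  rw [finsum_eq_sum_of_support_subset (s := (L.divisor k).support)]
  · rfl
  · intro c hc
    exact Finsupp.mem_support_iff.mpr hc

lemma valuationAt_ratSection (c : closedPoints C) :
    valuationAt k C c (L.ratSection c.1) = exp (-(L.divisor k c)) := by
  have := isLocallyNoetherian_of_smooth k C
  exact valuationAt_eq_exp_ord k c (L.ratSection_ne_zero c.1)

lemma valuationAt_gen (c : closedPoints C) {i : L.ι} (hc : c.1 ∈ L.U i) :
    valuationAt k C c (L.gen i (L.idx (genericPoint C)) (genericPoint_mem hc) (L.mem_idx _)) =
      exp (-(L.divisor k c)) := by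
  have := isDiscreteValuationRing_stalk k c
  obtain ⟨a, ha, h⟩ := L.exists_isUnit_gen i (L.idx c.1) hc (L.mem_idx c.1)
  have h1 : valuationAt k C c (algebraMap _ _ a) = 1 := by
    refine le_antisymm (IsDedekindDomain.HeightOneSpectrum.valuation_le_one _ _) (not_lt.mp ?_)
    intro h2
    exact (IsDedekindDomain.HeightOneSpectrum.valuation_lt_one_iff_mem _ _).mp h2 ha
  rw [← L.gen_mul i (L.idx c.1) _ (genericPoint_mem hc) (genericPoint_mem (L.mem_idx c.1)),
    map_mul, ← h, h1, one_mul, ← ratSection_eq, valuationAt_ratSection]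

lemma ratFun_mem_H0 {r : ℕ} (s : L.V k r) :
    L.ratFun k r s ∈ (curvePlaces k C).H0 (r • L.divisor k) := by
  rw [Places.mem_H0]
  intro c
  have h1 := L.germ_eq_mul_ratFun k s (L.idx c.1) (genericPoint_mem (L.mem_idx _))
  have h2 : valuationAt k C c (L.ratSection c.1 ^ r * L.ratFun k r s) ≤ 1 :=
    (valuationAt_le_one_iff k c _).mpr ⟨_, (algebraMap_germ (L.mem_idx c.1) _).trans h1⟩
  rw [map_mul, map_pow, valuationAt_ratSection, ← exp_nsmul] at h2
  have h3 := mul_le_mul_right h2 (exp (r • L.divisor k c))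
  rw [← mul_assoc, ← exp_add, mul_one] at h3
  have h4 : r • L.divisor k c + r • -(L.divisor k c) = 0 := by simp
  rw [h4, exp_zero, one_mul] at h3
  exact h3

lemma exists_ratFun_eq {r : ℕ} (f : C.functionField)
    (hf : ∀ c, valuationAt k C c f ≤ exp (r • L.divisor k c)) : ∃ s : L.V k r, L.ratFun k r s = f := by
  have := locallyOfFiniteType_of_smooth k (C := C)
  have := LocallyOfFiniteType.jacobsonSpace (C ↘ Spec (.of k))
  refine L.exists_section k r f fun c hc => ?_
  refine (valuationAt_le_one_iff k ⟨c, hc⟩ _).mp ?_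
  have h1 := L.valuationAt_ratSection k ⟨c, hc⟩
  rw [map_mul, map_pow, h1, ← exp_nsmul]
  refine (mul_le_mul_right (hf ⟨c, hc⟩) _).trans (le_of_eq ?_)
  rw [← exp_add, ← exp_zero]
  congr 1
  simp

lemma finiteDimensional_V (r : ℕ) : FiniteDimensional k (L.V k r) := by
  have := (curvePlaces k C).finiteDimensional_H0 (finiteDimensional_H1_curve k) (r • L.divisor k)
  refine FiniteDimensional.of_injective
    ((L.ratFun k r).codRestrict ((curvePlaces k C).H0 (r • L.divisor k)) (L.ratFun_mem_H0 k)) ?_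
  intro s t h
  exact L.ratFun_injective k r (congrArg Subtype.val h)

/-- Sections of `L^r` with prescribed jets at two points. -/
lemma exists_section_sub_mem {r n n' : ℕ}
    (hr : (n + n' : ℤ) + 2 * genus k C ≤ r * Places.deg (L.divisor k) + 1)
    {c c' : Pt k C} (hne : c ≠ c') {i i' : L.ι} (hi : c.point ∈ L.U i) (hi' : c'.point ∈ L.U i')
    (x : C.presheaf.stalk c.point) (x' : C.presheaf.stalk c'.point) :
    ∃ s : L.V k r,
      C.presheaf.germ (L.U i) c.point hi (s.1 i) - x ∈
        IsLocalRing.maximalIdeal (C.presheaf.stalk c.point) ^ n ∧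
      C.presheaf.germ (L.U i') c'.point hi' (s.1 i') - x' ∈
        IsLocalRing.maximalIdeal (C.presheaf.stalk c'.point) ^ n' := by
  classical
  have := locallyOfFiniteType_of_smooth k (C := C)
  let S := curvePlaces k C
  let E := L.divisor k
  let d : closedPoints C := ⟨c.point, c.isClosed_point⟩
  let d' : closedPoints C := ⟨c'.point, c'.isClosed_point⟩
  have hd : d ≠ d' := fun h => hne (Pt.point_injective (congrArg Subtype.val h))
  let γ := L.gen i (L.idx (genericPoint C)) (genericPoint_mem hi) (L.mem_idx _)
  let γ' := L.gen i' (L.idx (genericPoint C)) (genericPoint_mem hi') (L.mem_idx _)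
  have hγ0 : γ ≠ 0 := L.gen_ne_zero _ _ _ _
  have hγ0' : γ' ≠ 0 := L.gen_ne_zero _ _ _ _
  have hγ : S.v d γ = exp (-(E d)) := L.valuationAt_gen k d hi
  have hγ' : S.v d' γ' = exp (-(E d')) := L.valuationAt_gen k d' hi'
  -- The prescribed germs, rewritten as rational functions in the trivialization at the generic
  -- point.
  let y : C.functionField := algebraMap _ _ x / γ ^ r
  let y' : C.functionField := algebraMap _ _ x' / γ' ^ r
  let ρ : closedPoints C → C.functionField := Function.update (Function.update 0 d y) d' y'
  have hρd : ρ d = y := by simp [ρ, hd]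
  have hρd' : ρ d' = y' := by simp [ρ]
  have hρ : ∀ e, e ≠ d → e ≠ d' → ρ e = 0 := fun e h h' => by simp [ρ, h, h']
  let R : Places.reps S.O := ⟨ρ, (Set.toFinite {d, d'}).subset fun e he => by
    by_contra h
    simp only [Set.mem_insert_iff, Set.mem_singleton_iff, not_or] at h
    refine he ?_
    rw [hρ e h.1 h.2]
    exact (S.O e).zero_mem⟩
  -- The divisor of L^r twisted down by n times the first point and n' times the second. The
  -- hypothesis `hr` says that its degree is at least 2g − 1, so the repartition R can be
  -- approximated by a rational function to within this divisor.
  let E' : closedPoints C →₀ ℤ := r • E + (Finsupp.single d (-n : ℤ) + Finsupp.single d' (-n' : ℤ))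
  have hsm : Places.deg (r • E) = r * Places.deg E := by
    clear * -
    induction r with
    | zero => simp [Places.deg]
    | succ m ih => rw [succ_nsmul, Places.deg_add, ih]; push_cast; ring
  have hE' : 2 * (Module.finrank k (S.H1 0) : ℤ) - 1 ≤ Places.deg E' := by
    rw [Places.deg_add, Places.deg_add, Places.deg_single, Places.deg_single, hsm]
    rw [genus_eq] at hr
    linarith
  obtain ⟨f, hf⟩ := S.exists_approx (finiteDimensional_H1_curve k) hE' R
  have hE'd : E' d = r * E d - n := by
    have h0 : d' ≠ d := hd.symm
    simp [E', h0]
    ring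
  have hE'd' : E' d' = r * E d' - n' := by
    simp [E', hd]
    ring
  have hE'e : ∀ e, e ≠ d → e ≠ d' → E' e = r * E e := fun e h h' => by
    simp [E', h, h']
  have hfd : S.v d (y - f) ≤ exp (r * E d - n) := by
    rw [← hE'd, ← hρd]
    exact hf d
  have hfd' : S.v d' (y' - f) ≤ exp (r * E d' - n') := by
    rw [← hE'd', ← hρd']
    exact hf d'
  have hpow : ∀ m : ℤ, (exp (-m)) ^ r = exp (-(r * m)) := fun m => by
    rw [← exp_nsmul]
    simp
  have hy : S.v d y ≤ exp (r * E d) := by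
    rw [map_div₀, map_pow, hγ, hpow, exp_neg, div_inv_eq_mul]
    exact mul_le_of_le_one_left' ((valuationAt_le_one_iff k d _).mpr ⟨x, rfl⟩)
  have hy' : S.v d' y' ≤ exp (r * E d') := by
    rw [map_div₀, map_pow, hγ', hpow, exp_neg, div_inv_eq_mul]
    exact mul_le_of_le_one_left' ((valuationAt_le_one_iff k d' _).mpr ⟨x', rfl⟩)
  -- f is a section of L^r: at the two points y, y' and the errors are all bounded by rE, and
  -- elsewhere f itself is the error.
  have hfE : ∀ e, valuationAt k C e f ≤ exp (r • E e) := by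
    intro e
    rw [nsmul_eq_mul]
    by_cases h : e = d
    · subst h
      have h1 : f = y - (y - f) := by ring
      rw [h1]
      refine Valuation.map_sub_le _ hy (hfd.trans ?_)
      rw [exp_le_exp]
      omega
    by_cases h' : e = d'
    · subst h'
      have h1 : f = y' - (y' - f) := by ring
      rw [h1]
      refine Valuation.map_sub_le _ hy' (hfd'.trans ?_)
      rw [exp_le_exp]
      omega
    have h1 := hf e
    change S.v e (ρ e - f) ≤ _ at h1
    rw [hρ e h h', zero_sub, Valuation.map_neg, hE'e e h h'] at h1
    exact h1
  obtain ⟨s, hs⟩ := L.exists_ratFun_eq k f hfE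
  refine ⟨s, ?_, ?_⟩
  · refine (algebraMap_mem_pow_iff k d _ n).mpr ?_
    have h1 := (algebraMap_germ hi (s.1 i)).trans
      (L.germ_eq_mul_ratFun k s i (genericPoint_mem hi))
    rw [map_sub]
    have h2 : γ ^ r * f - algebraMap _ _ x = -(γ ^ r * (y - f)) := by
      simp only [y]
      field_simp
      ring
    have h3 : valuationAt k C d (γ ^ r * f - algebraMap _ _ x) ≤ exp (-n : ℤ) := by
      rw [h2, Valuation.map_neg, map_mul, map_pow]
      change S.v d γ ^ r * S.v d (y - f) ≤ _
      rw [hγ, hpow]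
      refine (mul_le_mul_right hfd _).trans (le_of_eq ?_)
      rw [← exp_add]
      congr 1
      ring
    rw [← hs] at h3
    exact (congrArg (fun z => valuationAt k C d (z - algebraMap _ _ x)) h1).trans_le h3
  · refine (algebraMap_mem_pow_iff k d' _ n').mpr ?_
    have h1 := (algebraMap_germ hi' (s.1 i')).trans
      (L.germ_eq_mul_ratFun k s i' (genericPoint_mem hi'))
    rw [map_sub]
    have h2 : γ' ^ r * f - algebraMap _ _ x' = -(γ' ^ r * (y' - f)) := by
      simp only [y']
      field_simp
      ring
    have h3 : valuationAt k C d' (γ' ^ r * f - algebraMap _ _ x') ≤ exp (-n' : ℤ) := by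
      rw [h2, Valuation.map_neg, map_mul, map_pow]
      change S.v d' γ' ^ r * S.v d' (y' - f) ≤ _
      rw [hγ', hpow]
      refine (mul_le_mul_right hfd' _).trans (le_of_eq ?_)
      rw [← exp_add]
      congr 1
      ring
    rw [← hs] at h3
    exact (congrArg (fun z => valuationAt k C d' (z - algebraMap _ _ x')) h1).trans_le h3

end Divisor

end LineBundle

end

/-! ### Coordinate charts, jets of sections, and orders of vanishing in terms of jets -/

section

open Polynomial

namespace LineBundle

/-- A coordinate neighbourhood on a curve over which `L` is trivialized, together with operators
that compute Taylor expansions up to order `d`. -/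
structure Chart (k : Type u) [Field k] {C : Scheme.{u}} [C.Over (Spec (.of k))] (L : LineBundle C)
    (d : ℕ) where
  /-- the index of the trivialization -/
  i : L.ι
  /-- the coordinate neighbourhood -/
  U : C.Opens
  affine : IsAffineOpen U
  le : U ≤ L.U i
  /-- the coordinate -/
  t : Γ(C, U)
  span : Submodule.span Γ(C, U) {KaehlerDifferential.D k Γ(C, U) t} = ⊤
  /-- the Taylor coefficients -/
  D : ℕ → (Γ(C, U) →ₗ[k] Γ(C, U))
  taylor : ∀ (c : Pt k C) (h : c.point ∈ U) (f : Γ(C, U)),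
    germₐ k U c.point h f - ∑ l ∈ Finset.range d,
      algebraMap k _ (c.eval U h (D l f)) * c.shift h t ^ l ∈
        IsLocalRing.maximalIdeal (C.presheaf.stalk c.point) ^ d

section

variable (k : Type u) [Field k] {C : Scheme.{u}} [C.Over (Spec (.of k))]
  [SmoothOfRelativeDimension 1 (C ↘ Spec (.of k))]

lemma exists_chart (L : LineBundle C) (x : C) (d : ℕ) : ∃ ch : L.Chart k d, x ∈ ch.U := by
  obtain ⟨V, hV, hx, hle, -, t, ht⟩ := exists_affine_coordinate k x (L.U (L.idx x)) (L.mem_idx x)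
  obtain ⟨D, hD⟩ := exists_taylor_stalk hV ht d
  exact ⟨⟨L.idx x, V, hV, hle, t, ht, D, hD⟩, hx⟩

end

namespace Chart

variable {k : Type u} [Field k] {C : Scheme.{u}} [C.Over (Spec (.of k))] {L : LineBundle C} {d : ℕ}
  (ch : L.Chart k d)

/-- The `l`-th Taylor coefficient of a section of `L^r`. -/
def jet (r l : ℕ) : L.V k r →ₗ[k] Γ(C, ch.U) :=
  ch.D l ∘ₗ (restr (k := k) ch.le).toLinearMap ∘ₗ LinearMap.proj ch.i ∘ₗ (L.V k r).subtype

/-- The Taylor polynomial of a section of `L^r` at a point. -/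
def poly (c : Pt k C) (h : c.point ∈ ch.U) {r : ℕ} (s : L.V k r) : k[X] :=
  ∑ l ∈ Finset.range d, Polynomial.C (c.eval ch.U h (ch.jet r l s)) * X ^ l

lemma coeff_poly (c : Pt k C) (h : c.point ∈ ch.U) {r : ℕ} (s : L.V k r) {l : ℕ} (hl : l < d) :
    (ch.poly c h s).coeff l = c.eval ch.U h (ch.jet r l s) := by
  simp [poly, coeff_X_pow, hl]

lemma germ_sub_aeval_mem (c : Pt k C) (h : c.point ∈ ch.U) {r : ℕ} (s : L.V k r) :
    C.presheaf.germ (L.U ch.i) c.point (ch.le h) (s.1 ch.i) -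
      aeval (c.shift h ch.t) (ch.poly c h s) ∈
        IsLocalRing.maximalIdeal (C.presheaf.stalk c.point) ^ d := by
  have h1 := ch.taylor c h (restr (k := k) ch.le (s.1 ch.i))
  have h2 : germₐ k ch.U c.point h (restr (k := k) ch.le (s.1 ch.i)) =
      C.presheaf.germ (L.U ch.i) c.point (ch.le h) (s.1 ch.i) :=
    TopCat.Presheaf.germ_res_apply C.presheaf (homOfLE ch.le) c.point h (s.1 ch.i)
  have h3 : aeval (c.shift h ch.t) (ch.poly c h s) = ∑ l ∈ Finset.range d,
      algebraMap k (C.presheaf.stalk c.point)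
        (c.eval ch.U h (ch.D l (restr (k := k) ch.le (s.1 ch.i)))) * c.shift h ch.t ^ l := by
    rw [poly, map_sum]
    refine Finset.sum_congr rfl fun l _ => ?_
    rw [map_mul, map_pow, aeval_C, aeval_X]
    rfl
  rw [h3, ← h2]
  exact h1

/-- The order of vanishing can be computed in any trivialization. -/
lemma ord_germ_eq_val {r : ℕ} (s : (L.pow r).H0 k) {x : C} {i : L.ι} (hx : x ∈ L.U i) :
    (L.pow r).val s x = Ring.ord (C.presheaf.stalk x) (C.presheaf.germ (L.U i) x hx (s.1 i)) := by
  let j := (L.pow r).idx x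
  have hj : x ∈ L.U j := (L.pow r).mem_idx x
  have hij : x ∈ L.U i ⊓ L.U j := ⟨hx, hj⟩
  have h := congrArg (C.presheaf.germ (L.U i ⊓ L.U j) x hij) (s.2 i j)
  rw [map_mul] at h
  have h1 := TopCat.Presheaf.germ_res_apply C.presheaf
    (homOfLE (inf_le_left : L.U i ⊓ L.U j ≤ _)) x hij (s.1 i)
  have h2 := TopCat.Presheaf.germ_res_apply C.presheaf
    (homOfLE (inf_le_right : L.U i ⊓ L.U j ≤ _)) x hij (s.1 j)
  have h3 := h1.symm.trans (h.trans (congrArg _ h2))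
  have h4 : IsUnit (C.presheaf.germ (L.U i ⊓ L.U j) x hij ((L.pow r).g i j).1) :=
    ((L.pow r).g i j).isUnit.map (C.presheaf.germ (L.U i ⊓ L.U j) x hij).hom
  exact (Ring.ord_mul_of_isUnit_left h4 _).symm.trans (congrArg _ h3.symm)

variable [SmoothOfRelativeDimension 1 (C ↘ Spec (.of k))]

lemma shift_span (c : Pt k C) (h : c.point ∈ ch.U) :
    IsLocalRing.maximalIdeal (C.presheaf.stalk c.point) = Ideal.span {c.shift h ch.t} := by
  have := isLocallyNoetherian_of_smooth k C
  exact c.maximalIdeal_eq_span ch.affine h ch.span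

variable [AlgebraicGeometry.IsIntegral C]

lemma le_val_iff_aeval (c : Pt k C) (h : c.point ∈ ch.U) {r n : ℕ} (hn : n ≤ d)
    (s : (L.pow r).H0 k) (p : k[X])
    (hp : C.presheaf.germ (L.U ch.i) c.point (ch.le h) (s.1 ch.i) - aeval (c.shift h ch.t) p ∈
        IsLocalRing.maximalIdeal (C.presheaf.stalk c.point) ^ d) :
    (n : ℕ∞) ≤ (L.pow r).val s c.point ↔ ∀ l < n, p.coeff l = 0 := by
  have := c.isDiscreteValuationRing_stalk
  rw [ord_germ_eq_val s (ch.le h), le_ord_iff_mem_pow, ← aeval_mem_pow_iff (ch.shift_span c h)]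
  have h1 := Ideal.pow_le_pow_right hn hp
  rw [← sub_add_cancel (C.presheaf.germ (L.U ch.i) c.point (ch.le h) (s.1 ch.i))
    (aeval (c.shift h ch.t) p)]
  exact Ideal.add_mem_iff_right _ h1

lemma le_val_iff (c : Pt k C) (h : c.point ∈ ch.U) {r n : ℕ} (hn : n ≤ d) (s : L.V k r) :
    (n : ℕ∞) ≤ (L.pow r).val s c.point ↔ ∀ l < n, c.eval ch.U h (ch.jet r l s) = 0 := by
  rw [ch.le_val_iff_aeval c h hn s _ (ch.germ_sub_aeval_mem c h s)]
  refine forall₂_congr fun l hl => ?_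
  rw [ch.coeff_poly c h s (hl.trans_le hn)]

/-- Modulo 𝔪^d the sections a₄ and a₆ agree with their Taylor polynomials. Reduction is a ring
homomorphism, so Δ agrees with the same expression in these polynomials. -/
lemma le_val_disc_iff (c : Pt k C) (h : c.point ∈ ch.U) {n : ℕ} (hn : n ≤ d) (a₄ : L.V k 4)
    (a₆ : L.V k 6) : (n : ℕ∞) ≤ (L.pow 12).val (L.disc a₄ a₆) c.point ↔
      ∀ l < n, (4 * ch.poly c h a₄ ^ 3 - 27 * ch.poly c h a₆ ^ 2).coeff l = 0 := by
  refine ch.le_val_iff_aeval c h hn (L.disc a₄ a₆) _ ?_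
  have h4 := ch.germ_sub_aeval_mem c h a₄
  have h6 := ch.germ_sub_aeval_mem c h a₆
  have h0 : C.presheaf.germ (L.U ch.i) c.point (ch.le h) ((L.disc a₄ a₆).1 ch.i) =
      4 * C.presheaf.germ (L.U ch.i) c.point (ch.le h) (a₄.1 ch.i) ^ 3 -
        27 * C.presheaf.germ (L.U ch.i) c.point (ch.le h) (a₆.1 ch.i) ^ 2 := by
    have : (L.disc a₄ a₆).1 ch.i = 4 * a₄.1 ch.i ^ 3 - 27 * a₆.1 ch.i ^ 2 := rfl
    rw [this]
    simp only [map_sub, map_mul, map_pow, map_ofNat]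
  rw [h0, ← Ideal.Quotient.eq_zero_iff_mem]
  rw [← Ideal.Quotient.mk_eq_mk_iff_sub_mem] at h4 h6
  simp only [map_sub, map_mul, map_pow, map_ofNat, h4, h6, sub_self]

end Chart

section Jets

variable {k : Type u} [Field k] [IsAlgClosed k] {C : Scheme.{u}} [C.Over (Spec (.of k))]
    [AlgebraicGeometry.IsIntegral C] [IsProper (C ↘ Spec (.of k))]
    [SmoothOfRelativeDimension 1 (C ↘ Spec (.of k))] {L : LineBundle C}

/-- Jets at two points can be prescribed. -/
lemma Chart.exists_jet_eq {d d' : ℕ} (ch : L.Chart k d) (ch' : L.Chart k d') {r n n' : ℕ}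
    (hr : (n + n' : ℤ) + 2 * genus k C ≤ r * Places.deg (L.divisor k) + 1) (hn : n ≤ d)
    (hn' : n' ≤ d') {c c' : Pt k C} (hne : c ≠ c') (h : c.point ∈ ch.U) (h' : c'.point ∈ ch'.U)
    (α α' : ℕ → k) : ∃ s : L.V k r, (∀ l < n, c.eval ch.U h (ch.jet r l s) = α l) ∧
      ∀ l < n', c'.eval ch'.U h' (ch'.jet r l s) = α' l := by
  -- Uniqueness of Taylor coefficients: two polynomials in the uniformizer that are congruent modulo
  -- 𝔪^m have the same first m coefficients.
  have key : ∀ {m e : ℕ} (che : L.Chart k e) (b : Pt k C) (hb : b.point ∈ che.U) (hm : m ≤ e)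
      (γ : ℕ → k) (s : L.V k r), C.presheaf.germ (L.U che.i) b.point (che.le hb) (s.1 che.i) -
        aeval (b.shift hb che.t) (∑ l ∈ Finset.range m, Polynomial.C (γ l) * X ^ l) ∈
          IsLocalRing.maximalIdeal (C.presheaf.stalk b.point) ^ m →
      ∀ l < m, b.eval che.U hb (che.jet r l s) = γ l := by
    intro m e che b hb hm γ s hs l hl
    have := b.isDiscreteValuationRing_stalk
    have h1 := Ideal.pow_le_pow_right hm (che.germ_sub_aeval_mem b hb s)
    have h2 := Ideal.sub_mem _ hs h1
    rw [sub_sub_sub_cancel_left, ← map_sub, aeval_mem_pow_iff (che.shift_span b hb)] at h2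
    have h3 := h2 l hl
    rw [coeff_sub, che.coeff_poly b hb s (hl.trans_le hm), sub_eq_zero] at h3
    rw [h3]
    simp [coeff_X_pow, hl]
  obtain ⟨s, hs, hs'⟩ := L.exists_section_sub_mem k hr hne (ch.le h) (ch'.le h')
    (aeval (c.shift h ch.t) (∑ l ∈ Finset.range n, Polynomial.C (α l) * X ^ l))
    (aeval (c'.shift h' ch'.t) (∑ l ∈ Finset.range n', Polynomial.C (α' l) * X ^ l))
  exact ⟨s, key ch c h hn α s hs, key ch' c' h' hn' α' s hs'⟩

end Jets

end LineBundle

end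

/-! ### Points of schemes, families of vectors over an affine base, and regular functions on 𝔸(V) -/

section

open TensorProduct

section Points

variable {k : Type u} [Field k] {X Y : Scheme.{u}} [X.Over (Spec (.of k))] [Y.Over (Spec (.of k))]

lemma fromSpec_over {U : X.Opens} (hU : IsAffineOpen U) :
    hU.fromSpec ≫ (X ↘ Spec (.of k)) = Spec.map (CommRingCat.ofHom (algebraMap k Γ(X, U))) := by
  have h1 := IsAffineOpen.SpecMap_appLE_fromSpec (X ↘ Spec (.of k))
    (isAffineOpen_top (Spec (.of k))) hU (le_preimage_top U)
  rw [IsAffineOpen.fromSpec_top, Scheme.isoSpec_Spec_inv, ← Spec.map_comp] at h1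
  rw [← h1]
  congr 1

/-- The image of a `k`-point. -/
def Pt.map (p : Pt k X) (f : X ⟶ Y) (hf : f ≫ (Y ↘ Spec (.of k)) = X ↘ Spec (.of k)) : Pt k Y :=
  ⟨p.1 ≫ f, by rw [Category.assoc, hf, p.2]⟩

lemma Pt.eval_appLE (p : Pt k X) (f : X ⟶ Y) (hf : f ≫ (Y ↘ Spec (.of k)) = X ↘ Spec (.of k))
    {U : Y.Opens} {W : X.Opens} (h : W ≤ f ⁻¹ᵁ U) (hW : p.point ∈ W) (s : Γ(Y, U)) :
    p.eval W hW (f.appLE U W h s) = (p.map f hf).eval U (h hW) s := by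
  have := Scheme.Hom.appLE_comp_appLE p.1 f U W ⊤ h (p.mem_preimage hW)
  exact congrArg (fun g => (Scheme.ΓSpecIso (.of k)).hom (g.hom s)) this

lemma Pt.SpecMap_eval_fromSpec (p : Pt k X) {U : X.Opens} (hU : IsAffineOpen U)
    (h : p.point ∈ U) :
    Spec.map (CommRingCat.ofHom (p.eval U h).toRingHom) ≫ hU.fromSpec = p.1 := by
  have h1 := IsAffineOpen.SpecMap_appLE_fromSpec p.1 hU (isAffineOpen_top (Spec (.of k)))
    (p.mem_preimage h)
  rw [IsAffineOpen.fromSpec_top, Scheme.isoSpec_Spec_inv] at h1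
  have h2 : CommRingCat.ofHom (p.eval U h).toRingHom =
      p.1.appLE U ⊤ (p.mem_preimage h) ≫ (Scheme.ΓSpecIso (.of k)).hom := rfl
  rw [h2, Spec.map_comp, Category.assoc, h1, ← Spec.map_comp_assoc, Iso.inv_hom_id, Spec.map_id,
    Category.id_comp]

variable {E : Type u} [CommRing E] [Algebra k E]

/-- The `k`-point that a morphism `Spec E ⟶ X` attaches to a `k`-point of `E`. -/
def Pt.ofSpec (b : Spec (.of E) ⟶ X)
    (hb : b ≫ (X ↘ Spec (.of k)) = Spec.map (CommRingCat.ofHom (algebraMap k E)))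
    (e : E →ₐ[k] k) : Pt k X :=
  ⟨Spec.map (CommRingCat.ofHom e.toRingHom) ≫ b, by
    rw [Category.assoc, hb, ← Spec.map_comp, ← CommRingCat.ofHom_comp, ← Spec.map_id]
    congr 1
    ext x
    simp⟩

/-- The preimage of an open set in `Spec E` contains a basic open set around e₀. Thus openness in X
becomes the nonvanishing of a single element of E, which is how opens enter the irreducibility
argument. -/
lemma Pt.exists_of_ofSpec_mem (b : Spec (.of E) ⟶ X)
    (hb : b ≫ (X ↘ Spec (.of k)) = Spec.map (CommRingCat.ofHom (algebraMap k E)))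
    (e₀ : E →ₐ[k] k) {O : Set X} (hO : IsOpen O) (h : (Pt.ofSpec b hb e₀).point ∈ O) :
    ∃ f : E, e₀ f ≠ 0 ∧ ∀ e : E →ₐ[k] k, e f ≠ 0 → (Pt.ofSpec b hb e).point ∈ O := by
  let z (e : E →ₐ[k] k) : PrimeSpectrum E := ⟨RingHom.ker e, RingHom.ker_isPrime _⟩
  have hz : ∀ e : E →ₐ[k] k,
      Spec.map (CommRingCat.ofHom e.toRingHom) (IsLocalRing.closedPoint k) = z e := by
    intro e
    refine PrimeSpectrum.ext ?_
    change (IsLocalRing.maximalIdeal k).comap e.toRingHom = RingHom.ker e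
    rw [IsLocalRing.maximalIdeal_eq_bot]
    rfl
  have hz' : ∀ e : E →ₐ[k] k, (Pt.ofSpec b hb e).point = b (z e) := fun e =>
    congrArg b (hz e)
  rw [hz'] at h
  have hO' : IsOpen (b ⁻¹' O : Set (PrimeSpectrum E)) := hO.preimage b.continuous
  obtain ⟨_, ⟨f, rfl⟩, hf, hfO⟩ :=
    PrimeSpectrum.isTopologicalBasis_basic_opens.exists_subset_of_mem_open h hO'
  refine ⟨f, hf, fun e he => ?_⟩
  rw [hz']
  exact hfO (a := z e) he

/-- The `k`-point of an affine open given by a `k`-point of its coordinate ring. -/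
def Pt.ofAlgHom {U : X.Opens} (hU : IsAffineOpen U) (φ : Γ(X, U) →ₐ[k] k) : Pt k X :=
  Pt.ofSpec (E := Γ(X, U)) hU.fromSpec (fromSpec_over hU) φ

lemma Pt.ofAlgHom_eval (p : Pt k X) {U : X.Opens} (hU : IsAffineOpen U) (h : p.point ∈ U) :
    Pt.ofAlgHom hU (p.eval U h) = p :=
  Subtype.ext (p.SpecMap_eval_fromSpec hU h)

lemma Pt.ofAlgHom_mem {U : X.Opens} (hU : IsAffineOpen U) (φ : Γ(X, U) →ₐ[k] k) :
    (Pt.ofAlgHom hU φ).point ∈ U := by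
  rw [← SetLike.mem_coe, ← hU.range_fromSpec]
  exact ⟨_, rfl⟩

lemma Pt.eval_ofAlgHom {U : X.Opens} (hU : IsAffineOpen U) (φ : Γ(X, U) →ₐ[k] k) :
    (Pt.ofAlgHom hU φ).eval U (Pt.ofAlgHom_mem hU φ) = φ := by
  have h1 := (Pt.ofAlgHom hU φ).SpecMap_eval_fromSpec hU (Pt.ofAlgHom_mem hU φ)
  have h2 : Spec.map (CommRingCat.ofHom ((Pt.ofAlgHom hU φ).eval U
      (Pt.ofAlgHom_mem hU φ)).toRingHom) = Spec.map (CommRingCat.ofHom φ.toRingHom) :=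
    (cancel_mono hU.fromSpec).mp h1
  have h3 := Spec.map_injective h2
  ext a
  exact congrArg (fun g => g.hom a) h3

lemma Pt.prod_map_fst_snd (p : Pt k (prodOver k X Y)) :
    (p.map (pullback.fst _ _) rfl).prod (p.map (pullback.snd _ _) pullback.condition.symm) = p := by
  refine Subtype.ext (pullback.hom_ext ?_ ?_)
  · exact pullback.lift_fst _ _ _
  · exact pullback.lift_snd _ _ _

lemma Pt.prod_map_fst (p : Pt k X) (q : Pt k Y) :
    (p.prod q).map (pullback.fst _ _) rfl = p :=
  Subtype.ext (pullback.lift_fst _ _ _)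

lemma Pt.prod_map_snd (p : Pt k X) (q : Pt k Y) :
    (p.prod q).map (pullback.snd _ _) pullback.condition.symm = q :=
  Subtype.ext (pullback.lift_snd _ _ _)

end Points

section VectorFamilies

variable {k E V : Type u} [Field k] [CommRing E] [Algebra k E] [AddCommGroup V] [Module k V]

/-- The value of an `E`-valued vector at a `k`-point of `E`. -/
def evalT (e : E →ₐ[k] k) : E ⊗[k] V →ₗ[k] V :=
  (TensorProduct.lid k V).toLinearMap ∘ₗ e.toLinearMap.rTensor V

lemma evalT_tmul (e : E →ₐ[k] k) (a : E) (v : V) : evalT e (a ⊗ₜ[k] v) = e a • v := by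
  simp [evalT]

lemma apply_liftBaseChange (e : E →ₐ[k] k) (J : V →ₗ[k] E) (n : E ⊗[k] V) :
    e (J.liftBaseChange E n) = e (J (evalT e n)) := by
  induction n with
  | zero => simp
  | tmul a v => simp [evalT_tmul]
  | add x y hx hy => rw [map_add, map_add, map_add, map_add, map_add, hx, hy]

/-- The values of linear forms at an `E`-valued vector. -/
def dualPairing (n : E ⊗[k] V) : Module.Dual k V →ₗ[k] E where
  toFun ℓ := (Algebra.linearMap k E ∘ₗ ℓ).liftBaseChange E n
  map_add' ℓ ℓ' := by
    induction n with
    | zero => simp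
    | tmul a v => simp [mul_add]
    | add x y hx hy => rw [map_add, map_add, map_add, hx, hy]; abel
  map_smul' a ℓ := by
    induction n with
    | zero => simp
    | tmul b v => simp [Algebra.smul_def]; ring
    | add x y hx hy => rw [map_add, map_add, smul_add, hx, hy]

lemma apply_dualPairing (e : E →ₐ[k] k) (n : E ⊗[k] V) (ℓ : Module.Dual k V) :
    e (dualPairing n ℓ) = ℓ (evalT e n) := by
  refine (apply_liftBaseChange e (Algebra.linearMap k E ∘ₗ ℓ) n).trans ?_
  simp

/-- The morphism `Spec E ⟶ 𝔸(V)` given by an `E`-valued vector. -/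
def vecFamily (n : E ⊗[k] V) : Spec (.of E) ⟶ affSpace k V :=
  Spec.map (CommRingCat.ofHom (SymmetricAlgebra.lift (dualPairing n) :
    SymmetricAlgebra k (Module.Dual k V) →ₐ[k] E).toRingHom)

lemma vecFamily_over (n : E ⊗[k] V) : vecFamily n ≫ (affSpace k V ↘ Spec (.of k)) =
    Spec.map (CommRingCat.ofHom (algebraMap k E)) := by
  change Spec.map _ ≫ Spec.map _ = _
  rw [← Spec.map_comp, ← CommRingCat.ofHom_comp]
  congr 2
  ext x
  simp

lemma ofSpec_vecFamily (n : E ⊗[k] V) (e : E →ₐ[k] k) :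
    Pt.ofSpec (vecFamily n) (vecFamily_over n) e = vecPt (evalT e n) := by
  refine Subtype.ext ?_
  change Spec.map _ ≫ Spec.map _ = Spec.map _
  rw [← Spec.map_comp, ← CommRingCat.ofHom_comp]
  congr 2
  have : e.comp (SymmetricAlgebra.lift (dualPairing n)) =
      SymmetricAlgebra.lift (Module.Dual.eval k V (evalT e n)) := by
    refine SymmetricAlgebra.algHom_ext (LinearMap.ext fun ℓ => ?_)
    simp [apply_dualPairing]
  exact congrArg AlgHom.toRingHom this

lemma ofSpec_prod {X Y : Scheme.{u}} [X.Over (Spec (.of k))] [Y.Over (Spec (.of k))]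
    (b : Spec (.of E) ⟶ X)
    (hb : b ≫ (X ↘ Spec (.of k)) = Spec.map (CommRingCat.ofHom (algebraMap k E)))
    (b' : Spec (.of E) ⟶ Y)
    (hb' : b' ≫ (Y ↘ Spec (.of k)) = Spec.map (CommRingCat.ofHom (algebraMap k E))) :
    ∃ (β : Spec (.of E) ⟶ prodOver k X Y)
      (hβ : β ≫ (prodOver k X Y ↘ Spec (.of k)) = Spec.map (CommRingCat.ofHom (algebraMap k E))),
      ∀ e, Pt.ofSpec β hβ e = (Pt.ofSpec b hb e).prod (Pt.ofSpec b' hb' e) := by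
  refine ⟨pullback.lift b b' (hb.trans hb'.symm), ?_, fun e => Subtype.ext ?_⟩
  · change _ ≫ pullback.fst _ _ ≫ _ = _
    rw [pullback.lift_fst_assoc, hb]
  · refine pullback.hom_ext ?_ ?_
    · change (Spec.map _ ≫ _) ≫ _ = pullback.lift _ _ _ ≫ _
      rw [Category.assoc, pullback.lift_fst, pullback.lift_fst]
      rfl
    · change (Spec.map _ ≫ _) ≫ _ = pullback.lift _ _ _ ≫ _
      rw [Category.assoc, pullback.lift_snd, pullback.lift_snd]
      rfl

lemma exists_ofSpec_eq_ofAlgHom {X : Scheme.{u}} [X.Over (Spec (.of k))] {U : X.Opens}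
    (hU : IsAffineOpen U) (θ : Γ(X, U) →ₐ[k] E) :
    ∃ (b : Spec (.of E) ⟶ X)
      (hb : b ≫ (X ↘ Spec (.of k)) = Spec.map (CommRingCat.ofHom (algebraMap k E))),
      ∀ e, Pt.ofSpec b hb e = Pt.ofAlgHom hU (e.comp θ) := by
  refine ⟨Spec.map (CommRingCat.ofHom θ.toRingHom) ≫ hU.fromSpec, ?_, fun e => Subtype.ext ?_⟩
  · rw [Category.assoc, fromSpec_over]
    refine (Spec.map_comp _ _).symm.trans ?_
    rw [← CommRingCat.ofHom_comp]
    congr 2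
    ext x
    simp
  · change Spec.map _ ≫ Spec.map _ ≫ _ = Spec.map _ ≫ _
    rw [← Category.assoc]
    congr 1
    exact (Spec.map_comp _ _).symm

/-- An `E`-valued vector with prescribed values of functionals `J i : V → E`. -/
lemma exists_liftBaseChange_eq {ι : Type*} [Fintype ι] [DecidableEq ι] (J : ι → V →ₗ[k] E)
    (w : ι → V) (hdet : IsUnit (Matrix.of fun i j => J i (w j)).det) (m : E ⊗[k] V) (a : ι → E) :
    ∃ n : E ⊗[k] V, (∀ i, (J i).liftBaseChange E n = a i) ∧
      ∀ e : E →ₐ[k] k, (∀ i, e ((J i).liftBaseChange E m) = e (a i)) → evalT e n = evalT e m := by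
  set M : Matrix ι ι E := Matrix.of fun i j => J i (w j)
  -- Cramer's rule: the correction Σ y_j ⊗ w_j repairs the defect a − J(m). At a point e where m
  -- already has the prescribed values the defect vanishes, and with it the correction.
  set y : ι → E := M⁻¹.mulVec fun i => a i - (J i).liftBaseChange E m
  refine ⟨m + ∑ j, y j ⊗ₜ[k] w j, fun i => ?_, fun e he => ?_⟩
  · have h1 : (J i).liftBaseChange E (∑ j, y j ⊗ₜ[k] w j) = M.mulVec y i := by
      rw [map_sum, Matrix.mulVec, dotProduct]
      refine Finset.sum_congr rfl fun j _ => ?_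
      simp [M, mul_comm]
    have h2 : M.mulVec y = fun i => a i - (J i).liftBaseChange E m := by
      rw [Matrix.mulVec_mulVec, Matrix.mul_nonsing_inv _ hdet, Matrix.one_mulVec]
    rw [map_add, h1, h2]
    simp
  · have h1 : ∀ j, e (y j) = 0 := by
      intro j
      simp only [y, Matrix.mulVec, dotProduct, map_sum, map_mul, map_sub, he, sub_self, mul_zero,
        Finset.sum_const_zero]
    simp [evalT_tmul, h1]

end VectorFamilies

section Regular

variable {k V : Type u} [Field k] [AddCommGroup V] [Module k V]

/-- The function on `𝔸(V)` given by a linear form. -/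
def linFun (ℓ : Module.Dual k V) : Γ(affSpace k V, ⊤) :=
  (Scheme.ΓSpecIso (.of (SymmetricAlgebra k (Module.Dual k V)))).inv
    (SymmetricAlgebra.ι k (Module.Dual k V) ℓ)

lemma eval_linFun (v : V) (ℓ : Module.Dual k V) :
    (vecPt v).eval ⊤ trivial (linFun ℓ) = ℓ v := by
  let φ : SymmetricAlgebra k (Module.Dual k V) →ₐ[k] k :=
    SymmetricAlgebra.lift (Module.Dual.eval k V v)
  have h1 : (Scheme.ΓSpecIso (.of (SymmetricAlgebra k (Module.Dual k V)))).inv ≫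
      (Spec.map (CommRingCat.ofHom φ.toRingHom)).appTop ≫ (Scheme.ΓSpecIso (.of k)).hom =
      CommRingCat.ofHom φ.toRingHom := by
    rw [Scheme.ΓSpecIso_naturality, Iso.inv_hom_id_assoc]
  have h2 : (vecPt v).1.appLE ⊤ ⊤ ((vecPt v).mem_preimage trivial) =
      (Spec.map (CommRingCat.ofHom φ.toRingHom)).appTop := Scheme.Hom.appLE_eq_app _
  have h3 := congrArg (fun g => g.hom (SymmetricAlgebra.ι k (Module.Dual k V) ℓ)) h1
  have h4 : (vecPt v).eval ⊤ trivial (linFun ℓ) = φ (SymmetricAlgebra.ι k (Module.Dual k V) ℓ) := by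
    refine Eq.trans ?_ h3
    exact congrArg (fun g => (Scheme.ΓSpecIso (.of k)).hom (g.hom (linFun ℓ))) h2
  rw [h4]
  exact SymmetricAlgebra.lift_ι_apply _ _

/-- A linear map to the functions on `U ⊆ B` gives a function on the part over `U` of a scheme that
maps to `𝔸(V)` and to `B`. -/
lemma exists_section_eval_eq [FiniteDimensional k V] {X B : Scheme.{u}} [X.Over (Spec (.of k))]
    [B.Over (Spec (.of k))] (q : X ⟶ affSpace k V)
    (hq : q ≫ (affSpace k V ↘ Spec (.of k)) = X ↘ Spec (.of k)) (π : X ⟶ B)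
    (hπ : π ≫ (B ↘ Spec (.of k)) = X ↘ Spec (.of k)) {U : B.Opens} {W : X.Opens}
    (hW : W ≤ π ⁻¹ᵁ U) (J : V →ₗ[k] Γ(B, U)) :
    ∃ σ : Γ(X, W), ∀ (p : Pt k X) (v : V) (h : p.point ∈ W), p.map q hq = vecPt v →
      p.eval W h σ = (p.map π hπ).eval U (hW h) (J v) := by
  let b := Module.finBasis k V
  have hW' : W ≤ q ⁻¹ᵁ ⊤ := le_top
  -- The vector is expanded in a basis: its coordinates are functions pulled back from 𝔸(V), and the
  -- images of the basis vectors are functions pulled back from B.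
  refine ⟨∑ j, q.appLE ⊤ W hW' (linFun (b.coord j)) * π.appLE U W hW (J (b j)), ?_⟩
  intro p v h hpv
  rw [map_sum]
  have h1 : ∀ j, p.eval W h (q.appLE ⊤ W hW' (linFun (b.coord j))) = b.coord j v := by
    intro j
    rw [p.eval_appLE q hq]
    have : ∀ p' : Pt k (affSpace k V), p' = vecPt v →
        p'.eval ⊤ trivial (linFun (b.coord j)) = b.coord j v := by
      rintro _ rfl
      exact eval_linFun v _
    exact this _ hpv
  simp_rw [map_mul, h1, p.eval_appLE π hπ]
  have h2 := congrArg (fun x => (p.map π hπ).eval U (hW h) (J x)) (b.sum_repr v)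
  simp only [map_sum, map_smul, smul_eq_mul] at h2
  exact h2

/-- A point restricts to a linear form on the dual of V, which is evaluation at a vector because V
is finite-dimensional. -/
lemma exists_eq_vecPt [FiniteDimensional k V] (p : Pt k (affSpace k V)) : ∃ v : V, p = vecPt v := by
  obtain ⟨φ, hφ⟩ := Spec.map_surjective p.1
  have h1 := p.2
  rw [← hφ] at h1
  have h2 : CommRingCat.ofHom (algebraMap k (SymmetricAlgebra k (Module.Dual k V))) ≫ φ = 𝟙 _ := by
    refine Spec.map_injective ?_
    rw [Spec.map_comp, Spec.map_id]
    exact h1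
  let ψ : SymmetricAlgebra k (Module.Dual k V) →ₐ[k] k :=
    { __ := φ.hom
      commutes' := fun a => congrArg (fun g => g.hom a) h2 }
  obtain ⟨v, hv⟩ := (Module.evalEquiv k V).surjective (ψ.toLinearMap ∘ₗ SymmetricAlgebra.ι k _)
  refine ⟨v, Subtype.ext (hφ.symm.trans ?_)⟩
  change Spec.map φ = Spec.map _
  congr 1
  have h3 : ψ = SymmetricAlgebra.lift (Module.Dual.eval k V v) := by
    refine SymmetricAlgebra.algHom_ext (LinearMap.ext fun ℓ => ?_)
    have h4 := congrArg (fun g => g ℓ) hv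
    exact h4.symm.trans (SymmetricAlgebra.lift_ι_apply _ _).symm
  ext x
  exact congrArg (fun g => g x) h3

end Regular

end

/-! ### Codimension of loci cut out by `d` equations -/

section Krull

variable {X : Scheme.{u}} [IsLocallyNoetherian X]

/-- Krull's height theorem: a point at which `d` functions vanish is a specialization of a point of
codimension at most `d` at which they vanish. -/
lemma exists_coheight_le {W : X.Opens} {x : X} (hx : x ∈ W) {d : ℕ} (g : Fin d → Γ(X, W))
    (hg : ∀ i, x ∉ X.basicOpen (g i)) :
    ∃ ξ : X, ξ ⤳ x ∧ Order.coheight ξ ≤ d ∧ ∀ i, ξ ∉ X.basicOpen (g i) := by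
  obtain ⟨U, hU, hxU, hUW⟩ := exists_isAffineOpen_mem_and_subset (X := X) (x := x) (U := W) hx
  have : IsNoetherianRing Γ(X, U) := IsLocallyNoetherian.component_noetherian ⟨U, hU⟩
  let g' : Fin d → Γ(X, U) := fun i => X.presheaf.map (homOfLE hUW).op (g i)
  have hg' : ∀ i (z : Spec Γ(X, U)), g' i ∈ z.asIdeal ↔ hU.fromSpec z ∉ X.basicOpen (g i) := by
    intro i z
    have h1 : hU.fromSpec z ∈ U := by
      rw [← SetLike.mem_coe, ← hU.range_fromSpec]
      exact ⟨z, rfl⟩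
    have h2 : hU.fromSpec z ∈ X.basicOpen (g' i) ↔ hU.fromSpec z ∈ X.basicOpen (g i) := by
      have h0 : X.basicOpen (g' i) = U ⊓ X.basicOpen (g i) :=
        Scheme.basicOpen_res X (g i) (homOfLE hUW).op
      rw [h0]
      exact ⟨fun h => h.2, fun h => ⟨h1, h⟩⟩
    have h3 : hU.fromSpec ⁻¹ᵁ X.basicOpen (g' i) = PrimeSpectrum.basicOpen (g' i) :=
      hU.fromSpec_preimage_basicOpen (g' i)
    rw [← h2, iff_not_comm]
    exact (SetLike.ext_iff.mp h3 z)
  obtain ⟨p, rfl⟩ : x ∈ Set.range hU.fromSpec := by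
    rw [hU.range_fromSpec]
    exact hxU
  have : p.asIdeal.IsPrime := p.2
  obtain ⟨q, hq, hqp⟩ := Ideal.exists_minimalPrimes_le (I := Ideal.span (Set.range g'))
    (J := p.asIdeal) (Ideal.span_le.mpr (by
      rintro _ ⟨i, rfl⟩
      exact (hg' i p).mpr (hg i)))
  let z : Spec Γ(X, U) := ⟨q, hq.1.1⟩
  refine ⟨hU.fromSpec z, ?_, ?_, fun i => ?_⟩
  · have : z ⤳ p := (PrimeSpectrum.le_iff_specializes z p).mp
      ((PrimeSpectrum.asIdeal_le_asIdeal z p).mp hqp)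
    exact this.map hU.fromSpec.continuous
  · have h1 : q.height ≤ d := by
      classical
      have h2 : ((Finset.univ.image g' : Finset Γ(X, U)) : Set Γ(X, U)) = Set.range g' := by simp
      rw [← h2] at hq
      refine (Ideal.height_le_card_of_mem_minimalPrimes_span_finset hq).trans ?_
      exact_mod_cast Finset.card_image_le.trans (by simp)
    have h3 : q.height = Order.coheight z := idealHeight_eq_coheight _ z
    rw [coheight_eq_of_isOpenImmersion, ← h3]
    exact h1
  · exact (hg' i z).mp (hq.1.2 (Ideal.subset_span ⟨i, rfl⟩))

variable [JacobsonSpace X] {P : Type*} [TopologicalSpace P]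

/-- Transfers Krull's theorem from the scheme to its set of closed points. By the Jacobson property
these are dense in closure {ξ}, so the trace T of this closure is irreducible and has it as its
closure. Sending an irreducible closed set of points to the generic point of its closure in X is
strictly monotone, so the coheight of T is at most that of ξ. -/
lemma exists_irreducibleCloseds_coheight_le {f : P → X} (hf : Topology.IsInducing f) {G : Set X}
    (hG : IsOpen G) (hrange : Set.range f = closedPoints X ∩ G) {p₀ : P} {W : X.Opens}
    (hW : f p₀ ∈ W) {d : ℕ} (g : Fin d → Γ(X, W)) (hg : ∀ i, f p₀ ∉ X.basicOpen (g i))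
    {Z : Set P} (hZ : IsClosed Z)
    (hsub : ∀ p, f p ∈ W → (∀ i, f p ∉ X.basicOpen (g i)) → p ∈ Z) :
    ∃ T : IrreducibleCloseds P, (T : Set P) ⊆ Z ∧ Order.coheight T ≤ d := by
  obtain ⟨ξ, hξ, hξd, hξg⟩ := exists_coheight_le hW g hg
  have hp₀G : f p₀ ∈ G := (hrange ▸ Set.mem_range_self p₀ : f p₀ ∈ closedPoints X ∩ G).2
  have hmeet : ∀ O : Set X, IsOpen O → ξ ∈ O → ∃ p, f p ∈ closure {ξ} ∩ O := by
    intro O hO hξO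
    obtain ⟨x, hx, hxc⟩ := nonempty_inter_closedPoints (X := X) (Z := closure {ξ} ∩ (O ∩ G))
      ⟨ξ, subset_closure rfl, hξO, hξ.mem_open hG hp₀G⟩
      (isClosed_closure.isLocallyClosed.inter (hO.inter hG).isLocallyClosed)
    have : x ∈ Set.range f := hrange ▸ ⟨hxc, hx.2.2⟩
    obtain ⟨p, rfl⟩ := this
    exact ⟨p, hx.1, hx.2.1⟩
  let T : IrreducibleCloseds P :=
    { carrier := f ⁻¹' closure {ξ}
      isIrreducible' := by
        refine ⟨⟨p₀, specializes_iff_mem_closure.mp hξ⟩, ?_⟩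
        intro u v hu hv hu' hv'
        obtain ⟨u, hu₁, rfl⟩ := hf.isOpen_iff.mp hu
        obtain ⟨v, hv₁, rfl⟩ := hf.isOpen_iff.mp hv
        obtain ⟨p, hp, hpu⟩ := hu'
        obtain ⟨q, hq, hqv⟩ := hv'
        obtain ⟨r, hr, hruv⟩ := hmeet (u ∩ v) (hu₁.inter hv₁)
          ⟨(specializes_iff_mem_closure.mpr hp).mem_open hu₁ hpu,
            (specializes_iff_mem_closure.mpr hq).mem_open hv₁ hqv⟩
        exact ⟨r, hr, hruv⟩
      isClosed' := isClosed_closure.preimage hf.continuous }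
  -- The equations are only available on W, but T is irreducible, so its part over W is dense in it,
  -- and Z is closed.
  have hTZ : (T : Set P) ⊆ Z := by
    intro p hp
    by_contra hpZ
    obtain ⟨q, hqT, hqZ, hqW⟩ := T.isIrreducible'.2 Zᶜ (f ⁻¹' W) hZ.isOpen_compl
      (W.isOpen.preimage hf.continuous) ⟨p, hp, hpZ⟩ ⟨p₀, specializes_iff_mem_closure.mp hξ, hW⟩
    refine hqZ (hsub q hqW fun i hi => hξg i ?_)
    exact (specializes_iff_mem_closure.mpr hqT).mem_open (X.basicOpen (g i)).isOpen hi
  refine ⟨T, hTZ, ?_⟩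
  have hirr : ∀ S : IrreducibleCloseds P, IsIrreducible (closure (f '' S)) := fun S =>
    (S.isIrreducible'.image f hf.continuous.continuousOn).closure
  let Φ : IrreducibleCloseds P → X := fun S => (hirr S).genericPoint
  have hΦ : ∀ S, closure {Φ S} = closure (f '' S) := fun S =>
    (hirr S).isGenericPoint_genericPoint_closure.def.trans isClosed_closure.closure_eq
  have hpre : ∀ S : IrreducibleCloseds P, f ⁻¹' closure (f '' S) = S := by
    intro S
    rw [← hf.closure_eq_preimage_closure_image]
    exact S.isClosed'.closure_eq
  have hmono : StrictMono Φ := by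
    intro S S' hSS'
    have hle : ∀ {S S' : IrreducibleCloseds P}, Φ S ≤ Φ S' ↔ (S : Set P) ⊆ S' := by
      intro S S'
      have h0 : Φ S ≤ Φ S' ↔ Φ S' ⤳ Φ S := Iff.rfl
      rw [h0, specializes_iff_closure_subset, hΦ, hΦ]
      refine ⟨fun h => ?_, fun h => closure_mono (Set.image_mono h)⟩
      rw [← hpre S, ← hpre S']
      exact Set.preimage_mono h
    rw [lt_iff_le_not_ge, hle, hle]
    exact ⟨hSS'.1, hSS'.2⟩
  have hΦT : Φ T = ξ := by
    have h1 : closure (f '' (T : Set P)) = closure {ξ} := by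
      refine subset_antisymm ?_ ?_
      · exact isClosed_closure.closure_subset_iff.mpr (Set.image_subset_iff.mpr subset_rfl)
      · refine isClosed_closure.closure_subset_iff.mpr (Set.singleton_subset_iff.mpr ?_)
        rw [mem_closure_iff]
        intro O hO hξO
        obtain ⟨p, hp, hpO⟩ := hmeet O hO hξO
        exact ⟨f p, hpO, p, hp, rfl⟩
    have h2 := (hΦ T).trans h1
    exact ((specializes_iff_closure_subset.mpr h2.ge).antisymm
      (specializes_iff_closure_subset.mpr h2.le)).eq
  refine (Order.coheight_le_coheight_apply_of_strictMono Φ hmono T).trans ?_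
  rw [hΦT]
  exact hξd

lemma codim_le {f : P → X} (hf : Topology.IsInducing f) {G : Set X}
    (hG : IsOpen G) (hrange : Set.range f = closedPoints X ∩ G) {p₀ : P} {W : X.Opens}
    (hW : f p₀ ∈ W) {d : ℕ} (g : Fin d → Γ(X, W)) (hg : ∀ i, f p₀ ∉ X.basicOpen (g i))
    {Z : Set P} (hZ : IsClosed Z)
    (hsub : ∀ p, f p ∈ W → (∀ i, f p ∉ X.basicOpen (g i)) → p ∈ Z) : codim Z ≤ d := by
  obtain ⟨T, hT, hTd⟩ := exists_irreducibleCloseds_coheight_le hf hG hrange hW g hg hZ hsub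
  exact (iInf₂_le T hT).trans hTd

end Krull

/-! ### Lower bounds for coheights from chains of irreducible closed sets -/

section Chains

variable {P : Type*} [TopologicalSpace P]

/-- A lower bound for the codimension of a closed subset of an irreducible closed set. -/
lemma le_coheight_of_subset {T A : IrreducibleCloseds P} (h : (T : Set P) ⊆ A) {n : ℕ}
    (hA : (n : ℕ∞) ≤ Order.coheight A) : (n : ℕ∞) ≤ Order.coheight T :=
  hA.trans (Order.coheight_anti h)

lemma add_one_le_coheight {A B : IrreducibleCloseds P} (h : (A : Set P) ⊂ B) {n : ℕ}
    (hB : (n : ℕ∞) ≤ Order.coheight B) : ((n + 1 : ℕ) : ℕ∞) ≤ Order.coheight A := by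
  push_cast
  exact (add_le_add_left hB 1).trans (Order.coheight_add_one_le h)

/-- The closure of an irreducible set. -/
def closureIrr {S : Set P} (hS : IsIrreducible S) : IrreducibleCloseds P :=
  ⟨closure S, hS.closure, isClosed_closure⟩

end Chains

/-! ### Taylor coefficients as regular functions on families, and closedness of the loci -/

section

open Polynomial

lemma map_coeff_disc {k R : Type*} [Field k] [CommRing R] [Algebra k R] (φ : R →ₐ[k] k)
    (σ₄ σ₆ : ℕ → R) (d l : ℕ) :
    φ ((4 * (∑ l ∈ Finset.range d, Polynomial.C (σ₄ l) * X ^ l) ^ 3 -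
      27 * (∑ l ∈ Finset.range d, Polynomial.C (σ₆ l) * X ^ l) ^ 2).coeff l) =
    (4 * (∑ l ∈ Finset.range d, Polynomial.C (φ (σ₄ l)) * X ^ l) ^ 3 -
      27 * (∑ l ∈ Finset.range d, Polynomial.C (φ (σ₆ l)) * X ^ l) ^ 2).coeff l := by
  refine (Polynomial.coeff_map φ.toRingHom l).symm.trans ?_
  simp only [Polynomial.map_sub, Polynomial.map_mul, Polynomial.map_pow, Polynomial.map_sum,
    Polynomial.map_ofNat, Polynomial.map_C, Polynomial.map_X]
  rfl

namespace LineBundle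

/-- A scheme with morphisms to `𝔸(V₄ ⊕ V₆)` and to `C`, and a set of its `k`-points. -/
structure Family (k : Type u) [Field k] {C : Scheme.{u}} [C.Over (Spec (.of k))] (L : LineBundle C)
    (P : Type u) [TopologicalSpace P] where
  /-- the scheme -/
  X : Scheme.{u}
  overInst : X.Over (Spec (.of k))
  /-- the morphism to `𝔸(V₄ ⊕ V₆)` -/
  q : X ⟶ affSpace k (L.V k 4 × L.V k 6)
  hq : q ≫ (affSpace k (L.V k 4 × L.V k 6) ↘ Spec (.of k)) = X ↘ Spec (.of k)
  /-- the morphism to `C` -/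
  π : X ⟶ C
  hπ : π ≫ (C ↘ Spec (.of k)) = X ↘ Spec (.of k)
  /-- the points -/
  pt : P → Pt k X
  cont : Continuous fun p => (pt p).point
  /-- the section of `L⁴` -/
  a₄ : P → L.V k 4
  /-- the section of `L⁶` -/
  a₆ : P → L.V k 6
  /-- the point of the curve -/
  c : P → Pt k C
  hqpt : ∀ p, (pt p).map q hq = vecPt (a₄ p, a₆ p)
  hπpt : ∀ p, (pt p).map π hπ = c p

namespace Family

variable {k : Type u} [Field k] {C : Scheme.{u}} [C.Over (Spec (.of k))] {L : LineBundle C}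
    {P : Type u} [TopologicalSpace P] (F : Family k L P)

instance : F.X.Over (Spec (.of k)) := F.overInst

lemma mem_preimage {U : C.Opens} {p : P} (h : (F.c p).point ∈ U) :
    (F.pt p).point ∈ F.π ⁻¹ᵁ U := by
  rw [← F.hπpt] at h
  exact h

lemma mem_of_mem_preimage {U : C.Opens} {p : P} (h : (F.pt p).point ∈ F.π ⁻¹ᵁ U) :
    (F.c p).point ∈ U := by
  rw [← F.hπpt]
  exact h

lemma exists_linear [FiniteDimensional k (L.V k 4)] [FiniteDimensional k (L.V k 6)] {U : C.Opens}
    (J : L.V k 4 × L.V k 6 →ₗ[k] Γ(C, U)) : ∃ σ : Γ(F.X, F.π ⁻¹ᵁ U),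
      ∀ (p : P) (h : (F.c p).point ∈ U), (F.pt p).eval (F.π ⁻¹ᵁ U) (F.mem_preimage h) σ =
        (F.c p).eval U h (J (F.a₄ p, F.a₆ p)) := by
  obtain ⟨σ, hσ⟩ := exists_section_eval_eq F.q F.hq F.π F.hπ (U := U) le_rfl J
  refine ⟨σ, fun p h => ?_⟩
  rw [hσ (F.pt p) _ (F.mem_preimage h) (F.hqpt p)]
  have : ∀ (c : Pt k C) (hc : c.point ∈ U), c = F.c p →
      c.eval U hc (J (F.a₄ p, F.a₆ p)) = (F.c p).eval U h (J (F.a₄ p, F.a₆ p)) := by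
    rintro c hc rfl
    rfl
  exact this _ _ (F.hπpt p)

lemma mem_basicOpen_iff {U : C.Opens} (σ : Γ(F.X, F.π ⁻¹ᵁ U)) {p : P}
    (h : (F.c p).point ∈ U) : (F.pt p).point ∈ F.X.basicOpen σ ↔
      (F.pt p).eval (F.π ⁻¹ᵁ U) (F.mem_preimage h) σ ≠ 0 :=
  ((F.pt p).eval_ne_zero_iff _ _).symm

/-- A set is closed if near each point outside it there is a function that vanishes on the set and
not at the point. -/
lemma isClosed_of_forall {Z : Set P} (hZ : ∀ p ∉ Z, ∃ (U : C.Opens) (_ : (F.c p).point ∈ U)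
    (σ : Γ(F.X, F.π ⁻¹ᵁ U)), (F.pt p).point ∈ F.X.basicOpen σ ∧
      ∀ p' ∈ Z, (F.c p').point ∈ U → (F.pt p').point ∉ F.X.basicOpen σ) : IsClosed Z := by
  refine isOpen_compl_iff.mp (isOpen_iff_forall_mem_open.mpr fun p hp => ?_)
  obtain ⟨U, hU, σ, hσ, hσZ⟩ := hZ p hp
  refine ⟨(fun p => (F.pt p).point) ⁻¹' F.X.basicOpen σ, fun p' hp' hp'Z => ?_,
    (F.X.basicOpen σ).isOpen.preimage F.cont, hσ⟩
  exact hσZ p' hp'Z (F.mem_of_mem_preimage (F.X.basicOpen_le σ hp')) hp'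

variable [FiniteDimensional k (L.V k 4)] [FiniteDimensional k (L.V k 6)]

lemma exists_jet_section_four {d : ℕ} (ch : L.Chart k d) (l : ℕ) :
    ∃ σ : Γ(F.X, F.π ⁻¹ᵁ ch.U), ∀ (p : P) (h : (F.c p).point ∈ ch.U),
      (F.pt p).eval (F.π ⁻¹ᵁ ch.U) (F.mem_preimage h) σ =
        (F.c p).eval ch.U h (ch.jet 4 l (F.a₄ p)) :=
  F.exists_linear (ch.jet 4 l ∘ₗ LinearMap.fst k _ _)

lemma exists_jet_section_six {d : ℕ} (ch : L.Chart k d) (l : ℕ) :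
    ∃ σ : Γ(F.X, F.π ⁻¹ᵁ ch.U), ∀ (p : P) (h : (F.c p).point ∈ ch.U),
      (F.pt p).eval (F.π ⁻¹ᵁ ch.U) (F.mem_preimage h) σ =
        (F.c p).eval ch.U h (ch.jet 6 l (F.a₆ p)) :=
  F.exists_linear (ch.jet 6 l ∘ₗ LinearMap.snd k _ _)

lemma exists_disc_section {d : ℕ} (ch : L.Chart k d) (l : ℕ) :
    ∃ σ : Γ(F.X, F.π ⁻¹ᵁ ch.U), ∀ (p : P) (h : (F.c p).point ∈ ch.U),
      (F.pt p).eval (F.π ⁻¹ᵁ ch.U) (F.mem_preimage h) σ =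
        (4 * ch.poly (F.c p) h (F.a₄ p) ^ 3 - 27 * ch.poly (F.c p) h (F.a₆ p) ^ 2).coeff l := by
  choose σ₄ h₄ using F.exists_jet_section_four ch
  choose σ₆ h₆ using F.exists_jet_section_six ch
  refine ⟨(4 * (∑ l ∈ Finset.range d, Polynomial.C (σ₄ l) * Polynomial.X ^ l) ^ 3 -
    27 * (∑ l ∈ Finset.range d, Polynomial.C (σ₆ l) * Polynomial.X ^ l) ^ 2).coeff l, fun p h => ?_⟩
  refine (map_coeff_disc ((F.pt p).eval (F.π ⁻¹ᵁ ch.U) (F.mem_preimage h)) σ₄ σ₆ d l).trans ?_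
  simp only [h₄ _ p h, h₆ _ p h]
  rfl

variable [AlgebraicGeometry.IsIntegral C] [SmoothOfRelativeDimension 1 (C ↘ Spec (.of k))]

/-- Over a coordinate chart the condition is the vanishing of the first n Taylor coefficients of Δ,
which are regular functions on the family. -/
lemma isClosed_le_val_disc (n : ℕ) :
    IsClosed {p | (n : ℕ∞) ≤ (L.pow 12).val (L.disc (F.a₄ p) (F.a₆ p)) (F.c p).point} := by
  refine F.isClosed_of_forall fun p hp => ?_
  obtain ⟨ch, hch⟩ := exists_chart k L (F.c p).point n
  rw [Set.mem_ofPred_eq, ch.le_val_disc_iff _ hch le_rfl] at hp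
  push Not at hp
  obtain ⟨l, hl, hne⟩ := hp
  obtain ⟨σ, hσ⟩ := F.exists_disc_section ch l
  refine ⟨ch.U, hch, σ, ?_, fun p' hp' hU => ?_⟩
  · rw [F.mem_basicOpen_iff σ hch, hσ]
    exact hne
  · rw [F.mem_basicOpen_iff σ hU, hσ, not_not]
    exact (ch.le_val_disc_iff _ hU le_rfl _ _).mp hp' l hl

lemma isClosed_one_le_val_six :
    IsClosed {p | 1 ≤ (L.pow 6).val (F.a₆ p) (F.c p).point} := by
  refine F.isClosed_of_forall fun p hp => ?_
  obtain ⟨ch, hch⟩ := exists_chart k L (F.c p).point 1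
  have key := fun (p' : P) (h : (F.c p').point ∈ ch.U) =>
    ch.le_val_iff (F.c p') h le_rfl (F.a₆ p')
  rw [Set.mem_ofPred_eq, ← Nat.cast_one, key p hch] at hp
  obtain ⟨σ, hσ⟩ := F.exists_jet_section_six ch 0
  refine ⟨ch.U, hch, σ, ?_, fun p' hp' hU => ?_⟩
  · rw [F.mem_basicOpen_iff σ hch, hσ]
    intro h0
    refine hp fun l hl => ?_
    rw [Nat.lt_one_iff.mp hl]
    exact h0
  · rw [F.mem_basicOpen_iff σ hU, hσ _ hU, not_not]
    exact (key p' hU).mp (by rw [Nat.cast_one]; exact hp') 0 one_pos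

end Family

/-! ### Types of points -/

/-- The types of behaviour of a pair of sections at a point. -/
inductive FibreType
  | any
  | singular
  | node
  | cusp

namespace FibreType

variable {k : Type u} [Field k] {C : Scheme.{u}} [C.Over (Spec (.of k))] {L : LineBundle C}

/-- The condition that a pair of sections be of a given type at a point. -/
def Holds (a₄ : L.V k 4) (a₆ : L.V k 6) (c : Pt k C) : FibreType → Prop
  | any => True
  | singular => 1 ≤ (L.pow 12).val (L.disc a₄ a₆) c.point
  | node => 2 ≤ (L.pow 12).val (L.disc a₄ a₆) c.point ∧ (L.pow 6).val a₆ c.point = 0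
  | cusp => 2 ≤ (L.pow 12).val (L.disc a₄ a₆) c.point ∧ 1 ≤ (L.pow 6).val a₆ c.point

section

variable {E : Type*} [CommRing E]

/-- The value of `a₄` in a parametrization of the jets of a given type. -/
def A (x : E) : FibreType → E
  | any => x
  | singular => 3 * x ^ 2
  | node => 3 * x ^ 2
  | cusp => 0

/-- The value of `a₆`. -/
def B (x y : E) : FibreType → E
  | any => y
  | singular => 2 * x ^ 3
  | node => 2 * x ^ 3
  | cusp => 0

/-- The coefficient of the derivative of `a₄` in the derivative of `a₆`. -/
def M (x : E) : FibreType → E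
  | any => 0
  | singular => 0
  | node => x
  | cusp => 0

/-- The constant term of the derivative of `a₆`. -/
def b (z : E) : FibreType → E
  | any => z
  | singular => z
  | node => 0
  | cusp => z

variable {E' : Type*} [CommRing E'] (e : E →+* E') (x y z : E) (τ : FibreType)

lemma map_A : e (τ.A x) = τ.A (e x) := by cases τ <;> simp [A, map_ofNat]
lemma map_B : e (τ.B x y) = τ.B (e x) (e y) := by cases τ <;> simp [B, map_ofNat]
lemma map_M : e (τ.M x) = τ.M (e x) := by cases τ <;> simp [M]
lemma map_b : e (τ.b z) = τ.b (e z) := by cases τ <;> simp [b]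

end

/-- The open condition in the parametrization. -/
def Adm (x : k) : FibreType → Prop
  | any => True
  | singular => True
  | node => x ≠ 0
  | cusp => True

end FibreType

section Coefficients

variable {R : Type*} [CommRing R] (p q : R[X])

lemma coeff_zero_disc : (4 * p ^ 3 - 27 * q ^ 2).coeff 0 = 4 * p.coeff 0 ^ 3 - 27 * q.coeff 0 ^ 2 := by
  simp [coeff_zero_eq_eval_zero]

lemma coeff_one_disc : (4 * p ^ 3 - 27 * q ^ 2).coeff 1 =
    12 * p.coeff 0 ^ 2 * p.coeff 1 - 54 * q.coeff 0 * q.coeff 1 := by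
  have h1 : Finset.HasAntidiagonal.antidiagonal (1 : ℕ) = {(0, 1), (1, 0)} := rfl
  simp [coeff_sub, coeff_ofNat_mul, pow_succ, coeff_mul, h1]
  ring

lemma coeff_two_disc : (4 * p ^ 3 - 27 * q ^ 2).coeff 2 =
    12 * p.coeff 0 ^ 2 * p.coeff 2 + 12 * p.coeff 0 * p.coeff 1 ^ 2 -
      54 * q.coeff 0 * q.coeff 2 - 27 * q.coeff 1 ^ 2 := by
  have h1 : Finset.HasAntidiagonal.antidiagonal (1 : ℕ) = {(0, 1), (1, 0)} := rfl
  have h2 : Finset.HasAntidiagonal.antidiagonal (2 : ℕ) = {(0, 2), (1, 1), (2, 0)} := rfl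
  simp [coeff_sub, coeff_ofNat_mul, pow_succ, coeff_mul, h1, h2]
  ring

end Coefficients

section HoldsIff

variable {k : Type u} [Field k] {C : Scheme.{u}} [C.Over (Spec (.of k))] {L : LineBundle C}
  [AlgebraicGeometry.IsIntegral C] [SmoothOfRelativeDimension 1 (C ↘ Spec (.of k))]

variable {d : ℕ} (ch : L.Chart k d) (c : Pt k C) (h : c.point ∈ ch.U) (a₄ : L.V k 4) (a₆ : L.V k 6)

lemma Chart.one_le_val_disc_iff (hd : 2 ≤ d) :
    1 ≤ (L.pow 12).val (L.disc a₄ a₆) c.point ↔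
      4 * c.eval ch.U h (ch.jet 4 0 a₄) ^ 3 = 27 * c.eval ch.U h (ch.jet 6 0 a₆) ^ 2 := by
  rw [← Nat.cast_one, ch.le_val_disc_iff c h (by omega)]
  simp only [Nat.lt_one_iff, forall_eq, coeff_zero_disc, sub_eq_zero]
  rw [ch.coeff_poly c h _ (by omega), ch.coeff_poly c h _ (by omega)]

lemma Chart.two_le_val_disc_iff (hd : 2 ≤ d) :
    2 ≤ (L.pow 12).val (L.disc a₄ a₆) c.point ↔
      4 * c.eval ch.U h (ch.jet 4 0 a₄) ^ 3 = 27 * c.eval ch.U h (ch.jet 6 0 a₆) ^ 2 ∧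
      12 * c.eval ch.U h (ch.jet 4 0 a₄) ^ 2 * c.eval ch.U h (ch.jet 4 1 a₄) =
        54 * c.eval ch.U h (ch.jet 6 0 a₆) * c.eval ch.U h (ch.jet 6 1 a₆) := by
  have h2 : ((2 : ℕ) : ℕ∞) = 2 := rfl
  rw [← h2, ch.le_val_disc_iff c h hd]
  have h01 : ∀ Q : ℕ → Prop, (∀ l < 2, Q l) ↔ Q 0 ∧ Q 1 := fun Q =>
    ⟨fun h => ⟨h 0 two_pos, h 1 one_lt_two⟩, fun h l hl => by interval_cases l; exacts [h.1, h.2]⟩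
  rw [h01, coeff_zero_disc, coeff_one_disc, sub_eq_zero, sub_eq_zero]
  rw [ch.coeff_poly c h _ (by omega), ch.coeff_poly c h _ (by omega),
    ch.coeff_poly c h _ (by omega), ch.coeff_poly c h _ (by omega)]

lemma Chart.one_le_val_six_iff (hd : 2 ≤ d) :
    1 ≤ (L.pow 6).val a₆ c.point ↔ c.eval ch.U h (ch.jet 6 0 a₆) = 0 := by
  rw [← Nat.cast_one, ch.le_val_iff c h (by omega)]
  simp

/-- Parametrization of the jets of a given type. -/
lemma Chart.holds_iff (hk2 : (2 : k) ≠ 0) (hk3 : (3 : k) ≠ 0) (hd : 2 ≤ d) (τ : FibreType) :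
    τ.Holds a₄ a₆ c ↔ ∃ x y z : k, τ.Adm x ∧ c.eval ch.U h (ch.jet 4 0 a₄) = τ.A x ∧
      c.eval ch.U h (ch.jet 6 0 a₆) = τ.B x y ∧
      c.eval ch.U h (ch.jet 6 1 a₆) = τ.b z + τ.M x * c.eval ch.U h (ch.jet 4 1 a₄) := by
  have h1 := ch.one_le_val_disc_iff c h a₄ a₆ hd
  have h2 := ch.two_le_val_disc_iff c h a₄ a₆ hd
  have h3 := ch.one_le_val_six_iff c h a₆ hd
  have h4 : (L.pow 6).val a₆ c.point = 0 ↔ ¬ 1 ≤ (L.pow 6).val a₆ c.point := by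
    rw [Order.one_le_iff_pos, pos_iff_ne_zero, not_not]
  rw [h3] at h4
  generalize c.eval ch.U h (ch.jet 4 0 a₄) = α at *
  generalize c.eval ch.U h (ch.jet 4 1 a₄) = α' at *
  generalize c.eval ch.U h (ch.jet 6 0 a₆) = β at *
  generalize c.eval ch.U h (ch.jet 6 1 a₆) = β' at *
  -- The rational parametrization of the cuspidal cubic, with parameter x = 3β/(2α) away from the
  -- cusp.
  have par : 4 * α ^ 3 = 27 * β ^ 2 → ∃ x, α = 3 * x ^ 2 ∧ β = 2 * x ^ 3 := by
    intro h
    have h27 : (27 : k) ≠ 0 := by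
      have : (27 : k) = 3 ^ 3 := by norm_num
      rw [this]
      exact pow_ne_zero _ hk3
    have h4 : (4 : k) ≠ 0 := by
      have : (4 : k) = 2 ^ 2 := by norm_num
      rw [this]
      exact pow_ne_zero _ hk2
    by_cases hα : α = 0
    · subst hα
      refine ⟨0, by simp, ?_⟩
      have : 27 * β ^ 2 = 0 := by rw [← h]; ring
      have := (mul_eq_zero.mp this).resolve_left h27
      rw [pow_eq_zero_iff two_ne_zero] at this
      rw [this]
      simp
    · refine ⟨3 * β / (2 * α), ?_, ?_⟩
      · field_simp
        linear_combination h
      · field_simp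
        refine mul_left_cancel₀ h4 ?_
        linear_combination 4 * β * h
  cases τ
  · simp only [FibreType.Holds, FibreType.Adm, FibreType.A, FibreType.B, FibreType.b, FibreType.M,
      true_iff]
    exact ⟨α, β, β', trivial, rfl, rfl, by simp⟩
  · simp only [FibreType.Holds, FibreType.Adm, FibreType.A, FibreType.B, FibreType.b, FibreType.M,
      h1, true_and, zero_mul, add_zero]
    constructor
    · intro h
      obtain ⟨x, hx, hx'⟩ := par h
      exact ⟨x, 0, β', hx, hx', rfl⟩
    · rintro ⟨x, -, -, rfl, rfl, -⟩
      ring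
  · simp only [FibreType.Holds, FibreType.Adm, FibreType.A, FibreType.B, FibreType.b, FibreType.M,
      h2, h4, zero_add]
    have h108 : (108 : k) ≠ 0 := by
      have : (108 : k) = 2 ^ 2 * 3 ^ 3 := by norm_num
      rw [this]
      exact mul_ne_zero (pow_ne_zero _ hk2) (pow_ne_zero _ hk3)
    constructor
    · rintro ⟨⟨h, h'⟩, hβ⟩
      obtain ⟨x, rfl, rfl⟩ := par h
      have hx : x ≠ 0 := by
        rintro rfl
        simp at hβ
      refine ⟨x, 0, 0, hx, rfl, rfl, ?_⟩
      -- The second equation 12α²α' = 54ββ' at α = 3x², β = 2x³; here x ≠ 0 and 108 = 2²·3³ is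
      -- invertible.
      have h5 : 108 * x ^ 3 * (β' - x * α') = 0 := by linear_combination -h'
      have h6 := (mul_eq_zero.mp h5).resolve_left (mul_ne_zero h108 (pow_ne_zero _ hx))
      linear_combination h6
    · rintro ⟨x, -, -, hx, rfl, rfl, rfl⟩
      exact ⟨⟨by ring, by ring⟩, mul_ne_zero hk2 (pow_ne_zero _ hx)⟩
  · simp only [FibreType.Holds, FibreType.Adm, FibreType.A, FibreType.B, FibreType.b, FibreType.M,
      h2, h3, true_and, zero_mul, add_zero]
    constructor
    · rintro ⟨⟨h, -⟩, rfl⟩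
      obtain ⟨x, rfl, hx⟩ := par h
      have hx : x = 0 := by
        have := (mul_eq_zero.mp hx.symm).resolve_left hk2
        exact (pow_eq_zero_iff three_ne_zero).mp this
      subst hx
      exact ⟨0, 0, β', by simp, rfl, rfl⟩
    · rintro ⟨-, -, z, rfl, rfl, rfl⟩
      simp

end HoldsIff

end LineBundle

end

/-! ### Abundance of points, and families of sections with given types at two points -/

section

open TensorProduct

section InfinitelyManyPoints

variable {k : Type u} [Field k] {C : Scheme.{u}} [C.Over (Spec (.of k))]
    [AlgebraicGeometry.IsIntegral C] [SmoothOfRelativeDimension 1 (C ↘ Spec (.of k))]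

lemma Pt.point_ne_genericPoint (c : Pt k C) : c.point ≠ genericPoint C := by
  intro h
  have h1 : IsDiscreteValuationRing (C.presheaf.stalk c.point) := c.isDiscreteValuationRing_stalk
  have h2 : ∀ x : C, x = genericPoint C → IsField (C.presheaf.stalk x) := by
    rintro _ rfl
    exact Field.toIsField C.functionField
  exact IsDiscreteValuationRing.not_isField _ (h2 _ h)

/-- Removing finitely many closed points from a nonempty open set leaves an open set that still
contains the generic point, hence also a closed point. -/
lemma exists_pt_mem_of_finite [IsAlgClosed k] {O : Set C} (hO : IsOpen O) (hne : O.Nonempty)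
    {F : Set (Pt k C)} (hF : F.Finite) : ∃ c : Pt k C, c.point ∈ O ∧ c ∉ F := by
  have := locallyOfFiniteType_of_smooth k (C := C)
  have := LocallyOfFiniteType.jacobsonSpace (C ↘ Spec (.of k))
  have hcl : IsClosed (Pt.point '' F) := by
    rw [← Set.biUnion_of_singleton (Pt.point '' F), Set.biUnion_image]
    exact hF.isClosed_biUnion fun c _ => c.isClosed_point
  obtain ⟨x, hx, hxc⟩ := nonempty_inter_closedPoints (X := C) (Z := O ∩ (Pt.point '' F)ᶜ)
    ⟨genericPoint C, ((genericPoint_spec C).mem_open_set_iff hO).mpr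
      (hne.mono fun x hx => ⟨trivial, hx⟩), by
        rintro ⟨c, -, hc⟩
        exact c.point_ne_genericPoint hc⟩
    (hO.inter hcl.isOpen_compl).isLocallyClosed
  refine ⟨ptOf k ⟨x, hxc⟩, ?_, fun h => hx.2 ⟨_, h, ptOf_point k ⟨x, hxc⟩⟩⟩
  rw [ptOf_point]
  exact hx.1

variable (k) in
lemma exists_pt_ne [IsAlgClosed k] : ∃ c c' : Pt k C, c ≠ c' := by
  obtain ⟨c, -, -⟩ := exists_pt_mem_of_finite (k := k) (C := C) isOpen_univ Set.univ_nonempty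
    Set.finite_empty
  obtain ⟨c', -, hc'⟩ := exists_pt_mem_of_finite (k := k) (C := C) isOpen_univ Set.univ_nonempty
    (Set.finite_singleton c)
  exact ⟨c, c', fun h => hc' h.symm⟩

end InfinitelyManyPoints

lemma evalT_lTensor {k E V W : Type u} [Field k] [CommRing E] [Algebra k E] [AddCommGroup V]
    [Module k V] [AddCommGroup W] [Module k W] (e : E →ₐ[k] k) (J : V →ₗ[k] W) (n : E ⊗[k] V) :
    evalT e (J.lTensor E n) = J (evalT e n) := by
  induction n with
  | zero => simp
  | tmul a v => simp [evalT_tmul]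
  | add x y hx hy => simp only [map_add, hx, hy]

namespace LineBundle

section Fits

variable {k : Type u} [Field k] {C : Scheme.{u}} [C.Over (Spec (.of k))] {L : LineBundle C}
  {d d' : ℕ} (ch : L.Chart k d) (ch' : L.Chart k d')

/-- The jets of `a₄` and `a₆` are those of type `τ` with parameters `x`, `y`, `z`. -/
def Chart.Fits (φ : Γ(C, ch.U) →ₐ[k] k) (τ : FibreType) (x y z : k) (a₄ : L.V k 4)
    (a₆ : L.V k 6) : Prop :=
  φ (ch.jet 4 0 a₄) = τ.A x ∧ φ (ch.jet 6 0 a₆) = τ.B x y ∧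
    φ (ch.jet 6 1 a₆) = τ.b z + τ.M x * φ (ch.jet 4 1 a₄)

variable {E : Type u} [CommRing E] [Algebra k E] (θ : Γ(C, ch.U) →ₐ[k] E)
  (θ' : Γ(C, ch'.U) →ₐ[k] E)

/-- The values of a section of `L⁴` at two points. -/
def jets₄ : Fin 2 → (L.V k 4 →ₗ[k] E) :=
  ![θ.toLinearMap ∘ₗ ch.jet 4 0, θ'.toLinearMap ∘ₗ ch'.jet 4 0]

/-- The values and the derivatives of a section of `L⁶` at two points. -/
def jets₆ : Fin 4 → (L.V k 6 →ₗ[k] E) :=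
  ![θ.toLinearMap ∘ₗ ch.jet 6 0, θ.toLinearMap ∘ₗ ch.jet 6 1,
    θ'.toLinearMap ∘ₗ ch'.jet 6 0, θ'.toLinearMap ∘ₗ ch'.jet 6 1]

/-- The determinant of the values of two sections of `L⁴`. -/
def det₄ (w : Fin 2 → L.V k 4) : E := (Matrix.of fun i j => jets₄ ch ch' θ θ' i (w j)).det

/-- The determinant of the jets of four sections of `L⁶`. -/
def det₆ (w : Fin 4 → L.V k 6) : E := (Matrix.of fun i j => jets₆ ch ch' θ θ' i (w j)).det

variable {E' : Type u} [CommRing E'] [Algebra k E'] (e : E →ₐ[k] E')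

lemma map_jets₄ (i : Fin 2) (s : L.V k 4) :
    e (jets₄ ch ch' θ θ' i s) = jets₄ ch ch' (e.comp θ) (e.comp θ') i s := by
  fin_cases i <;> rfl

lemma map_jets₆ (i : Fin 4) (s : L.V k 6) :
    e (jets₆ ch ch' θ θ' i s) = jets₆ ch ch' (e.comp θ) (e.comp θ') i s := by
  fin_cases i <;> rfl

lemma map_det₄ (w : Fin 2 → L.V k 4) :
    e (det₄ ch ch' θ θ' w) = det₄ ch ch' (e.comp θ) (e.comp θ') w := by
  rw [det₄, AlgHom.map_det]
  congr 1
  ext i j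
  exact map_jets₄ ch ch' θ θ' e i (w j)

lemma map_det₆ (w : Fin 4 → L.V k 6) :
    e (det₆ ch ch' θ θ' w) = det₆ ch ch' (e.comp θ) (e.comp θ') w := by
  rw [det₆, AlgHom.map_det]
  congr 1
  ext i j
  exact map_jets₆ ch ch' θ θ' e i (w j)

/-- Families of pairs of sections of given types. -/
lemma exists_family {w₄ : Fin 2 → L.V k 4} (h₄ : IsUnit (det₄ ch ch' θ θ' w₄))
    {w₆ : Fin 4 → L.V k 6} (h₆ : IsUnit (det₆ ch ch' θ θ' w₆)) (m₄ : E ⊗[k] L.V k 4)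
    (m₆ : E ⊗[k] L.V k 6) (τ τ' : FibreType) (x y z x' y' z' : E) :
    ∃ (n₄ : E ⊗[k] L.V k 4) (n₆ : E ⊗[k] L.V k 6), ∀ e : E →ₐ[k] k,
      (ch.Fits (e.comp θ) τ (e x) (e y) (e z) (evalT e n₄) (evalT e n₆) ∧
        ch'.Fits (e.comp θ') τ' (e x') (e y') (e z') (evalT e n₄) (evalT e n₆)) ∧
      (ch.Fits (e.comp θ) τ (e x) (e y) (e z) (evalT e m₄) (evalT e m₆) →
        ch'.Fits (e.comp θ') τ' (e x') (e y') (e z') (evalT e m₄) (evalT e m₆) →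
        evalT e n₄ = evalT e m₄ ∧ evalT e n₆ = evalT e m₆) := by
  -- The section of L⁴ is fixed first: for type `node` the prescribed derivative of a₆ involves the
  -- derivative of a₄, which is left free and enters below as D and D'.
  obtain ⟨n₄, hn₄, hm₄⟩ := exists_liftBaseChange_eq (jets₄ ch ch' θ θ') w₄ h₄ m₄
    ![τ.A x, τ'.A x']
  let D := (θ.toLinearMap ∘ₗ ch.jet 4 1).liftBaseChange E n₄
  let D' := (θ'.toLinearMap ∘ₗ ch'.jet 4 1).liftBaseChange E n₄
  have hD : ∀ e : E →ₐ[k] k, e D = e.comp θ (ch.jet 4 1 (evalT e n₄)) := fun e =>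
    apply_liftBaseChange e _ n₄
  have hD' : ∀ e : E →ₐ[k] k, e D' = e.comp θ' (ch'.jet 4 1 (evalT e n₄)) := fun e =>
    apply_liftBaseChange e _ n₄
  obtain ⟨n₆, hn₆, hm₆⟩ := exists_liftBaseChange_eq (jets₆ ch ch' θ θ') w₆ h₆ m₆
    ![τ.B x y, τ.b z + τ.M x * D, τ'.B x' y', τ'.b z' + τ'.M x' * D']
  refine ⟨n₄, n₆, fun e => ?_⟩
  have hA : ∀ (τ : FibreType) (x : E), e (τ.A x) = τ.A (e x) := fun τ x => τ.map_A (e : E →+* k) x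
  have hB : ∀ (τ : FibreType) (x y : E), e (τ.B x y) = τ.B (e x) (e y) :=
    fun τ x y => τ.map_B (e : E →+* k) x y
  have hM : ∀ (τ : FibreType) (x : E), e (τ.M x) = τ.M (e x) := fun τ x => τ.map_M (e : E →+* k) x
  have hb : ∀ (τ : FibreType) (x : E), e (τ.b x) = τ.b (e x) := fun τ x => τ.map_b (e : E →+* k) x
  have e₄ := fun i n => apply_liftBaseChange e (jets₄ ch ch' θ θ' i) n
  have e₆ := fun i n => apply_liftBaseChange e (jets₆ ch ch' θ θ' i) n
  constructor
  · refine ⟨⟨?_, ?_, ?_⟩, ?_, ?_, ?_⟩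
    · exact (e₄ 0 n₄).symm.trans ((congrArg e (hn₄ 0)).trans (hA _ _))
    · exact (e₆ 0 n₆).symm.trans ((congrArg e (hn₆ 0)).trans (hB _ _ _))
    · refine (e₆ 1 n₆).symm.trans ((congrArg e (hn₆ 1)).trans ?_)
      rw [← hD, ← hb, ← hM, ← map_mul, ← map_add]
      rfl
    · exact (e₄ 1 n₄).symm.trans ((congrArg e (hn₄ 1)).trans (hA _ _))
    · exact (e₆ 2 n₆).symm.trans ((congrArg e (hn₆ 2)).trans (hB _ _ _))
    · refine (e₆ 3 n₆).symm.trans ((congrArg e (hn₆ 3)).trans ?_)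
      rw [← hD', ← hb, ← hM, ← map_mul, ← map_add]
      rfl
  · rintro ⟨f1, f2, f3⟩ ⟨f1', f2', f3'⟩
    have h4 : evalT e n₄ = evalT e m₄ := by
      refine hm₄ e fun i => ?_
      fin_cases i
      · exact (e₄ 0 m₄).trans (f1.trans (hA _ _).symm)
      · exact (e₄ 1 m₄).trans (f1'.trans (hA _ _).symm)
    refine ⟨h4, hm₆ e fun i => ?_⟩
    rw [← h4] at f3 f3'
    fin_cases i
    · exact (e₆ 0 m₆).trans (f2.trans (hB _ _ _).symm)
    · refine (e₆ 1 m₆).trans (f3.trans ?_)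
      rw [← hD, ← hb, ← hM, ← map_mul, ← map_add]
      rfl
    · exact (e₆ 2 m₆).trans (f2'.trans (hB _ _ _).symm)
    · refine (e₆ 3 m₆).trans (f3'.trans ?_)
      rw [← hD', ← hb, ← hM, ← map_mul, ← map_add]
      rfl

/-- The family of sections and of points defines a morphism from `Spec E` to 𝔸(V₄ ⊕ V₆) × (C × C),
and the Zariski topology on the parameters is induced from the target. -/
lemma exists_mem_of_isOpen (n₄ : E ⊗[k] L.V k 4) (n₆ : E ⊗[k] L.V k 6) (e₀ : E →ₐ[k] k)
    {O : Set (L.Param₂ k)} (hO : IsOpen O)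
    (hne₀ : Pt.ofAlgHom ch.affine (e₀.comp θ) ≠ Pt.ofAlgHom ch'.affine (e₀.comp θ'))
    (h₀ : (⟨evalT e₀ n₄, evalT e₀ n₆, _, _, hne₀⟩ : L.Param₂ k) ∈ O) :
    ∃ f : E, e₀ f ≠ 0 ∧ ∀ e : E →ₐ[k] k, e f ≠ 0 →
      ∀ hne : Pt.ofAlgHom ch.affine (e.comp θ) ≠ Pt.ofAlgHom ch'.affine (e.comp θ'),
        (⟨evalT e n₄, evalT e n₆, _, _, hne⟩ : L.Param₂ k) ∈ O := by
  let n : E ⊗[k] (L.V k 4 × L.V k 6) :=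
    (LinearMap.inl k (L.V k 4) (L.V k 6)).lTensor E n₄ +
      (LinearMap.inr k (L.V k 4) (L.V k 6)).lTensor E n₆
  have hn : ∀ e : E →ₐ[k] k, evalT e n = (evalT e n₄, evalT e n₆) := by
    intro e
    rw [map_add, evalT_lTensor, evalT_lTensor]
    simp
  obtain ⟨b, hb, hbe⟩ := exists_ofSpec_eq_ofAlgHom ch.affine θ
  obtain ⟨b', hb', hbe'⟩ := exists_ofSpec_eq_ofAlgHom ch'.affine θ'
  obtain ⟨β, hβ, hβe⟩ := ofSpec_prod b hb b' hb'
  obtain ⟨γ, hγ, hγe⟩ := ofSpec_prod (vecFamily n) (vecFamily_over n) β hβ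
  have key : ∀ e : E →ₐ[k] k, Pt.ofSpec γ hγ e = (vecPt (evalT e n₄, evalT e n₆)).prod
      ((Pt.ofAlgHom ch.affine (e.comp θ)).prod (Pt.ofAlgHom ch'.affine (e.comp θ'))) := by
    intro e
    rw [hγe, hβe, hbe, hbe', ofSpec_vecFamily, hn]
  obtain ⟨O', hO', rfl⟩ := isOpen_induced_iff.mp hO
  obtain ⟨f, hf, hfO⟩ := Pt.exists_of_ofSpec_mem γ hγ e₀ hO' (by rw [key]; exact h₀)
  refine ⟨f, hf, fun e he hne => ?_⟩
  have := hfO e he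
  rw [key] at this
  exact this

end Fits

end LineBundle

end

/-! ### Irreducibility of the loci of given types -/

section

open TensorProduct

namespace LineBundle

namespace FibreType

/-- A function whose nonvanishing is the open condition in the parametrization. -/
def G {E : Type*} [CommRing E] (x : E) : FibreType → E
  | any => 1
  | singular => 1
  | node => x
  | cusp => 1

lemma map_G {E E' : Type*} [CommRing E] [CommRing E'] (e : E →+* E') (x : E) (τ : FibreType) :
    e (τ.G x) = τ.G (e x) := by
  cases τ <;> simp [G]

lemma adm_iff {k : Type*} [Field k] (x : k) (τ : FibreType) : τ.Adm x ↔ τ.G x ≠ 0 := by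
  cases τ <;> simp [G, Adm]

end FibreType

section Locus

variable (k : Type u) [Field k] {C : Scheme.{u}} [C.Over (Spec (.of k))] (L : LineBundle C)

/-- The locus of given types at the two points. -/
def typeLocus (τ τ' : FibreType) : Set (L.Param₂ k) :=
  {p | τ.Holds p.a₄ p.a₆ p.c ∧ τ'.Holds p.a₄ p.a₆ p.c'}

variable {k L}

lemma Param₂.mk_eq {p : L.Param₂ k} {a₄ : L.V k 4} {a₆ : L.V k 6} {c c' : Pt k C} {hne : c ≠ c'}
    (h₄ : a₄ = p.a₄) (h₆ : a₆ = p.a₆) (hc : c = p.c) (hc' : c' = p.c') :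
    (⟨a₄, a₆, c, c', hne⟩ : L.Param₂ k) = p := by
  subst h₄ h₆ hc hc'
  rfl

end Locus

section Duals

variable {k : Type u} [Field k] [IsAlgClosed k] {C : Scheme.{u}} [C.Over (Spec (.of k))]
    [AlgebraicGeometry.IsIntegral C] [IsProper (C ↘ Spec (.of k))]
    [SmoothOfRelativeDimension 1 (C ↘ Spec (.of k))] {L : LineBundle C}

/-- Since 4h ≥ 2g + 2, the values at two points can be prescribed. Sections dual to the two
evaluations give the identity matrix. -/
lemma exists_det₄_eq_one (hL : (genus k C : ℤ) + 1 ≤ 2 * Places.deg (L.divisor k)) (ch ch' : L.Chart k 2)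
    {c c' : Pt k C} (hne : c ≠ c') (h : c.point ∈ ch.U) (h' : c'.point ∈ ch'.U) :
    ∃ w, det₄ ch ch' (c.eval ch.U h) (c'.eval ch'.U h') w = 1 := by
  have key : ∀ a : Fin 2 → k, ∃ s : L.V k 4, ∀ i,
      jets₄ ch ch' (c.eval ch.U h) (c'.eval ch'.U h') i s = a i := by
    intro a
    obtain ⟨s, hs, hs'⟩ := Chart.exists_jet_eq ch ch' (r := 4) (n := 1) (n' := 1)
      (by push_cast; linarith) one_le_two one_le_two hne h h' (fun _ => a 0) (fun _ => a 1)
    refine ⟨s, fun i => ?_⟩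
    fin_cases i
    · exact hs 0 one_pos
    · exact hs' 0 one_pos
  choose w hw using fun j => key (Pi.single j 1)
  refine ⟨w, ?_⟩
  have : (Matrix.of fun i j => jets₄ ch ch' (c.eval ch.U h) (c'.eval ch'.U h') i (w j)) = 1 := by
    ext i j
    rw [Matrix.of_apply, hw, Matrix.one_apply, Pi.single_apply]
  rw [det₄, this, Matrix.det_one]

/-- Since 6h ≥ 3g + 3 ≥ 2g + 3, values and first derivatives at both points can be prescribed, which
is total length 4. -/
lemma exists_det₆_eq_one (hL : (genus k C : ℤ) + 1 ≤ 2 * Places.deg (L.divisor k)) (ch ch' : L.Chart k 2)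
    {c c' : Pt k C} (hne : c ≠ c') (h : c.point ∈ ch.U) (h' : c'.point ∈ ch'.U) :
    ∃ w, det₆ ch ch' (c.eval ch.U h) (c'.eval ch'.U h') w = 1 := by
  have key : ∀ a : Fin 4 → k, ∃ s : L.V k 6, ∀ i,
      jets₆ ch ch' (c.eval ch.U h) (c'.eval ch'.U h') i s = a i := by
    intro a
    obtain ⟨s, hs, hs'⟩ := Chart.exists_jet_eq ch ch' (r := 6) (n := 2) (n' := 2)
      (by push_cast; linarith) le_rfl le_rfl hne h h' (fun l => if l = 0 then a 0 else a 1)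
      (fun l => if l = 0 then a 2 else a 3)
    refine ⟨s, fun i => ?_⟩
    fin_cases i
    · exact hs 0 two_pos
    · exact hs 1 one_lt_two
    · exact hs' 0 two_pos
    · exact hs' 1 one_lt_two
  choose w hw using fun j => key (Pi.single j 1)
  refine ⟨w, ?_⟩
  have : (Matrix.of fun i j => jets₆ ch ch' (c.eval ch.U h) (c'.eval ch'.U h') i (w j)) = 1 := by
    ext i j
    rw [Matrix.of_apply, hw, Matrix.one_apply, Pi.single_apply]
  rw [det₆, this, Matrix.det_one]

/-- Pairs of sections with given first order jets at one point and of given type at another. -/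
lemma exists_fits (hL : (genus k C : ℤ) + 1 ≤ 2 * Places.deg (L.divisor k)) (ch ch' : L.Chart k 2)
    {c c' : Pt k C} (hne : c ≠ c') (h : c.point ∈ ch.U) (h' : c'.point ∈ ch'.U)
    (α₀ α₁ β₀ β₁ : k) (τ : FibreType) (x y z : k) :
    ∃ (a₄ : L.V k 4) (a₆ : L.V k 6), (c.eval ch.U h (ch.jet 4 0 a₄) = α₀ ∧
      c.eval ch.U h (ch.jet 4 1 a₄) = α₁ ∧ c.eval ch.U h (ch.jet 6 0 a₆) = β₀ ∧
      c.eval ch.U h (ch.jet 6 1 a₆) = β₁) ∧ ch'.Fits (c'.eval ch'.U h') τ x y z a₄ a₆ := by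
  -- Total length 3 is what 4h ≥ 2g + 2 allows. The derivative of a₄ at the second point stays free,
  -- and a₆ is adapted to it afterwards.
  obtain ⟨a₄, h₄, h₄'⟩ := Chart.exists_jet_eq ch ch' (r := 4) (n := 2) (n' := 1)
    (by push_cast; linarith) le_rfl one_le_two hne h h' (fun l => if l = 0 then α₀ else α₁)
    (fun _ => τ.A x)
  obtain ⟨a₆, h₆, h₆'⟩ := Chart.exists_jet_eq ch ch' (r := 6) (n := 2) (n' := 2)
    (by push_cast; linarith) le_rfl le_rfl hne h h' (fun l => if l = 0 then β₀ else β₁)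
    (fun l => if l = 0 then τ.B x y else τ.b z + τ.M x * c'.eval ch'.U h' (ch'.jet 4 1 a₄))
  exact ⟨a₄, a₆, ⟨h₄ 0 two_pos, h₄ 1 one_lt_two, h₆ 0 two_pos, h₆ 1 one_lt_two⟩,
    h₄' 0 one_pos, h₆' 0 two_pos, h₆' 1 one_lt_two⟩

end Duals

section Irreducible

variable {k : Type u} [Field k] {C : Scheme.{u}} [C.Over (Spec (.of k))]
    [AlgebraicGeometry.IsIntegral C]
    [SmoothOfRelativeDimension 1 (C ↘ Spec (.of k))] {L : LineBundle C}

lemma Chart.holds_iff_fits (ch : L.Chart k 2) (hk2 : (2 : k) ≠ 0) (hk3 : (3 : k) ≠ 0) {c : Pt k C}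
    (h : c.point ∈ ch.U) (τ : FibreType)
    (a₄ : L.V k 4) (a₆ : L.V k 6) : τ.Holds a₄ a₆ c ↔
      ∃ x y z : k, τ.G x ≠ 0 ∧ ch.Fits (c.eval ch.U h) τ x y z a₄ a₆ := by
  simp only [ch.holds_iff c h a₄ a₆ hk2 hk3 le_rfl τ, FibreType.adm_iff]
  rfl

lemma Chart.Fits.holds (hk2 : (2 : k) ≠ 0) (hk3 : (3 : k) ≠ 0) {ch : L.Chart k 2}
    {φ : Γ(C, ch.U) →ₐ[k] k} {τ : FibreType} {x y z : k}
    {a₄ : L.V k 4} {a₆ : L.V k 6} (hf : ch.Fits φ τ x y z a₄ a₆) (hx : τ.G x ≠ 0) :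
    τ.Holds a₄ a₆ (Pt.ofAlgHom ch.affine φ) := by
  rw [ch.holds_iff_fits hk2 hk3 (Pt.ofAlgHom_mem ch.affine φ), Pt.eval_ofAlgHom]
  exact ⟨x, y, z, hx, hf⟩

variable [IsAlgClosed k] [IsProper (C ↘ Spec (.of k))]

/-- The points move with E while the type parameters stay constant. Starting from the constant
family p.a₄, p.a₆, the jets are corrected so that the types persist. The correction vanishes at e₀,
so the family passes through p there and stays in u nearby. -/
lemma exists_ne_zero_forall_exists_mem (hL : (genus k C : ℤ) + 1 ≤ 2 * Places.deg (L.divisor k))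
    (hk2 : (2 : k) ≠ 0) (hk3 : (3 : k) ≠ 0) {ch ch' : L.Chart k 2} {E : Type u} [CommRing E] [Algebra k E]
    (θ : Γ(C, ch.U) →ₐ[k] E) (θ' : Γ(C, ch'.U) →ₐ[k] E) (e₀ : E →ₐ[k] k) {p : L.Param₂ k}
    (h : p.c.point ∈ ch.U) (h' : p.c'.point ∈ ch'.U) (hθ : e₀.comp θ = p.c.eval ch.U h)
    (hθ' : e₀.comp θ' = p.c'.eval ch'.U h') {τ τ' : FibreType} (hp : p ∈ L.typeLocus k τ τ')
    {u : Set (L.Param₂ k)} (hu : IsOpen u) (hpu : p ∈ u) :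
    ∃ f : E, e₀ f ≠ 0 ∧ ∀ e : E →ₐ[k] k, e f ≠ 0 →
      Pt.ofAlgHom ch.affine (e.comp θ) ≠ Pt.ofAlgHom ch'.affine (e.comp θ') →
      ∃ q ∈ L.typeLocus k τ τ' ∩ u, q.c = Pt.ofAlgHom ch.affine (e.comp θ) ∧
        q.c' = Pt.ofAlgHom ch'.affine (e.comp θ') := by
  obtain ⟨x, y, z, hx, hf⟩ := (ch.holds_iff_fits hk2 hk3 h τ p.a₄ p.a₆).mp hp.1
  obtain ⟨x', y', z', hx', hf'⟩ := (ch'.holds_iff_fits hk2 hk3 h' τ' p.a₄ p.a₆).mp hp.2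
  obtain ⟨w₄, hw₄⟩ := exists_det₄_eq_one hL ch ch' p.ne h h'
  obtain ⟨w₆, hw₆⟩ := exists_det₆_eq_one hL ch ch' p.ne h h'
  -- The correction needs both determinants to be invertible. They equal 1 at e₀, so D may be
  -- inverted at the cost of shrinking the base.
  let D : E := det₄ ch ch' θ θ' w₄ * det₆ ch ch' θ θ' w₆
  have hD : e₀ D ≠ 0 := by
    simp only [D]
    rw [map_mul, map_det₄, map_det₆, hθ, hθ', hw₄, hw₆, mul_one]
    exact one_ne_zero
  let E' := Localization.Away D
  let i : E →ₐ[k] E' := IsScalarTower.toAlgHom k E E'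
  have hDi : IsUnit (i D) := IsLocalization.Away.algebraMap_isUnit D
  have hlift : ∀ e : E →ₐ[k] k, e D ≠ 0 → ∃ e' : E' →ₐ[k] k, e'.comp i = e := by
    intro e he
    refine ⟨IsLocalization.liftAlgHom (M := Submonoid.powers D) (f := e) ?_, ?_⟩
    · rintro ⟨_, n, rfl⟩
      exact (IsUnit.mk0 _ he).pow n |>.map (MonoidHom.id k) |> fun h => by simpa using h
    · ext a
      exact IsLocalization.lift_eq _ a
  have h₄ : IsUnit (det₄ ch ch' (i.comp θ) (i.comp θ') w₄) := by
    rw [← map_det₄]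
    exact isUnit_of_mul_isUnit_left (map_mul i _ _ ▸ hDi)
  have h₆ : IsUnit (det₆ ch ch' (i.comp θ) (i.comp θ') w₆) := by
    rw [← map_det₆]
    exact isUnit_of_mul_isUnit_right (map_mul i _ _ ▸ hDi)
  obtain ⟨n₄, n₆, hn⟩ := exists_family ch ch' (i.comp θ) (i.comp θ') h₄ h₆ (1 ⊗ₜ p.a₄) (1 ⊗ₜ p.a₆)
    τ τ' (algebraMap k E' x) (algebraMap k E' y) (algebraMap k E' z) (algebraMap k E' x')
    (algebraMap k E' y') (algebraMap k E' z')
  simp only [AlgHom.commutes, evalT_tmul, map_one, one_smul, ← AlgHom.comp_assoc] at hn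
  obtain ⟨e₀', he₀'⟩ := hlift e₀ hD
  have hc : Pt.ofAlgHom ch.affine (e₀.comp θ) = p.c := by rw [hθ, Pt.ofAlgHom_eval]
  have hc' : Pt.ofAlgHom ch'.affine (e₀.comp θ') = p.c' := by rw [hθ', Pt.ofAlgHom_eval]
  have hn₀ := hn e₀'
  rw [he₀', hθ, hθ'] at hn₀
  obtain ⟨hn₄, hn₆⟩ := hn₀.2 hf hf'
  have hne₀ : Pt.ofAlgHom ch.affine (e₀'.comp (i.comp θ)) ≠
      Pt.ofAlgHom ch'.affine (e₀'.comp (i.comp θ')) := by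
    rw [← AlgHom.comp_assoc, ← AlgHom.comp_assoc, he₀', hc, hc']
    exact p.ne
  obtain ⟨f', hf'0, hf'u⟩ := exists_mem_of_isOpen ch ch' (i.comp θ) (i.comp θ') n₄ n₆ e₀' hu hne₀ (by
    rw [Param₂.mk_eq hn₄ hn₆]
    · exact hpu
    · rw [← AlgHom.comp_assoc, he₀', hc]
    · rw [← AlgHom.comp_assoc, he₀', hc'])
  -- Clearing denominators: f' = a/Dⁿ, so nonvanishing of D·a at a point of E is nonvanishing of
  -- both D and f'.
  obtain ⟨⟨a, ⟨_, n, rfl⟩⟩, ha⟩ := IsLocalization.surj (Submonoid.powers D) f'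
  have ha' : ∀ e' : E' →ₐ[k] k, e' f' * (e'.comp i D) ^ n = e'.comp i a := by
    intro e'
    have := congrArg e' ha
    simp only [map_mul, map_pow] at this
    exact this
  refine ⟨D * a, ?_, fun e he hne => ?_⟩
  · rw [map_mul]
    refine mul_ne_zero hD ?_
    have := ha' e₀'
    rw [he₀'] at this
    rw [← this]
    exact mul_ne_zero hf'0 (pow_ne_zero _ hD)
  · rw [map_mul] at he
    obtain ⟨e', he'⟩ := hlift e (left_ne_zero_of_mul he)
    have h1 := ha' e'
    rw [he'] at h1
    have h2 : e' f' ≠ 0 := fun h0 => right_ne_zero_of_mul he (by rw [← h1, h0, zero_mul])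
    subst he'
    obtain ⟨hfe, hfe'⟩ := (hn e').1
    have hS : (⟨evalT e' n₄, evalT e' n₆, _, _, hne⟩ : L.Param₂ k) ∈ L.typeLocus k τ τ' :=
      ⟨hfe.holds hk2 hk3 hx, hfe'.holds hk2 hk3 hx'⟩
    exact ⟨⟨evalT e' n₄, evalT e' n₆, _, _, hne⟩, ⟨hS, hf'u e' h2 hne⟩, rfl, rfl⟩

/-- With both points of the curve fixed, interpolate the sections and the type parameters linearly
over the affine line and correct the jets. The resulting family joins p at 0 to q at 1, and nonempty
opens of the line meet. -/
lemma exists_mem_inter_of_eq (hL : (genus k C : ℤ) + 1 ≤ 2 * Places.deg (L.divisor k))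
    (hk2 : (2 : k) ≠ 0) (hk3 : (3 : k) ≠ 0) {τ τ' : FibreType} {p q : L.Param₂ k} (hp : p ∈ L.typeLocus k τ τ')
    (hq : q ∈ L.typeLocus k τ τ') (hc : q.c = p.c) (hc' : q.c' = p.c') {u v : Set (L.Param₂ k)}
    (hu : IsOpen u) (hpu : p ∈ u) (hv : IsOpen v) (hqv : q ∈ v) :
    (L.typeLocus k τ τ' ∩ (u ∩ v)).Nonempty := by
  obtain ⟨ch, h⟩ := exists_chart k L p.c.point 2
  obtain ⟨ch', h'⟩ := exists_chart k L p.c'.point 2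
  obtain ⟨x, y, z, hx, hf⟩ := (ch.holds_iff_fits hk2 hk3 h τ p.a₄ p.a₆).mp hp.1
  obtain ⟨x', y', z', hx', hf'⟩ := (ch'.holds_iff_fits hk2 hk3 h' τ' p.a₄ p.a₆).mp hp.2
  obtain ⟨X, Y, Z, -, hF⟩ := (ch.holds_iff_fits hk2 hk3 h τ q.a₄ q.a₆).mp (hc ▸ hq.1)
  obtain ⟨X', Y', Z', -, hF'⟩ := (ch'.holds_iff_fits hk2 hk3 h' τ' q.a₄ q.a₆).mp (hc' ▸ hq.2)
  obtain ⟨w₄, hw₄⟩ := exists_det₄_eq_one hL ch ch' p.ne h h'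
  obtain ⟨w₆, hw₆⟩ := exists_det₆_eq_one hL ch ch' p.ne h h'
  let i : k →ₐ[k] Polynomial k := Algebra.ofId k _
  let θ := i.comp (p.c.eval ch.U h)
  let θ' := i.comp (p.c'.eval ch'.U h')
  have hi : ∀ e : Polynomial k →ₐ[k] k, e.comp i = AlgHom.id k k := fun e => Subsingleton.elim _ _
  have hθ : ∀ e : Polynomial k →ₐ[k] k, e.comp θ = p.c.eval ch.U h := fun e => by
    rw [← AlgHom.comp_assoc, hi, AlgHom.id_comp]
  have hθ' : ∀ e : Polynomial k →ₐ[k] k, e.comp θ' = p.c'.eval ch'.U h' := fun e => by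
    rw [← AlgHom.comp_assoc, hi, AlgHom.id_comp]
  let l (a b : k) : Polynomial k := Polynomial.C a * (1 - Polynomial.X) + Polynomial.C b * Polynomial.X
  let ev (s : k) : Polynomial k →ₐ[k] k := Polynomial.aeval s
  have hl0 : ∀ a b, ev 0 (l a b) = a := fun a b => by simp [ev, l]
  have hl1 : ∀ a b, ev 1 (l a b) = b := fun a b => by simp [ev, l]
  obtain ⟨n₄, n₆, hn⟩ := exists_family ch ch' θ θ' (w₄ := w₄) (w₆ := w₆)
    (by rw [← map_det₄, hw₄, map_one]; exact isUnit_one)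
    (by rw [← map_det₆, hw₆, map_one]; exact isUnit_one)
    ((1 - Polynomial.X) ⊗ₜ p.a₄ + Polynomial.X ⊗ₜ q.a₄)
    ((1 - Polynomial.X) ⊗ₜ p.a₆ + Polynomial.X ⊗ₜ q.a₆)
    τ τ' (l x X) (l y Y) (l z Z) (l x' X') (l y' Y') (l z' Z')
  simp only [hθ, hθ'] at hn
  have hne : ∀ e : Polynomial k →ₐ[k] k,
      Pt.ofAlgHom ch.affine (e.comp θ) ≠ Pt.ofAlgHom ch'.affine (e.comp θ') := by
    intro e
    rw [hθ, hθ', Pt.ofAlgHom_eval, Pt.ofAlgHom_eval]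
    exact p.ne
  have hpt : ∀ e : Polynomial k →ₐ[k] k, Pt.ofAlgHom ch.affine (e.comp θ) = p.c := by
    intro e
    rw [hθ, Pt.ofAlgHom_eval]
  have hpt' : ∀ e : Polynomial k →ₐ[k] k, Pt.ofAlgHom ch'.affine (e.comp θ') = p.c' := by
    intro e
    rw [hθ', Pt.ofAlgHom_eval]
  have h0 := (hn (ev 0)).2
  have h1 := (hn (ev 1)).2
  simp only [hl0, hl1, map_add, evalT_tmul] at h0 h1
  simp only [ev, map_sub, map_one, Polynomial.aeval_X, sub_zero, sub_self, one_smul, zero_smul,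
    add_zero, zero_add] at h0 h1
  obtain ⟨h0₄, h0₆⟩ := h0 hf hf'
  obtain ⟨h1₄, h1₆⟩ := h1 hF hF'
  obtain ⟨f, hf0, hfu⟩ := exists_mem_of_isOpen ch ch' θ θ' n₄ n₆ (ev 0) hu (hne _) (by
    rw [Param₂.mk_eq h0₄ h0₆ (hpt _) (hpt' _)]
    exact hpu)
  obtain ⟨g, hg0, hgv⟩ := exists_mem_of_isOpen ch ch' θ θ' n₄ n₆ (ev 1) hv (hne _) (by
    rw [Param₂.mk_eq h1₄ h1₆ ((hpt _).trans hc.symm) ((hpt' _).trans hc'.symm)]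
    exact hqv)
  have hG : ∀ (e : Polynomial k →ₐ[k] k) (τ : FibreType) (r : Polynomial k),
      e (τ.G r) = τ.G (e r) := fun e τ r => τ.map_G (e : Polynomial k →+* k) r
  -- The factors express membership in u, membership in v, and admissibility of the interpolated
  -- parameters at the two points. For the last two, nonvanishing at 0 suffices. A nonzero
  -- polynomial over the infinite field `k` has a nonzero value.
  have hprod : f * g * (τ.G (l x X) * τ'.G (l x' X')) ≠ 0 := by
    refine mul_ne_zero (mul_ne_zero ?_ ?_) (mul_ne_zero ?_ ?_)
    · rintro rfl
      exact hf0 (map_zero _)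
    · rintro rfl
      exact hg0 (map_zero _)
    · intro h
      have := hG (ev 0) τ (l x X)
      rw [h, map_zero, hl0] at this
      exact hx this.symm
    · intro h
      have := hG (ev 0) τ' (l x' X')
      rw [h, map_zero, hl0] at this
      exact hx' this.symm
  obtain ⟨s, hs⟩ : ∃ s : k, ev s (f * g * (τ.G (l x X) * τ'.G (l x' X'))) ≠ 0 := by
    by_contra! hcon
    exact hprod (Polynomial.funext fun s => by
      rw [Polynomial.eval_zero, ← Polynomial.coe_aeval_eq_eval]
      exact hcon s)
  rw [map_mul, map_mul, map_mul, hG, hG] at hs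
  have hs1 := left_ne_zero_of_mul hs
  have hs2 := right_ne_zero_of_mul hs
  obtain ⟨hfe, hfe'⟩ := (hn (ev s)).1
  rw [← hθ (ev s)] at hfe
  rw [← hθ' (ev s)] at hfe'
  have hS : (⟨evalT (ev s) n₄, evalT (ev s) n₆, _, _, hne (ev s)⟩ : L.Param₂ k) ∈
      L.typeLocus k τ τ' :=
    ⟨hfe.holds hk2 hk3 (left_ne_zero_of_mul hs2), hfe'.holds hk2 hk3 (right_ne_zero_of_mul hs2)⟩
  exact ⟨_, hS, hfu _ (left_ne_zero_of_mul hs1) (hne _), hgv _ (right_ne_zero_of_mul hs1) (hne _)⟩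

/-- The first point can be moved. -/
lemma exists_isOpen_forall_exists_fst (hL : (genus k C : ℤ) + 1 ≤ 2 * Places.deg (L.divisor k))
    (hk2 : (2 : k) ≠ 0) (hk3 : (3 : k) ≠ 0) {τ τ' : FibreType} {p : L.Param₂ k}
    (hp : p ∈ L.typeLocus k τ τ') {u : Set (L.Param₂ k)} (hu : IsOpen u) (hpu : p ∈ u) :
    ∃ O : C.Opens, p.c.point ∈ O ∧ ∀ b : Pt k C, b.point ∈ O → b ≠ p.c' →
      ∃ q ∈ L.typeLocus k τ τ' ∩ u, q.c = b ∧ q.c' = p.c' := by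
  obtain ⟨ch, h⟩ := exists_chart k L p.c.point 2
  obtain ⟨ch', h'⟩ := exists_chart k L p.c'.point 2
  let i : k →ₐ[k] Γ(C, ch.U) := Algebra.ofId k _
  have hi : ∀ e : Γ(C, ch.U) →ₐ[k] k, e.comp i = AlgHom.id k k := fun e => Subsingleton.elim _ _
  have hθ' : ∀ e : Γ(C, ch.U) →ₐ[k] k, e.comp (i.comp (p.c'.eval ch'.U h')) =
      p.c'.eval ch'.U h' := fun e => by
    rw [← AlgHom.comp_assoc, hi, AlgHom.id_comp]
  -- The base is the coordinate neighbourhood itself, with the tautological first point and a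
  -- constant second point.
  obtain ⟨f, hf, hfu⟩ := exists_ne_zero_forall_exists_mem hL hk2 hk3 (ch := ch) (ch' := ch')
    (AlgHom.id k _) (i.comp (p.c'.eval ch'.U h')) (p.c.eval ch.U h) h h' (AlgHom.comp_id _) (hθ' _)
    hp hu hpu
  refine ⟨C.basicOpen f, (p.c.eval_ne_zero_iff h f).mp hf, fun b hb hbne => ?_⟩
  have hbU := C.basicOpen_le f hb
  have := hfu (b.eval ch.U hbU) ((b.eval_ne_zero_iff hbU f).mpr hb)
  rw [hθ', AlgHom.comp_id, Pt.ofAlgHom_eval, Pt.ofAlgHom_eval] at this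
  exact this hbne

/-- The second point can be moved. -/
lemma exists_isOpen_forall_exists_snd (hL : (genus k C : ℤ) + 1 ≤ 2 * Places.deg (L.divisor k))
    (hk2 : (2 : k) ≠ 0) (hk3 : (3 : k) ≠ 0) {τ τ' : FibreType} {p : L.Param₂ k}
    (hp : p ∈ L.typeLocus k τ τ') {u : Set (L.Param₂ k)} (hu : IsOpen u) (hpu : p ∈ u) :
    ∃ O : C.Opens, p.c'.point ∈ O ∧ ∀ b : Pt k C, b.point ∈ O → p.c ≠ b →
      ∃ q ∈ L.typeLocus k τ τ' ∩ u, q.c = p.c ∧ q.c' = b := by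
  obtain ⟨ch, h⟩ := exists_chart k L p.c.point 2
  obtain ⟨ch', h'⟩ := exists_chart k L p.c'.point 2
  let i : k →ₐ[k] Γ(C, ch'.U) := Algebra.ofId k _
  have hi : ∀ e : Γ(C, ch'.U) →ₐ[k] k, e.comp i = AlgHom.id k k := fun e => Subsingleton.elim _ _
  have hθ : ∀ e : Γ(C, ch'.U) →ₐ[k] k, e.comp (i.comp (p.c.eval ch.U h)) =
      p.c.eval ch.U h := fun e => by
    rw [← AlgHom.comp_assoc, hi, AlgHom.id_comp]
  obtain ⟨f, hf, hfu⟩ := exists_ne_zero_forall_exists_mem hL hk2 hk3 (ch := ch) (ch' := ch')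
    (i.comp (p.c.eval ch.U h)) (AlgHom.id k _) (p.c'.eval ch'.U h') h h' (hθ _) (AlgHom.comp_id _)
    hp hu hpu
  refine ⟨C.basicOpen f, (p.c'.eval_ne_zero_iff h' f).mp hf, fun b hb hbne => ?_⟩
  have hbU := C.basicOpen_le f hb
  have := hfu (b.eval ch'.U hbU) ((b.eval_ne_zero_iff hbU f).mpr hb)
  rw [hθ, AlgHom.comp_id, Pt.ofAlgHom_eval, Pt.ofAlgHom_eval] at this
  exact this hbne

/-- To show that two relatively open nonempty subsets meet, take p in one and q in the other. Move
both first points to a common b, then both second points to a common b', and join the results by a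
line. The common points exist because nonempty opens of the irreducible curve meet; b is chosen away
from both second points, and b' away from b. -/
theorem isIrreducible_typeLocus (hL : (genus k C : ℤ) + 1 ≤ 2 * Places.deg (L.divisor k))
    (hk2 : (2 : k) ≠ 0) (hk3 : (3 : k) ≠ 0) (τ τ' : FibreType) : IsIrreducible (L.typeLocus k τ τ') := by
  constructor
  · obtain ⟨c, c', hne⟩ := exists_pt_ne k (C := C)
    obtain ⟨ch, h⟩ := exists_chart k L c.point 2
    obtain ⟨ch', h'⟩ := exists_chart k L c'.point 2
    obtain ⟨a₄, a₆, ⟨h1, h2, h3, h4⟩, hf⟩ := exists_fits hL ch ch' hne h h' (τ.A 1) 0 (τ.B 1 0)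
      (τ.b 0) τ' 1 0 0
    have hG : ∀ τ : FibreType, τ.G (1 : k) ≠ 0 := fun τ => by cases τ <;> simp [FibreType.G]
    refine ⟨⟨a₄, a₆, c, c', hne⟩, ?_, ?_⟩
    · refine (ch.holds_iff_fits hk2 hk3 h τ a₄ a₆).mpr ⟨1, 0, 0, hG τ, h1, h3, ?_⟩
      rw [h4, h2, mul_zero, add_zero]
    · exact (ch'.holds_iff_fits hk2 hk3 h' τ' a₄ a₆).mpr ⟨1, 0, 0, hG τ', hf⟩
  · rintro u v hu hv ⟨p, hp, hpu⟩ ⟨q, hq, hqv⟩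
    obtain ⟨O, hpO, hO⟩ := exists_isOpen_forall_exists_fst hL hk2 hk3 hp hu hpu
    obtain ⟨O', hqO', hO'⟩ := exists_isOpen_forall_exists_fst hL hk2 hk3 hq hv hqv
    obtain ⟨b, hb, hbne⟩ := exists_pt_mem_of_finite (k := k) (O.isOpen.inter O'.isOpen)
      ⟨genericPoint C, genericPoint_mem hpO, genericPoint_mem hqO'⟩ (Set.toFinite {p.c', q.c'})
    simp only [Set.mem_insert_iff, Set.mem_singleton_iff, not_or] at hbne
    obtain ⟨p₁, ⟨hp₁, hp₁u⟩, hp₁c, hp₁c'⟩ := hO b hb.1 hbne.1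
    obtain ⟨q₁, ⟨hq₁, hq₁v⟩, hq₁c, hq₁c'⟩ := hO' b hb.2 hbne.2
    obtain ⟨W, hpW, hW⟩ := exists_isOpen_forall_exists_snd hL hk2 hk3 hp₁ hu hp₁u
    obtain ⟨W', hqW', hW'⟩ := exists_isOpen_forall_exists_snd hL hk2 hk3 hq₁ hv hq₁v
    obtain ⟨b', hb', hbne'⟩ := exists_pt_mem_of_finite (k := k) (W.isOpen.inter W'.isOpen)
      ⟨genericPoint C, genericPoint_mem hpW, genericPoint_mem hqW'⟩ (Set.finite_singleton b)
    have hne : b ≠ b' := fun h => hbne' h.symm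
    obtain ⟨p₂, ⟨hp₂, hp₂u⟩, hp₂c, hp₂c'⟩ := hW b' hb'.1 (hp₁c ▸ hne)
    obtain ⟨q₂, ⟨hq₂, hq₂v⟩, hq₂c, hq₂c'⟩ := hW' b' hb'.2 (hq₁c ▸ hne)
    exact exists_mem_inter_of_eq hL hk2 hk3 hp₂ hq₂
      (hq₂c.trans (hq₁c.trans (hp₁c.symm.trans hp₂c.symm))) (hq₂c'.trans hp₂c'.symm) hu hp₂u hv hq₂v

end Irreducible

end LineBundle

end

/-! ### The parameter spaces as schemes and their sets of closed points -/

section Schemes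

variable {k : Type u} [Field k]

lemma locallyOfFiniteType_affSpace (V : Type u) [AddCommGroup V] [Module k V]
    [FiniteDimensional k V] : LocallyOfFiniteType (affSpace k V ↘ Spec (.of k)) := by
  have h1 : Algebra.FiniteType k (SymmetricAlgebra k (Module.Dual k V)) :=
    Algebra.FiniteType.equiv inferInstance
      (SymmetricAlgebra.equivMvPolynomial (Module.finBasis k (Module.Dual k V))).symm
  have h2 : (algebraMap k (SymmetricAlgebra k (Module.Dual k V))).FiniteType :=
    RingHom.finiteType_algebraMap.mpr h1
  exact (HasRingHomProperty.Spec_iff (P := @LocallyOfFiniteType)).mpr h2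

lemma locallyOfFiniteType_prodOver (X Y : Scheme.{u}) [X.Over (Spec (.of k))]
    [Y.Over (Spec (.of k))] [LocallyOfFiniteType (X ↘ Spec (.of k))]
    [LocallyOfFiniteType (Y ↘ Spec (.of k))] :
    LocallyOfFiniteType (prodOver k X Y ↘ Spec (.of k)) := by
  change LocallyOfFiniteType (pullback.fst (X ↘ Spec (.of k)) (Y ↘ Spec (.of k)) ≫ _)
  infer_instance

end Schemes

namespace LineBundle

section Families

variable (k : Type u) [Field k] {C : Scheme.{u}} [C.Over (Spec (.of k))] (L : LineBundle C)

/-- The scheme `𝔸(V₄ ⊕ V₆) × C`. -/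
abbrev space₁ : Scheme.{u} := prodOver k (affSpace k (L.V k 4 × L.V k 6)) C

/-- The scheme `𝔸(V₄ ⊕ V₆) × (C × C)`. -/
abbrev space₂ : Scheme.{u} := prodOver k (affSpace k (L.V k 4 × L.V k 6)) (prodOver k C C)

/-- The point of `𝔸(V₄ ⊕ V₆) × C` given by a pair of sections and a point. -/
def pt₁ (p : L.Param k) : Pt k (L.space₁ k) := (vecPt (k := k) (p.a₄, p.a₆)).prod p.c

/-- The point of `𝔸(V₄ ⊕ V₆) × (C × C)` given by a pair of sections and two points. -/
def pt₂ (p : L.Param₂ k) : Pt k (L.space₂ k) :=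
  (vecPt (k := k) (p.a₄, p.a₆)).prod (p.c.prod p.c')

lemma isInducing_pt₁ : Topology.IsInducing fun p => (L.pt₁ k p).point := ⟨rfl⟩

lemma isInducing_pt₂ : Topology.IsInducing fun p => (L.pt₂ k p).point := ⟨rfl⟩

/-- The family over `𝔸(V₄ ⊕ V₆) × C`. -/
def family : Family k L (L.Param k) where
  X := L.space₁ k
  overInst := inferInstance
  q := pullback.fst _ _
  hq := rfl
  π := pullback.snd _ _
  hπ := pullback.condition.symm
  pt := L.pt₁ k
  cont := (L.isInducing_pt₁ k).continuous
  a₄ := Param.a₄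
  a₆ := Param.a₆
  c := Param.c
  hqpt _ := Pt.prod_map_fst _ _
  hπpt _ := Pt.prod_map_snd _ _

/-- The family over `𝔸(V₄ ⊕ V₆) × (C × C)` with the first point. -/
def familyFst : Family k L (L.Param₂ k) where
  X := L.space₂ k
  overInst := inferInstance
  q := pullback.fst _ _
  hq := rfl
  π := pullback.snd _ _ ≫ pullback.fst _ _
  hπ := (Category.assoc _ _ _).trans pullback.condition.symm
  pt := L.pt₂ k
  cont := (L.isInducing_pt₂ k).continuous
  a₄ := Param₂.a₄
  a₆ := Param₂.a₆
  c := Param₂.c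
  hqpt _ := Pt.prod_map_fst _ _
  hπpt p := by
    refine Subtype.ext ?_
    change pullback.lift _ _ _ ≫ pullback.snd _ _ ≫ pullback.fst _ _ = _
    rw [pullback.lift_snd_assoc]
    exact pullback.lift_fst _ _ _

/-- The family over `𝔸(V₄ ⊕ V₆) × (C × C)` with the second point. -/
def familySnd : Family k L (L.Param₂ k) where
  X := L.space₂ k
  overInst := inferInstance
  q := pullback.fst _ _
  hq := rfl
  π := pullback.snd _ _ ≫ pullback.snd _ _
  hπ := (Category.assoc _ _ _).trans
    ((congrArg _ pullback.condition.symm).trans pullback.condition.symm)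
  pt := L.pt₂ k
  cont := (L.isInducing_pt₂ k).continuous
  a₄ := Param₂.a₄
  a₆ := Param₂.a₆
  c := Param₂.c'
  hqpt _ := Pt.prod_map_fst _ _
  hπpt p := by
    refine Subtype.ext ?_
    change pullback.lift _ _ _ ≫ pullback.snd _ _ ≫ pullback.snd _ _ = _
    rw [pullback.lift_snd_assoc]
    exact pullback.lift_snd _ _ _

variable {k L}

/-- Forget the second point. -/
def Param₂.forget (p : L.Param₂ k) : L.Param k := ⟨p.a₄, p.a₆, p.c⟩

lemma Param₂.continuous_forget : Continuous (Param₂.forget (L := L) (k := k)) := by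
  refine continuous_induced_rng.mpr ?_
  let F : L.space₂ k ⟶ L.space₁ k := pullback.lift (pullback.fst _ _)
    (pullback.snd _ _ ≫ pullback.fst _ _) (pullback.condition.trans (Category.assoc _ _ _).symm)
  have h1 : ∀ p : L.Param₂ k, (L.pt₁ k p.forget).1 = (L.pt₂ k p).1 ≫ F := by
    intro p
    refine pullback.hom_ext ?_ ?_
    · rw [Category.assoc, pullback.lift_fst]
      exact (pullback.lift_fst _ _ _).trans (pullback.lift_fst _ _ _).symm
    · rw [Category.assoc, pullback.lift_snd]
      refine (pullback.lift_snd _ _ _).trans ?_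
      exact (congrArg Subtype.val ((L.familyFst k).hπpt p)).symm
  have h2 : (fun p : L.Param₂ k => (L.pt₁ k p.forget).point) =
      F ∘ fun p : L.Param₂ k => (L.pt₂ k p).point := by
    funext p
    exact congrArg (fun f : Spec (.of k) ⟶ L.space₁ k => f (IsLocalRing.closedPoint k)) (h1 p)
  change Continuous fun p : L.Param₂ k => (L.pt₁ k p.forget).point
  rw [h2]
  exact F.continuous.comp (L.isInducing_pt₂ k).continuous

end Families

section Ranges

variable (k : Type u) [Field k] {C : Scheme.{u}} [C.Over (Spec (.of k))]
    [LocallyOfFiniteType (C ↘ Spec (.of k))]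
    (L : LineBundle C) [FiniteDimensional k (L.V k 4)] [FiniteDimensional k (L.V k 6)]

lemma locallyOfFiniteType_space₁ : LocallyOfFiniteType (L.space₁ k ↘ Spec (.of k)) := by
  have := locallyOfFiniteType_affSpace (k := k) (L.V k 4 × L.V k 6)
  exact locallyOfFiniteType_prodOver _ _

lemma locallyOfFiniteType_space₂ : LocallyOfFiniteType (L.space₂ k ↘ Spec (.of k)) := by
  have := locallyOfFiniteType_affSpace (k := k) (L.V k 4 × L.V k 6)
  have := locallyOfFiniteType_prodOver (k := k) C C
  exact locallyOfFiniteType_prodOver _ _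

variable [IsAlgClosed k]

lemma range_pt₁ : Set.range (fun p => (L.pt₁ k p).point) = closedPoints (L.space₁ k) ∩ Set.univ := by
  have := L.locallyOfFiniteType_space₁ k
  rw [Set.inter_univ]
  refine subset_antisymm ?_ fun x hx => ?_
  · rintro _ ⟨p, rfl⟩
    exact (L.pt₁ k p).isClosed_point
  · let p : Pt k (L.space₁ k) := ptOf k ⟨x, hx⟩
    obtain ⟨v, hv⟩ := exists_eq_vecPt (p.map (pullback.fst _ _) rfl)
    refine ⟨⟨v.1, v.2, p.map (pullback.snd _ _) pullback.condition.symm⟩, ?_⟩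
    have h1 := p.prod_map_fst_snd
    rw [hv] at h1
    exact (congrArg Pt.point h1).trans (ptOf_point k ⟨x, hx⟩)

variable [IsSeparated (C ↘ Spec (.of k))]

/-- G is the complement of the preimage of the diagonal, which is closed since C is separated. A
pair of `k`-points lies on the diagonal exactly when its members are equal. -/
lemma exists_range_pt₂ : ∃ G : Set (L.space₂ k), IsOpen G ∧
    Set.range (fun p => (L.pt₂ k p).point) = closedPoints (L.space₂ k) ∩ G := by
  have := L.locallyOfFiniteType_space₂ k
  let δ := pullback.diagonal (C ↘ Spec (.of k))
  let s : L.space₂ k ⟶ prodOver k C C := pullback.snd _ _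
  refine ⟨(s ⁻¹' Set.range δ)ᶜ, (δ.isClosedEmbedding.isClosed_range.preimage s.continuous).isOpen_compl,
    subset_antisymm ?_ ?_⟩
  · rintro _ ⟨p, rfl⟩
    refine ⟨(L.pt₂ k p).isClosed_point, ?_⟩
    rintro ⟨x, hx⟩
    have hs : s (L.pt₂ k p).point = (p.c.prod p.c').point :=
      congrArg Pt.point (Pt.prod_map_snd (vecPt (p.a₄, p.a₆)) (p.c.prod p.c'))
    rw [hs] at hx
    have h1 : pullback.fst (C ↘ Spec (.of k)) (C ↘ Spec (.of k)) (p.c.prod p.c').point = x := by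
      rw [← hx]
      exact congrArg (fun f : C ⟶ C => f x) (pullback.diagonal_fst (C ↘ Spec (.of k)))
    have h2 : pullback.snd (C ↘ Spec (.of k)) (C ↘ Spec (.of k)) (p.c.prod p.c').point = x := by
      rw [← hx]
      exact congrArg (fun f : C ⟶ C => f x) (pullback.diagonal_snd (C ↘ Spec (.of k)))
    have h3 : p.c.point = x := (congrArg Pt.point (Pt.prod_map_fst p.c p.c')).symm.trans h1
    have h4 : p.c'.point = x := (congrArg Pt.point (Pt.prod_map_snd p.c p.c')).symm.trans h2
    exact p.ne (Pt.point_injective (h3.trans h4.symm))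
  · rintro x ⟨hx, hxG⟩
    let p : Pt k (L.space₂ k) := ptOf k ⟨x, hx⟩
    obtain ⟨v, hv⟩ := exists_eq_vecPt (p.map (pullback.fst _ _) rfl)
    let r : Pt k (prodOver k C C) := p.map s pullback.condition.symm
    let c := r.map (pullback.fst _ _) rfl
    let c' := r.map (pullback.snd _ _) pullback.condition.symm
    have hr : c.prod c' = r := r.prod_map_fst_snd
    have hpx : p.point = x := ptOf_point k ⟨x, hx⟩
    have hne : c ≠ c' := by
      intro h
      refine hxG ⟨c.point, ?_⟩
      have h1 : c.prod c = r := (congrArg c.prod h).trans hr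
      have h2 : (c.prod c).1 = c.1 ≫ δ := by
        refine pullback.hom_ext ?_ ?_
        · rw [Category.assoc, pullback.diagonal_fst, Category.comp_id]
          exact pullback.lift_fst _ _ _
        · rw [Category.assoc, pullback.diagonal_snd, Category.comp_id]
          exact pullback.lift_snd _ _ _
      have h3 : (c.prod c).point = δ c.point :=
        congrArg (fun f : Spec (.of k) ⟶ prodOver k C C => f (IsLocalRing.closedPoint k)) h2
      rw [← h3, h1, ← hpx]
      rfl
    refine ⟨⟨v.1, v.2, c, c', hne⟩, ?_⟩
    have h1 := p.prod_map_fst_snd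
    rw [hv] at h1
    have h2 : L.pt₂ k ⟨v.1, v.2, c, c', hne⟩ = p := (congrArg (vecPt v).prod hr).trans h1
    exact (congrArg Pt.point h2).trans hpx

end Ranges

end LineBundle

/-! ### Topological lemmas, and the types of fibres at one point -/

section Topology

variable {X Y : Type*} [TopologicalSpace X] [TopologicalSpace Y]

lemma closure_ssubset_closure {S S' Z : Set X} (h : S ⊆ S') (hZ : IsClosed Z) (hSZ : S ⊆ Z) {p : X}
    (hp : p ∈ S') (hpZ : p ∉ Z) : closure S ⊂ closure S' :=
  ⟨closure_mono h, fun h' => hpZ (closure_minimal hSZ hZ (h' (subset_closure hp)))⟩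

lemma isIrreducible_of_image {f : X → Y} (hf : Topology.IsInducing f) {S : Set X}
    (hS : IsIrreducible (f '' S)) : IsIrreducible S := by
  refine ⟨Set.image_nonempty.mp hS.1, fun u v hu hv ⟨p, hp, hpu⟩ ⟨q, hq, hqv⟩ => ?_⟩
  obtain ⟨u, hu', rfl⟩ := hf.isOpen_iff.mp hu
  obtain ⟨v, hv', rfl⟩ := hf.isOpen_iff.mp hv
  obtain ⟨_, ⟨r, hr, rfl⟩, hru, hrv⟩ := hS.2 u v hu' hv' ⟨f p, ⟨p, hp, rfl⟩, hpu⟩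
    ⟨f q, ⟨q, hq, rfl⟩, hqv⟩
  exact ⟨r, hr, hru, hrv⟩

lemma irreducibleComponents_eq_pair {A B : Set X} (hA : IsIrreducible A) (hA' : IsClosed A)
    (hB : IsIrreducible B) (hB' : IsClosed B) (hAB : A ∪ B = Set.univ) (h : ¬ A ⊆ B)
    (h' : ¬ B ⊆ A) : irreducibleComponents X = {A, B} := by
  have key : ∀ T : Set X, IsIrreducible T → T ⊆ A ∨ T ⊆ B := fun T hT =>
    isPreirreducible_iff_isClosed_union_isClosed.mp hT.2 A B hA' hB' (hAB ▸ Set.subset_univ T)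
  ext T
  constructor
  · intro hT
    rcases key T hT.1 with hTA | hTB
    · exact Or.inl (subset_antisymm hTA (hT.2 hA hTA))
    · exact Or.inr (subset_antisymm hTB (hT.2 hB hTB))
  · rintro (rfl | rfl)
    · refine ⟨hA, fun S hS hAS => ?_⟩
      exact (key S hS).resolve_right fun hSB => h (hAS.trans hSB)
    · refine ⟨hB, fun S hS hBS => ?_⟩
      exact (key S hS).resolve_left fun hSA => h' (hBS.trans hSA)

end Topology

namespace LineBundle

variable {k : Type u} [Field k] {C : Scheme.{u}} [C.Over (Spec (.of k))] {L : LineBundle C}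

section Types

variable (k L)

/-- The locus of given type in `𝔸(V₄ ⊕ V₆) × C`. -/
def typeLocus₁ (τ : FibreType) : Set (L.Param k) := {p | τ.Holds p.a₄ p.a₆ p.c}

variable {k L}

lemma FibreType.Holds.singular_of_two_le {a₄ : L.V k 4} {a₆ : L.V k 6} {c : Pt k C}
    (h : 2 ≤ (L.pow 12).val (L.disc a₄ a₆) c.point) : FibreType.singular.Holds a₄ a₆ c :=
  one_le_two.trans h

lemma FibreType.node_or_cusp {a₄ : L.V k 4} {a₆ : L.V k 6} {c : Pt k C}
    (h : 2 ≤ (L.pow 12).val (L.disc a₄ a₆) c.point) :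
    FibreType.node.Holds a₄ a₆ c ∨ FibreType.cusp.Holds a₄ a₆ c := by
  by_cases h0 : (L.pow 6).val a₆ c.point = 0
  · exact Or.inl ⟨h, h0⟩
  · exact Or.inr ⟨h, Order.one_le_iff_pos.mpr (pos_iff_ne_zero.mpr h0)⟩

lemma FibreType.Holds.two_le {τ : FibreType} (hτ : τ = .node ∨ τ = .cusp) {a₄ : L.V k 4}
    {a₆ : L.V k 6} {c : Pt k C} (h : τ.Holds a₄ a₆ c) :
    2 ≤ (L.pow 12).val (L.disc a₄ a₆) c.point := by
  rcases hτ with rfl | rfl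
  · exact h.1
  · exact h.1

/-- Exchange the two points. -/
def Param₂.swap (p : L.Param₂ k) : L.Param₂ k := ⟨p.a₄, p.a₆, p.c', p.c, p.ne.symm⟩

lemma Chart.coeff_disc_zero {d : ℕ} (ch : L.Chart k d) (c : Pt k C) (h : c.point ∈ ch.U) (l : ℕ) :
    (4 * ch.poly c h (0 : L.V k 4) ^ 3 - 27 * ch.poly c h (0 : L.V k 6) ^ 2).coeff l = 0 := by
  simp [Chart.poly]

end Types

section Closed

variable [AlgebraicGeometry.IsIntegral C] [SmoothOfRelativeDimension 1 (C ↘ Spec (.of k))]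
  [FiniteDimensional k (L.V k 4)] [FiniteDimensional k (L.V k 6)]

variable (L)

lemma isClosed_K (d : ℕ) : IsClosed (L.K k d) := (L.family k).isClosed_le_val_disc d

lemma isClosed_fst (d : ℕ) :
    IsClosed {p : L.Param₂ k | (d : ℕ∞) ≤ (L.pow 12).val (L.disc p.a₄ p.a₆) p.c.point} :=
  (L.familyFst k).isClosed_le_val_disc d

lemma isClosed_snd (d : ℕ) :
    IsClosed {p : L.Param₂ k | (d : ℕ∞) ≤ (L.pow 12).val (L.disc p.a₄ p.a₆) p.c'.point} :=
  (L.familySnd k).isClosed_le_val_disc d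

lemma isClosed_K₂plus : IsClosed (L.K₂plus k) := (L.isClosed_fst 2).inter (L.isClosed_snd 2)

end Closed

/-! ### Upper bounds for the codimensions -/

section UpperBounds

variable [IsAlgClosed k] [AlgebraicGeometry.IsIntegral C]
  [SmoothOfRelativeDimension 1 (C ↘ Spec (.of k))]
  [FiniteDimensional k (L.V k 4)] [FiniteDimensional k (L.V k 6)]

variable (k L)

/-- At the zero pair of sections Δ vanishes identically, so the d Taylor coefficients that cut out
the locus over a chart have a common zero there, and Krull's theorem applies. -/
lemma codim_K_le (d : ℕ) : codim (L.K k d) ≤ d := by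
  have := locallyOfFiniteType_of_smooth k (C := C)
  have := L.locallyOfFiniteType_space₁ k
  have := LocallyOfFiniteType.isLocallyNoetherian (L.space₁ k ↘ Spec (.of k))
  have := LocallyOfFiniteType.jacobsonSpace (L.space₁ k ↘ Spec (.of k))
  obtain ⟨c, -, -⟩ := exists_pt_ne k (C := C)
  obtain ⟨ch, h⟩ := exists_chart k L c.point d
  let F := L.family k
  choose σ hσ using F.exists_disc_section ch
  let p₀ : L.Param k := ⟨0, 0, c⟩
  refine codim_le (L.isInducing_pt₁ k) isOpen_univ (L.range_pt₁ k) (p₀ := p₀)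
    (W := F.π ⁻¹ᵁ ch.U) (F.mem_preimage (p := p₀) h) (fun i : Fin d => σ i) (fun i hi => ?_)
    (L.isClosed_K d) fun p hp hpσ => ?_
  · refine (F.mem_basicOpen_iff (σ i) (p := p₀) h).mp hi ?_
    rw [hσ i p₀ h]
    exact ch.coeff_disc_zero c h i
  · have hpU : (F.c p).point ∈ ch.U := F.mem_of_mem_preimage hp
    refine (ch.le_val_disc_iff p.c hpU le_rfl p.a₄ p.a₆).mpr fun l hl => ?_
    have h1 := mt (F.mem_basicOpen_iff (σ l) (p := p) hpU).mpr (hpσ ⟨l, hl⟩)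
    rw [not_not, hσ l p hpU] at h1
    exact h1

/-- Two equations at each of the two points, which vanish together at the zero pair of sections. -/
lemma codim_K₂plus_le [IsSeparated (C ↘ Spec (.of k))] : codim (L.K₂plus k) ≤ 4 := by
  have := locallyOfFiniteType_of_smooth k (C := C)
  have := L.locallyOfFiniteType_space₂ k
  have := LocallyOfFiniteType.isLocallyNoetherian (L.space₂ k ↘ Spec (.of k))
  have := LocallyOfFiniteType.jacobsonSpace (L.space₂ k ↘ Spec (.of k))
  obtain ⟨c, c', hne⟩ := exists_pt_ne k (C := C)
  obtain ⟨ch, h⟩ := exists_chart k L c.point 2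
  obtain ⟨ch', h'⟩ := exists_chart k L c'.point 2
  obtain ⟨G, hG, hrange⟩ := L.exists_range_pt₂ k
  let F := L.familyFst k
  let F' := L.familySnd k
  choose σ hσ using F.exists_disc_section ch
  choose σ' hσ' using F'.exists_disc_section ch'
  let p₀ : L.Param₂ k := ⟨0, 0, c, c', hne⟩
  let W : (L.space₂ k).Opens := F.π ⁻¹ᵁ ch.U ⊓ F'.π ⁻¹ᵁ ch'.U
  have hres : ∀ {V : (L.space₂ k).Opens} (hWV : W ≤ V) (s : Γ(L.space₂ k, V)) (p : L.Param₂ k),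
      (L.pt₂ k p).point ∈ W →
      ((L.pt₂ k p).point ∈ (L.space₂ k).basicOpen ((L.space₂ k).presheaf.map (homOfLE hWV).op s) ↔
        (L.pt₂ k p).point ∈ (L.space₂ k).basicOpen s) := by
    intro V hWV s p hp
    have : (L.space₂ k).basicOpen ((L.space₂ k).presheaf.map (homOfLE hWV).op s) =
        W ⊓ (L.space₂ k).basicOpen s := Scheme.basicOpen_res _ s (homOfLE hWV).op
    rw [this]
    exact ⟨fun h => h.2, fun h => ⟨hp, h⟩⟩
  let g : Fin 4 → Γ(L.space₂ k, W) :=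
    ![(L.space₂ k).presheaf.map (homOfLE inf_le_left).op (σ 0),
      (L.space₂ k).presheaf.map (homOfLE inf_le_left).op (σ 1),
      (L.space₂ k).presheaf.map (homOfLE inf_le_right).op (σ' 0),
      (L.space₂ k).presheaf.map (homOfLE inf_le_right).op (σ' 1)]
  have hp₀ : (L.pt₂ k p₀).point ∈ W := ⟨F.mem_preimage (p := p₀) h, F'.mem_preimage (p := p₀) h'⟩
  have h0 : ∀ l, (L.pt₂ k p₀).point ∉ (L.space₂ k).basicOpen (σ l) := fun l hl => by
    refine (F.mem_basicOpen_iff (σ l) (p := p₀) h).mp hl ?_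
    rw [hσ l p₀ h]
    exact ch.coeff_disc_zero c h l
  have h0' : ∀ l, (L.pt₂ k p₀).point ∉ (L.space₂ k).basicOpen (σ' l) := fun l hl => by
    refine (F'.mem_basicOpen_iff (σ' l) (p := p₀) h').mp hl ?_
    rw [hσ' l p₀ h']
    exact ch'.coeff_disc_zero c' h' l
  refine codim_le (d := 4) (L.isInducing_pt₂ k) hG hrange (p₀ := p₀) (W := W) hp₀ g (fun i => ?_)
    L.isClosed_K₂plus fun p hp hpg => ?_
  · fin_cases i
    · exact mt (hres inf_le_left (σ 0) p₀ hp₀).mp (h0 0)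
    · exact mt (hres inf_le_left (σ 1) p₀ hp₀).mp (h0 1)
    · exact mt (hres inf_le_right (σ' 0) p₀ hp₀).mp (h0' 0)
    · exact mt (hres inf_le_right (σ' 1) p₀ hp₀).mp (h0' 1)
  · have hpU : (F.c p).point ∈ ch.U := F.mem_of_mem_preimage hp.1
    have hpU' : (F'.c p).point ∈ ch'.U := F'.mem_of_mem_preimage hp.2
    have e : ∀ l, (L.pt₂ k p).point ∉ (L.space₂ k).basicOpen (σ l) →
        (4 * ch.poly p.c hpU p.a₄ ^ 3 - 27 * ch.poly p.c hpU p.a₆ ^ 2).coeff l = 0 := by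
      intro l hl
      have h1 := mt (F.mem_basicOpen_iff (σ l) (p := p) hpU).mpr hl
      rw [not_not, hσ l p hpU] at h1
      exact h1
    have e' : ∀ l, (L.pt₂ k p).point ∉ (L.space₂ k).basicOpen (σ' l) →
        (4 * ch'.poly p.c' hpU' p.a₄ ^ 3 - 27 * ch'.poly p.c' hpU' p.a₆ ^ 2).coeff l = 0 := by
      intro l hl
      have h1 := mt (F'.mem_basicOpen_iff (σ' l) (p := p) hpU').mpr hl
      rw [not_not, hσ' l p hpU'] at h1
      exact h1
    constructor
    · refine (ch.le_val_disc_iff p.c hpU (n := 2) le_rfl p.a₄ p.a₆).mpr fun l hl => ?_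
      interval_cases l
      · exact e 0 (mt (hres inf_le_left (σ 0) p hp).mpr (hpg 0))
      · exact e 1 (mt (hres inf_le_left (σ 1) p hp).mpr (hpg 1))
    · refine (ch'.le_val_disc_iff p.c' hpU' (n := 2) le_rfl p.a₄ p.a₆).mpr fun l hl => ?_
      interval_cases l
      · exact e' 0 (mt (hres inf_le_right (σ' 0) p hp).mpr (hpg 2))
      · exact e' 1 (mt (hres inf_le_right (σ' 1) p hp).mpr (hpg 3))

end UpperBounds

end LineBundle

/-! ### Lower bounds for the codimensions and the components of 𝒦₂ -/

namespace LineBundle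

variable {k : Type u} [Field k] [IsAlgClosed k] {C : Scheme.{u}} [C.Over (Spec (.of k))]
    [AlgebraicGeometry.IsIntegral C] [IsProper (C ↘ Spec (.of k))]
    [SmoothOfRelativeDimension 1 (C ↘ Spec (.of k))] {L : LineBundle C}

section ExactPoints

lemma exists_any_not_singular (hL : (genus k C : ℤ) + 1 ≤ 2 * Places.deg (L.divisor k))
    (hk2 : (2 : k) ≠ 0) (hk3 : (3 : k) ≠ 0) {τ : FibreType} {x : k} (hx : τ.G x ≠ 0) :
    ∃ p ∈ L.typeLocus k .any τ, ¬ 1 ≤ (L.pow 12).val (L.disc p.a₄ p.a₆) p.c.point := by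
  obtain ⟨c, c', hne⟩ := exists_pt_ne k (C := C)
  obtain ⟨ch, h⟩ := exists_chart k L c.point 2
  obtain ⟨ch', h'⟩ := exists_chart k L c'.point 2
  -- With a₄(c) = 1 and a₆(c) = 0 the value of Δ at c is 4.
  obtain ⟨a₄, a₆, ⟨h1, -, h3, -⟩, hf⟩ := exists_fits hL ch ch' hne h h' 1 0 0 0 τ x 0 0
  refine ⟨⟨a₄, a₆, c, c', hne⟩,
    ⟨trivial, (ch'.holds_iff_fits hk2 hk3 h' τ a₄ a₆).mpr ⟨x, 0, 0, hx, hf⟩⟩, ?_⟩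
  rw [ch.one_le_val_disc_iff c h a₄ a₆ le_rfl, h1, h3]
  intro h0
  have : (2 : k) * 2 = 0 := by linear_combination h0
  exact mul_ne_zero hk2 hk2 this

lemma exists_singular_not_two_le (hL : (genus k C : ℤ) + 1 ≤ 2 * Places.deg (L.divisor k))
    (hk2 : (2 : k) ≠ 0) (hk3 : (3 : k) ≠ 0) {τ : FibreType} {x : k} (hx : τ.G x ≠ 0) :
    ∃ p ∈ L.typeLocus k .singular τ, ¬ 2 ≤ (L.pow 12).val (L.disc p.a₄ p.a₆) p.c.point := by
  obtain ⟨c, c', hne⟩ := exists_pt_ne k (C := C)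
  obtain ⟨ch, h⟩ := exists_chart k L c.point 2
  obtain ⟨ch', h'⟩ := exists_chart k L c'.point 2
  -- The values (3, 2) lie on the cubic, at x = 1. With α' = 0 and β' = 1 the linear coefficient of
  -- Δ is −108.
  obtain ⟨a₄, a₆, ⟨h1, h2, h3, h4⟩, hf⟩ := exists_fits hL ch ch' hne h h' 3 0 2 1 τ x 0 0
  refine ⟨⟨a₄, a₆, c, c', hne⟩,
    ⟨(ch.one_le_val_disc_iff c h a₄ a₆ le_rfl).mpr ?_,
      (ch'.holds_iff_fits hk2 hk3 h' τ a₄ a₆).mpr ⟨x, 0, 0, hx, hf⟩⟩, ?_⟩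
  · rw [h1, h3]
    norm_num
  · rw [ch.two_le_val_disc_iff c h a₄ a₆ le_rfl, h1, h2, h3, h4]
    rintro ⟨-, h0⟩
    have : (2 : k) * 2 * (3 * 3 * 3) = 0 := by linear_combination -h0
    exact mul_ne_zero (mul_ne_zero hk2 hk2) (mul_ne_zero (mul_ne_zero hk3 hk3) hk3) this

lemma exists_cusp (hL : (genus k C : ℤ) + 1 ≤ 2 * Places.deg (L.divisor k)) {c : Pt k C} {d : ℕ}
    (ch : L.Chart k d) (h : c.point ∈ ch.U) (hd : 2 ≤ d) : ∃ a₆ : L.V k 6,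
      (c.eval ch.U h (ch.jet 6 0 a₆) = 0 ∧ c.eval ch.U h (ch.jet 6 1 a₆) = 1) ∧
      FibreType.cusp.Holds (0 : L.V k 4) a₆ c := by
  obtain ⟨c', -, hc'⟩ := exists_pt_mem_of_finite (k := k) (C := C) isOpen_univ Set.univ_nonempty
    (Set.finite_singleton c)
  have hne : c ≠ c' := fun h => hc' h.symm
  obtain ⟨ch', h'⟩ := exists_chart k L c'.point 2
  obtain ⟨a₆, h₆, -⟩ := Chart.exists_jet_eq ch ch' (r := 6) (n := 2) (n' := 0)
    (by push_cast; linarith) hd (Nat.zero_le _) hne h h' (fun l => if l = 0 then 0 else 1)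
    (fun _ => 0)
  have h0 : c.eval ch.U h (ch.jet 6 0 a₆) = 0 := h₆ 0 two_pos
  have h1 : c.eval ch.U h (ch.jet 6 1 a₆) = 1 := h₆ 1 one_lt_two
  refine ⟨a₆, ⟨h0, h1⟩, (ch.two_le_val_disc_iff c h 0 a₆ hd).mpr ?_,
    (ch.one_le_val_six_iff c h a₆ hd).mpr h0⟩
  rw [h0, map_zero, map_zero]
  simp

/-- If a₄ = 0 and a₆ has a simple zero at c with derivative 1, the quadratic coefficient of Δ is
−27. -/
lemma exists_cusp_not_three_le (hL : (genus k C : ℤ) + 1 ≤ 2 * Places.deg (L.divisor k))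
    (hk3 : (3 : k) ≠ 0) : ∃ p ∈ L.typeLocus₁ k .cusp,
      ¬ 3 ≤ (L.pow 12).val (L.disc p.a₄ p.a₆) p.c.point := by
  obtain ⟨c, -, -⟩ := exists_pt_ne k (C := C)
  obtain ⟨ch, h⟩ := exists_chart k L c.point 3
  obtain ⟨a₆, ⟨h0, h1⟩, hcusp⟩ := exists_cusp hL ch h (by norm_num)
  refine ⟨⟨0, a₆, c⟩, hcusp, fun h3 => ?_⟩
  have h2 := (ch.le_val_disc_iff c h (n := 3) le_rfl 0 a₆).mp h3 2 (by norm_num)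
  rw [coeff_two_disc, ch.coeff_poly c h a₆ (by norm_num), ch.coeff_poly c h a₆ (by norm_num),
    ch.coeff_poly c h a₆ (by norm_num), ch.coeff_poly c h (0 : L.V k 4) (by norm_num),
    ch.coeff_poly c h (0 : L.V k 4) (by norm_num), h0, h1] at h2
  simp only [map_zero] at h2
  have : (3 : k) * 3 * 3 = 0 := by linear_combination -h2
  exact mul_ne_zero (mul_ne_zero hk3 hk3) hk3 this

lemma exists_node_not_three_le (hL : (genus k C : ℤ) + 1 ≤ 2 * Places.deg (L.divisor k))
    (hk2 : (2 : k) ≠ 0) (hk3 : (3 : k) ≠ 0) : ∃ p ∈ L.typeLocus₁ k .node,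
      ¬ 3 ≤ (L.pow 12).val (L.disc p.a₄ p.a₆) p.c.point := by
  obtain ⟨c, c', hne⟩ := exists_pt_ne k (C := C)
  obtain ⟨ch, h⟩ := exists_chart k L c.point 3
  obtain ⟨ch', h'⟩ := exists_chart k L c'.point 2
  obtain ⟨a₄, h₄, -⟩ := Chart.exists_jet_eq ch ch' (r := 4) (n := 2) (n' := 0)
    (by push_cast; linarith) (by norm_num) (Nat.zero_le _) hne h h'
    (fun l => if l = 0 then 3 else 0) (fun _ => 0)
  -- At values (3, 2) with vanishing first derivatives the quadratic coefficient of Δ is 108 times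
  -- the difference of the quadratic coefficients of a₄ and a₆. The latter is chosen so that the
  -- difference is −1.
  obtain ⟨a₆, h₆, -⟩ := Chart.exists_jet_eq ch ch' (r := 6) (n := 3) (n' := 0)
    (by push_cast; linarith) le_rfl (Nat.zero_le _) hne h h'
    (fun l => if l = 0 then 2 else if l = 1 then 0 else c.eval ch.U h (ch.jet 4 2 a₄) + 1)
    (fun _ => 0)
  have e₀ : c.eval ch.U h (ch.jet 4 0 a₄) = 3 := h₄ 0 two_pos
  have e₁ : c.eval ch.U h (ch.jet 4 1 a₄) = 0 := h₄ 1 one_lt_two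
  have f₀ : c.eval ch.U h (ch.jet 6 0 a₆) = 2 := h₆ 0 (by norm_num)
  have f₁ : c.eval ch.U h (ch.jet 6 1 a₆) = 0 := h₆ 1 (by norm_num)
  have f₂ : c.eval ch.U h (ch.jet 6 2 a₆) = c.eval ch.U h (ch.jet 4 2 a₄) + 1 := h₆ 2 (by norm_num)
  refine ⟨⟨a₄, a₆, c⟩, ⟨(ch.two_le_val_disc_iff c h a₄ a₆ (by norm_num)).mpr ?_, ?_⟩, fun h3 => ?_⟩
  · rw [e₀, e₁, f₀, f₁]
    norm_num
  · by_contra hv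
    have := (ch.one_le_val_six_iff c h a₆ (by norm_num)).mp
      (Order.one_le_iff_pos.mpr (pos_iff_ne_zero.mpr hv))
    rw [f₀] at this
    exact hk2 this
  · have h2 := (ch.le_val_disc_iff c h (n := 3) le_rfl a₄ a₆).mp h3 2 (by norm_num)
    rw [coeff_two_disc, ch.coeff_poly c h a₆ (by norm_num), ch.coeff_poly c h a₆ (by norm_num),
      ch.coeff_poly c h a₆ (by norm_num), ch.coeff_poly c h a₄ (by norm_num),
      ch.coeff_poly c h a₄ (by norm_num), ch.coeff_poly c h a₄ (by norm_num), e₀, e₁, f₀, f₁, f₂]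
      at h2
    have : (2 : k) * 2 * (3 * 3 * 3) = 0 := by linear_combination -h2
    exact mul_ne_zero (mul_ne_zero hk2 hk2) (mul_ne_zero (mul_ne_zero hk3 hk3) hk3) this

end ExactPoints

section OnePoint

/-- The locus is the continuous image, under forgetting the second point, of the two-point locus
with no condition at the second point. -/
lemma isIrreducible_typeLocus₁ (hL : (genus k C : ℤ) + 1 ≤ 2 * Places.deg (L.divisor k))
    (hk2 : (2 : k) ≠ 0) (hk3 : (3 : k) ≠ 0) (τ : FibreType) : IsIrreducible (L.typeLocus₁ k τ) := by
  have h1 := (isIrreducible_typeLocus hL hk2 hk3 τ .any).image Param₂.forget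
    Param₂.continuous_forget.continuousOn
  convert h1
  refine subset_antisymm (fun p hp => ?_) ?_
  · obtain ⟨c', -, hc'⟩ := exists_pt_mem_of_finite (k := k) (C := C) isOpen_univ Set.univ_nonempty
      (Set.finite_singleton p.c)
    exact ⟨⟨p.a₄, p.a₆, p.c, c', fun h => hc' h.symm⟩, ⟨hp, trivial⟩, rfl⟩
  · rintro _ ⟨p, hp, rfl⟩
    exact hp.1

variable [FiniteDimensional k (L.V k 4)] [FiniteDimensional k (L.V k 6)]

/-- The strict chain any ⊃ singular ⊃ node or cusp of closures settles d ≤ 2, as an irreducible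
subset of 𝒦₂ lies in the closure of the nodes or in that of the cusps. For d = 3 the inclusion is
strict, since each of the two contains a point where val_c(Δ) is exactly 2. -/
lemma le_codim_K (hL : (genus k C : ℤ) + 1 ≤ 2 * Places.deg (L.divisor k))
    (hk2 : (2 : k) ≠ 0) (hk3 : (3 : k) ≠ 0) {d : ℕ} (hd : d ≤ 3) : d ≤ codim (L.K k d) := by
  let I (τ : FibreType) := closureIrr (isIrreducible_typeLocus₁ (L := L) hL hk2 hk3 τ)
  have hG : ∀ τ : FibreType, τ.G (1 : k) ≠ 0 := fun τ => by cases τ <;> simp [FibreType.G]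
  have h1 : ((1 : ℕ) : ℕ∞) ≤ Order.coheight (I .singular) := by
    obtain ⟨p, hp, hp'⟩ := exists_any_not_singular hL hk2 hk3 (hG .any)
    refine add_one_le_coheight (B := I .any) (n := 0) ?_ bot_le
    exact closure_ssubset_closure (p := p.forget) (fun _ _ => trivial) (L.isClosed_K 1)
      (fun _ h => h) trivial hp'
  have h2 : ∀ τ : FibreType, τ = .node ∨ τ = .cusp → ((2 : ℕ) : ℕ∞) ≤ Order.coheight (I τ) := by
    intro τ hτ
    obtain ⟨p, hp, hp'⟩ := exists_singular_not_two_le hL hk2 hk3 (hG .any)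
    refine add_one_le_coheight (B := I .singular) ?_ h1
    exact closure_ssubset_closure (p := p.forget)
      (fun _ h => FibreType.Holds.singular_of_two_le (h.two_le hτ)) (L.isClosed_K 2)
      (fun _ h => h.two_le hτ) hp.1 hp'
  have hcover : ∀ T : IrreducibleCloseds (L.Param k), (T : Set (L.Param k)) ⊆ L.K k 2 →
      ∃ τ, (τ = FibreType.node ∨ τ = .cusp) ∧ (T : Set (L.Param k)) ⊆ I τ := by
    intro T hT
    rcases isPreirreducible_iff_isClosed_union_isClosed.mp T.isIrreducible'.2 (I .node) (I .cusp)
      (I .node).isClosed' (I .cusp).isClosed' (fun p hp =>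
        (FibreType.node_or_cusp (hT hp)).imp (fun h => subset_closure h)
          (fun h => subset_closure h)) with h | h
    · exact ⟨_, Or.inl rfl, h⟩
    · exact ⟨_, Or.inr rfl, h⟩
  refine le_iInf₂ fun T hT => ?_
  interval_cases d
  · exact bot_le
  · exact le_coheight_of_subset (hT.trans subset_closure) h1
  · obtain ⟨τ, hτ, h⟩ := hcover T hT
    exact le_coheight_of_subset h (h2 τ hτ)
  · obtain ⟨τ, hτ, h⟩ := hcover T fun p hp =>
      (Nat.cast_le.mpr (by norm_num : 2 ≤ 3) : ((2 : ℕ) : ℕ∞) ≤ (3 : ℕ)).trans (hT hp)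
    refine add_one_le_coheight (B := I τ) ⟨h, fun h' => ?_⟩ (h2 τ hτ)
    obtain ⟨p, hp, hp'⟩ : ∃ p ∈ L.typeLocus₁ k τ,
        ¬ 3 ≤ (L.pow 12).val (L.disc p.a₄ p.a₆) p.c.point := by
      rcases hτ with rfl | rfl
      · exact exists_node_not_three_le hL hk2 hk3
      · exact exists_cusp_not_three_le hL hk3
    exact hp' (hT (h' (subset_closure hp)))

/-- Not every cusp is a limit of nodes. -/
lemma exists_cusp_notMem_closure (hL : (genus k C : ℤ) + 1 ≤ 2 * Places.deg (L.divisor k))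
    (hk2 : (2 : k) ≠ 0) (hk3 : (3 : k) ≠ 0) :
    ∃ p ∈ L.typeLocus₁ k .cusp, p ∉ closure (L.typeLocus₁ k .node) := by
  obtain ⟨c, -, -⟩ := exists_pt_ne k (C := C)
  obtain ⟨ch, h⟩ := exists_chart k L c.point 2
  obtain ⟨a₆, ⟨h0, h1⟩, hcusp⟩ := exists_cusp hL ch h le_rfl
  let p₀ : L.Param k := ⟨0, a₆, c⟩
  refine ⟨p₀, hcusp, fun hcl => ?_⟩
  let F := L.family k
  obtain ⟨σ, hσ⟩ := F.exists_jet_section_four ch 0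
  obtain ⟨σ', hσ'⟩ := F.exists_jet_section_four ch 1
  obtain ⟨ρ, hρ⟩ := F.exists_jet_section_six ch 1
  -- The separating function is 3β'² − αα'². It vanishes on nodes, where α = 3x² and β' = xα', and
  -- equals 3 at the chosen cusp, where α = 0 and β' = 1.
  have key : ∀ (p : L.Param k) (hp : p.c.point ∈ ch.U),
      (F.pt p).point ∈ F.X.basicOpen (3 * ρ ^ 2 - σ * σ' ^ 2) ↔
        3 * p.c.eval ch.U hp (ch.jet 6 1 p.a₆) ^ 2 -
          p.c.eval ch.U hp (ch.jet 4 0 p.a₄) * p.c.eval ch.U hp (ch.jet 4 1 p.a₄) ^ 2 ≠ 0 := by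
    intro p hp
    rw [F.mem_basicOpen_iff _ hp]
    simp only [map_sub, map_mul, map_pow, map_ofNat, hσ p hp, hσ' p hp, hρ p hp]
    rfl
  obtain ⟨p, hpO, hp⟩ := mem_closure_iff.mp hcl
    ((fun p => (F.pt p).point) ⁻¹' F.X.basicOpen (3 * ρ ^ 2 - σ * σ' ^ 2))
    ((F.X.basicOpen _).isOpen.preimage F.cont) ((key p₀ h).mpr (by
      simp only [p₀, h1, map_zero]
      simpa using hk3))
  have hpU : p.c.point ∈ ch.U := F.mem_of_mem_preimage (F.X.basicOpen_le _ hpO)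
  refine (key p hpU).mp hpO ?_
  obtain ⟨x, y, z, -, e0, -, e1⟩ := (ch.holds_iff_fits hk2 hk3 hpU .node p.a₄ p.a₆).mp hp
  rw [e0, e1]
  simp only [FibreType.A, FibreType.b, FibreType.M]
  ring

theorem irreducibleComponents_K_two (hL : (genus k C : ℤ) + 1 ≤ 2 * Places.deg (L.divisor k))
    (hk2 : (2 : k) ≠ 0) (hk3 : (3 : k) ≠ 0) :
    irreducibleComponents (L.K k 2) = {L.K₂I₂ k, L.K₂II k} ∧ L.K₂I₂ k ≠ L.K₂II k := by
  let N : Set (L.K k 2) := {p | (L.pow 6).val p.1.a₆ p.1.c.point = 0}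
  have hN : Subtype.val '' N = L.typeLocus₁ k .node := by
    refine subset_antisymm ?_ fun p hp => ⟨⟨p, hp.1⟩, hp.2, rfl⟩
    rintro _ ⟨p, hp, rfl⟩
    exact ⟨p.2, hp⟩
  have hII : Subtype.val '' L.K₂II k = L.typeLocus₁ k .cusp := by
    refine subset_antisymm ?_ fun p hp => ⟨⟨p, hp.1⟩, hp.2, rfl⟩
    rintro _ ⟨p, hp, rfl⟩
    exact ⟨p.2, hp⟩
  have hNirr : IsIrreducible N := isIrreducible_of_image Topology.IsInducing.subtypeVal
    (hN ▸ isIrreducible_typeLocus₁ hL hk2 hk3 .node)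
  have hIIirr : IsIrreducible (L.K₂II k) := isIrreducible_of_image Topology.IsInducing.subtypeVal
    (hII ▸ isIrreducible_typeLocus₁ hL hk2 hk3 .cusp)
  have hIIcl : IsClosed (L.K₂II k) :=
    (L.family k).isClosed_one_le_val_six.preimage continuous_subtype_val
  have h1 : ¬ L.K₂I₂ k ⊆ L.K₂II k := by
    intro h
    obtain ⟨p, hp⟩ := hNirr.1
    have h2 : 1 ≤ (L.pow 6).val p.1.a₆ p.1.c.point := h (subset_closure hp)
    have h3 : (L.pow 6).val p.1.a₆ p.1.c.point = 0 := hp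
    rw [h3] at h2
    exact not_lt_of_ge h2 one_pos
  have h2 : ¬ L.K₂II k ⊆ L.K₂I₂ k := by
    intro h
    obtain ⟨p, hp, hpN⟩ := exists_cusp_notMem_closure hL hk2 hk3
    rw [← hII] at hp
    obtain ⟨p, hp, rfl⟩ := hp
    refine hpN ?_
    rw [← hN]
    exact image_closure_subset_closure_image continuous_subtype_val ⟨p, h hp, rfl⟩
  refine ⟨irreducibleComponents_eq_pair hNirr.closure isClosed_closure hIIirr hIIcl ?_ h1 h2,
    fun h => h1 h.le⟩
  refine Set.eq_univ_of_forall fun p => ?_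
  rcases FibreType.node_or_cusp p.2 with h | h
  · exact Or.inl (subset_closure h.2)
  · exact Or.inr h.2

end OnePoint

section TwoPoints

variable [FiniteDimensional k (L.V k 4)] [FiniteDimensional k (L.V k 6)]

/-- The conditions are imposed first at one point and then at the other: (any, any) ⊃ (singular,
any) ⊃ (τ, any) ⊃ (τ, singular) ⊃ (τ, τ') with τ and τ' each node or cusp. The four last loci cover
𝒦₂⁺. -/
lemma le_codim_K₂plus (hL : (genus k C : ℤ) + 1 ≤ 2 * Places.deg (L.divisor k))
    (hk2 : (2 : k) ≠ 0) (hk3 : (3 : k) ≠ 0) : 4 ≤ codim (L.K₂plus k) := by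
  let I (τ τ' : FibreType) := closureIrr (isIrreducible_typeLocus (L := L) hL hk2 hk3 τ τ')
  have hG : ∀ τ : FibreType, τ.G (1 : k) ≠ 0 := fun τ => by cases τ <;> simp [FibreType.G]
  have h1 : ((1 : ℕ) : ℕ∞) ≤ Order.coheight (I .singular .any) := by
    obtain ⟨p, hp, hp'⟩ := exists_any_not_singular hL hk2 hk3 (hG .any)
    refine add_one_le_coheight (B := I .any .any) (n := 0) ?_ bot_le
    exact closure_ssubset_closure (p := p) (fun _ _ => ⟨trivial, trivial⟩) (L.isClosed_fst 1)
      (fun _ h => h.1) hp hp'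
  have h2 : ∀ τ : FibreType, τ = .node ∨ τ = .cusp →
      ((2 : ℕ) : ℕ∞) ≤ Order.coheight (I τ .any) := by
    intro τ hτ
    obtain ⟨p, hp, hp'⟩ := exists_singular_not_two_le hL hk2 hk3 (hG .any)
    refine add_one_le_coheight (B := I .singular .any) ?_ h1
    exact closure_ssubset_closure (p := p)
      (fun _ h => ⟨FibreType.Holds.singular_of_two_le (h.1.two_le hτ), trivial⟩) (L.isClosed_fst 2)
      (fun _ h => h.1.two_le hτ) hp hp'
  have h3 : ∀ τ : FibreType, τ = .node ∨ τ = .cusp →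
      ((3 : ℕ) : ℕ∞) ≤ Order.coheight (I τ .singular) := by
    intro τ hτ
    obtain ⟨p, hp, hp'⟩ := exists_any_not_singular hL hk2 hk3 (hG τ)
    refine add_one_le_coheight (B := I τ .any) ?_ (h2 τ hτ)
    -- The witness was built with the nonsingular point first and type τ second, so its points are
    -- exchanged.
    exact closure_ssubset_closure (p := p.swap) (fun _ h => ⟨h.1, trivial⟩) (L.isClosed_snd 1)
      (fun _ h => h.2) ⟨hp.2, hp.1⟩ hp'
  have h4 : ∀ τ τ' : FibreType, τ = .node ∨ τ = .cusp → τ' = .node ∨ τ' = .cusp →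
      ((4 : ℕ) : ℕ∞) ≤ Order.coheight (I τ τ') := by
    intro τ τ' hτ hτ'
    obtain ⟨p, hp, hp'⟩ := exists_singular_not_two_le hL hk2 hk3 (hG τ)
    refine add_one_le_coheight (B := I τ .singular) ?_ (h3 τ hτ)
    exact closure_ssubset_closure (p := p.swap)
      (fun _ h => ⟨h.1, FibreType.Holds.singular_of_two_le (h.2.two_le hτ')⟩) (L.isClosed_snd 2)
      (fun _ h => h.2.two_le hτ') ⟨hp.2, hp.1⟩ hp'
  refine le_iInf₂ fun T hT => ?_
  have hun := isPreirreducible_iff_isClosed_union_isClosed.mp T.isIrreducible'.2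
  have hcl : ∀ τ τ', IsClosed (I τ τ' : Set (L.Param₂ k)) := fun τ τ' => (I τ τ').isClosed'
  rcases hun (I .node .node ∪ I .node .cusp) (I .cusp .node ∪ I .cusp .cusp)
      ((hcl _ _).union (hcl _ _)) ((hcl _ _).union (hcl _ _)) (fun p hp => by
        rcases FibreType.node_or_cusp (hT hp).1 with h | h <;>
        rcases FibreType.node_or_cusp (hT hp).2 with h' | h'
        · exact Or.inl (Or.inl (subset_closure ⟨h, h'⟩))
        · exact Or.inl (Or.inr (subset_closure ⟨h, h'⟩))
        · exact Or.inr (Or.inl (subset_closure ⟨h, h'⟩))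
        · exact Or.inr (Or.inr (subset_closure ⟨h, h'⟩))) with h | h <;>
    rcases hun _ _ (hcl _ _) (hcl _ _) h with h | h
  · exact le_coheight_of_subset h (h4 _ _ (Or.inl rfl) (Or.inl rfl))
  · exact le_coheight_of_subset h (h4 _ _ (Or.inl rfl) (Or.inr rfl))
  · exact le_coheight_of_subset h (h4 _ _ (Or.inr rfl) (Or.inl rfl))
  · exact le_coheight_of_subset h (h4 _ _ (Or.inr rfl) (Or.inr rfl))

end TwoPoints

end LineBundle

end EllBertini

end

theorem mainTheorem9 (k : Type u) [Field k] [IsAlgClosed k]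
    (hk2 : ringChar k ≠ 2) (hk3 : ringChar k ≠ 3)
    (C : Scheme.{u}) [C.Over (Spec (.of k))] [AlgebraicGeometry.IsIntegral C]
    [IsProper (C ↘ Spec (.of k))] [SmoothOfRelativeDimension 1 (C ↘ Spec (.of k))]
    (L : EllBertini.LineBundle C)
    (hL : (EllBertini.genus k C : ℤ) + 1 ≤ 2 * L.degree k) :
    ((∀ d : ℕ, IsClosed (L.K k d)) ∧ IsClosed (L.K₂plus k)) ∧
    (∀ d : ℕ, d ≤ 3 → EllBertini.codim (L.K k d) = d) ∧
    (irreducibleComponents (L.K k 2) = {L.K₂I₂ k, L.K₂II k} ∧ L.K₂I₂ k ≠ L.K₂II k) ∧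
    EllBertini.codim (L.K₂plus k) = 4 := by
  have h2 : (2 : k) ≠ 0 := Ring.two_ne_zero hk2
  have h3 : (3 : k) ≠ 0 := by
    intro h
    have h1 : ringChar k ∣ 3 := (ringChar.spec k 3).mp (by exact_mod_cast h)
    rcases (Nat.dvd_prime Nat.prime_three).mp h1 with h | h
    · exact CharP.ringChar_ne_one h
    · exact hk3 h
  have hdeg := L.degree_eq k
  rw [hdeg] at hL
  have := L.finiteDimensional_V k 4
  have := L.finiteDimensional_V k 6
  refine ⟨⟨L.isClosed_K, L.isClosed_K₂plus⟩, fun d hd => ?_,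
    EllBertini.LineBundle.irreducibleComponents_K_two hL h2 h3, ?_⟩
  · exact le_antisymm (L.codim_K_le k d) (EllBertini.LineBundle.le_codim_K hL h2 h3 hd)
  · exact le_antisymm (L.codim_K₂plus_le k) (EllBertini.LineBundle.le_codim_K₂plus hL h2 h3)
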